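/- **Conventions.** Complex manifolds are Hausdorff, second countable and non-empty. Let $\sigma_p=i^{p^2}2^{-p}$. A real $(p,p)$-form $\Omega$ on a complex manifold is *transverse* if at every point $\Omega(\sigma_p^{-1}V\wedge\overline V)>0$ for every simple $(p,0)$-vector $V\ne0$ (i.e. $\Omega$ restricts to a strictly positive volume form on every complex $p$-dimensional subspace of the tangent space). It is *positive* (has non-negative eigenvalues) if at every point $\Omega=\sigma_p\sum_j\eta_j\wedge\overline{\eta_j}$ for finitely many $(p,0)$-covectors $\eta_j$. All forms are smooth. A complex manifold $M$ is * $p$-Kähler (pK) if it has a transverse real $(p,p)$-form $\Omega$ with $d\Omega=0$; * weakly $p$-Kähler (pWK) if it has a transverse real $(p,p)$-form $\Omega$ with $\partial\Omega=\partial\bar\partial\alpha$ for some form $\alpha$; * $p$-symplectic (pS) if it has a closed real $2p$-form whose $(p,p)$-component $\Omega$ is transverse; * $p$-pluriclosed (pPL) if it has a transverse real $(p,p)$-form $\Omega$ with $\partial\bar\partial\Omega=0$. Fix one of these four types $\tau\in\{K,WK,S,PL\}$; "$p$-Kähler", in quotation marks, means $p\tau$, and $\Omega$ is then called a "$p$-Kähler"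 form. Let $X,Y$ be complex manifolds of dimensions $m,n\ge1$. **Situation A** (with indices $1\le p\le m$, $1\le q\le n$, $(p,q)\neq(1,1)$). There are positive "$s$-Kähler" forms $\Omega_s$ on $X$ for $p\le s<m$ and positive "$s$-Kähler" forms $\Phi_s$ on $Y$ for $q\le s<n$ such that: if $m-p\le n-q$, then for every $1\le a<m-p$ either $\partial\Omega_{p+a}=0$ or $\partial\Phi_r=0$ for all $n-a\le r\le n-1$; if $m-p>n-q$, then for every $1\le a<n-q$ either $\partial\Phi_{q+a}=0$ or $\partial\Omega_r=0$ for all $m-a\le r\le m-1$. The indices are minimal: $X$ is not "$(p-1)$-Kähler" if $p\ge2$, and $Y$ is not "$(q-1)$-Kähler" if $q\ge2$. Moreover $p\ne1$ if $m-p<n-q$, and $q\neq1$ if $n-q<m-p$. In this situation it is known that $X\times Y$ is "$s$-Kähler" for all $B_A\le s<m+n$, where $$B_A=m+n-\min(m-p,n-q).$$ **Situation B** (with an index $2\le q\le n$, i.e. $(p,q)\ne(1,1)$ for $p=1$). $X$ is Kähler (1K), $Y$ is "$s$-Kähler" for all $q\le s<n$, and $Y$ is not "$(q-1)$-Kähler".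 In this situation it is known that $X\times Y$ is "$s$-Kähler" for all $B_B\le s<m+n$, where $$B_B=m+q.$$ **Proposition.** The bounds $B_A$ and $B_B$ are sharp when both manifolds are compact, and not in general otherwise: 1. Let $X$ and $Y$ be compact. In Situation A, $X\times Y$ is not "$(B_A-1)$-Kähler". In Situation B, $X\times Y$ is not "$(B_B-1)$-Kähler". 2. There are a connected non-compact complex manifold $X$, a connected compact complex manifold $Y$ and indices $p,q$ such that, for each of the four types $\tau$, both Situation A (with $p,q$) and Situation B (with $q$) hold, while $X\times Y$ is "$(B_A-1)$-Kähler" and "$(B_B-1)$-Kähler". Also, for each of the four types, Situation A holds for $(Y,X)$ with the indices $(q,p)$, while $Y\times X$ is "$(B_A-1)$-Kähler"; so in Situation A compactness of neither factor can be dropped. -/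

import Mathlib

open scoped Manifold ContDiff

noncomputable section

namespace GenKahler

/-! ### Multilinear algebra: types of forms and positivity

A complex-valued `k`-covector on the complex vector space `E` is a real-multilinear alternating map
`E [⋀^Fin k]→L[ℝ] ℂ`. -/

section Linear

variable {E : Type*} [NormedAddCommGroup E] [NormedSpace ℂ E]

/-- `η` has bidegree `(a, b)`: for `a + b = k`, the `k`-covectors of bidegree `(a, b)` are those on
which multiplication of all the arguments by `c ∈ ℂ` acts as multiplication by `c ^ a * c̄ ^ b`. -/
def HasBidegree {k : ℕ} (a b : ℕ) (η : E [⋀^Fin k]→L[ℝ] ℂ) : Prop :=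
  a + b = k ∧
    ∀ (c : ℂ) (v : Fin k → E), η (fun i => c • v i) = c ^ a * (starRingEnd ℂ c) ^ b * η v

/-- The tuple `(v₀, i v₀, v₁, i v₁, …, v_{p-1}, i v_{p-1})`. -/
def complexFrame {p : ℕ} (v : Fin p → E) : Fin (2 * p) → E := fun j =>
  (if (j : ℕ) % 2 = 0 then (1 : ℂ) else Complex.I) • v ⟨(j : ℕ) / 2, by omega⟩

/-- A `(p, p)`-covector is transverse (strictly weakly positive) if `Ω(σ_p⁻¹ V ∧ V̄) > 0` for every
nonzero simple `(p, 0)`-vector `V`, that is, if it restricts to a strictly positive volume form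
on every complex subspace of dimension `p`. If `V` is the wedge product of the `(1, 0)`-vectors
`(v_j - i J v_j) / 2`, then `σ_p⁻¹ V ∧ V̄ = v₀ ∧ J v₀ ∧ … ∧ v_{p-1} ∧ J v_{p-1}`. -/
def IsTransverseAt {p : ℕ} (Ω : E [⋀^Fin (2 * p)]→L[ℝ] ℂ) : Prop :=
  ∀ v : Fin p → E, LinearIndependent ℂ v → 0 < (Ω (complexFrame v)).re

/-- The wedge product `η ∧ η̄` of a `(p, 0)`-covector `η` and its conjugate; its arguments are
indexed by `Fin p ⊕ Fin p`. -/
def wedgeConj {p : ℕ} (η : E [⋀^Fin p]→L[ℂ] ℂ) : E [⋀^Fin p ⊕ Fin p]→ₗ[ℝ] ℂ :=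
  (LinearMap.mul' ℝ ℂ).compAlternatingMap
    (AlternatingMap.domCoprod (η.restrictScalars ℝ).toAlternatingMap
      (Complex.conjAe.toLinearMap.compAlternatingMap (η.restrictScalars ℝ).toAlternatingMap))

/-- The identification of `Fin (2 * p)` with two consecutive blocks `Fin p ⊕ Fin p`. -/
def blocks (p : ℕ) : Fin (2 * p) ≃ Fin p ⊕ Fin p :=
  (finCongr (two_mul p)).trans finSumFinEquiv.symm

/-- The constant `σ_p = i ^ (p²) 2 ^ (-p)`. -/
def sigma (p : ℕ) : ℂ := Complex.I ^ (p ^ 2) * (2 : ℂ)⁻¹ ^ p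

/-- A `(p, p)`-covector is positive (has non-negative eigenvalues) if it is
`σ_p ∑ η_j ∧ η̄_j` for finitely many `(p, 0)`-covectors `η_j`, not necessarily simple. -/
def IsPositiveAt {p : ℕ} (Ω : E [⋀^Fin (2 * p)]→L[ℝ] ℂ) : Prop :=
  ∃ (N : ℕ) (η : Fin N → E [⋀^Fin p]→L[ℂ] ℂ),
    ∀ v : Fin p ⊕ Fin p → E, Ω (v ∘ blocks p) = sigma p * ∑ j, wedgeConj (η j) v

end Linear

/-! ### Differential forms on a complex manifold -/

section Forms

variable {E : Type*} [NormedAddCommGroup E] [NormedSpace ℂ E]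
  {H : Type*} [TopologicalSpace H] (I : ModelWithCorners ℂ E H)
  {M : Type*} [TopologicalSpace M] [ChartedSpace H M]

/-- A (not necessarily smooth) complex-valued `k`-form on `M`. As for Mathlib's `TangentSpace`, the
tangent space at `x` is identified with `E` through the preferred chart at `x`. -/
abbrev Form (E M : Type*) [NormedAddCommGroup E] [NormedSpace ℂ E] (k : ℕ) : Type _ :=
  M → E [⋀^Fin k]→L[ℝ] ℂ

/-- The expression of a form in the preferred chart at `x₀`, a form on the target of that chart:
at the image `e` of a point `y`, the value of the form at `y` is composed with the derivative at `e`
of the change of coordinates from the chart at `x₀` to the preferred chart at `y`. -/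
def inChart {k : ℕ} (θ : Form E M k) (x₀ : M) (e : E) : E [⋀^Fin k]→L[ℝ] ℂ :=
  (θ ((extChartAt I x₀).symm e)).compContinuousLinearMap
    ((fderivWithin ℂ (extChartAt I ((extChartAt I x₀).symm e) ∘ (extChartAt I x₀).symm)
      (Set.range I) e).restrictScalars ℝ)

/-- Smooth forms. -/
def IsSmooth {k : ℕ} (θ : Form E M k) : Prop :=
  ∀ x₀ : M, ContDiffOn ℝ ∞ (inChart I θ x₀) (extChartAt I x₀).target

/-- The exterior derivative `d`, computed at `x` in the preferred chart at `x`. -/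
def extD {k : ℕ} (θ : Form E M k) : Form E M (k + 1) := fun x =>
  extDeriv (inChart I θ x) (extChartAt I x x)

/-- Pull-back of a form by multiplication by `c ∈ ℂ` on the tangent spaces. For `c = i` it
multiplies forms of bidegree `(a, b)` by `i ^ (a - b)`. -/
def scale {k : ℕ} (c : ℂ) (θ : Form E M k) : Form E M k := fun x =>
  (θ x).compContinuousLinearMap ((c • ContinuousLinearMap.id ℂ E).restrictScalars ℝ)

/-- The operator `d^c = J⁻¹ d J = i (∂̄ - ∂)`, where `J` multiplies forms of bidegree `(a, b)`
by `i ^ (a - b)`. -/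
def extDc {k : ℕ} (θ : Form E M k) : Form E M (k + 1) :=
  scale (-Complex.I) (extD I (scale Complex.I θ))

/-- The operator `∂ = (d + i d^c) / 2`. -/
def del {k : ℕ} (θ : Form E M k) : Form E M (k + 1) :=
  (1 / 2 : ℂ) • (extD I θ + Complex.I • extDc I θ)

/-- The operator `∂̄ = (d - i d^c) / 2`. -/
def delbar {k : ℕ} (θ : Form E M k) : Form E M (k + 1) :=
  (1 / 2 : ℂ) • (extD I θ - Complex.I • extDc I θ)

/-- Real forms. -/
def IsReal {k : ℕ} (θ : Form E M k) : Prop :=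
  ∀ (x : M) (v : Fin k → E), (starRingEnd ℂ) (θ x v) = θ x v

/-- The four classes of generalized `p`-Kähler manifolds. -/
inductive KahlerType
  | kahler
  | weaklyKahler
  | symplectic
  | pluriclosed

/-- The closedness condition imposed on a `(p, p)`-form `Ω` in each of the four classes:
`dΩ = 0`; `∂Ω = ∂∂̄α` for some form `α`; `Ω` is the `(p, p)`-component of a closed real
`2p`-form `Ψ` (whose component of bidegree `(a, 2p - a)` is called `comp a`); `∂∂̄Ω = 0`. -/
def IsClosedOfType {p : ℕ} (Ω : Form E M (2 * p)) : KahlerType → Prop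
  | .kahler => extD I Ω = 0
  | .weaklyKahler =>
      ∃ (k : ℕ) (h : k + 1 + 1 = 2 * p + 1) (α : Form E M k), IsSmooth I α ∧
        ∀ (x : M) (v : Fin (2 * p + 1) → E),
          del I Ω x v = del I (delbar I α) x (v ∘ Fin.cast h)
  | .symplectic =>
      ∃ (Ψ : Form E M (2 * p)) (comp : ℕ → Form E M (2 * p)),
        IsSmooth I Ψ ∧ IsReal Ψ ∧ extD I Ψ = 0 ∧
        (∀ a ≤ 2 * p, ∀ x, HasBidegree a (2 * p - a) (comp a x)) ∧
        Ψ = ∑ a ∈ Finset.range (2 * p + 1), comp a ∧ comp p = Ω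
  | .pluriclosed => del I (delbar I Ω) = 0

/-- `Ω` is a generalized `p`-Kähler form of type `τ`: a smooth real transverse `(p, p)`-form with
the closedness condition of type `τ`. -/
structure IsKahlerForm (τ : KahlerType) {p : ℕ} (Ω : Form E M (2 * p)) : Prop where
  smooth : IsSmooth I Ω
  real : IsReal Ω
  bidegree : ∀ x, HasBidegree p p (Ω x)
  transverse : ∀ x, IsTransverseAt (Ω x)
  closed : IsClosedOfType I Ω τ

variable (M) in
/-- `M` is a generalized `p`-Kähler manifold of type `τ`. -/
def IsPKahler (τ : KahlerType) (p : ℕ) : Prop :=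
  ∃ Ω : Form E M (2 * p), IsKahlerForm I τ Ω

end Forms

/-! ### The two situations in which the product is considered -/

/-- The model of complex manifolds of dimension `n`. -/
abbrev Cn (n : ℕ) : Type := EuclideanSpace ℂ (Fin n)

section Products

variable (τ : KahlerType) (m n p q : ℕ)
  (X : Type*) [TopologicalSpace X] [ChartedSpace (Cn m) X]
  (Y : Type*) [TopologicalSpace Y] [ChartedSpace (Cn n) Y]

/-- The product `X × Y`, a complex manifold of dimension `m + n`, is `s`-Kähler of type `τ`. -/
def ProductIsPKahler (s : ℕ) : Prop :=
  IsPKahler ((𝓘(ℂ, Cn m)).prod 𝓘(ℂ, Cn n)) (X × Y) τ s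

/-- `X` is `s`-Kähler for `p ≤ s < m` and `Y` is `s`-Kähler for `q ≤ s < n` (all of type `τ`),
through forms with non-negative eigenvalues that satisfy the additional closedness conditions
under which the product is `s`-Kähler for `m + n - min (m - p) (n - q) ≤ s < m + n`. -/
def HasPositiveForms : Prop :=
  ∃ (Ω : ∀ s : ℕ, Form (Cn m) X (2 * s)) (Φ : ∀ s : ℕ, Form (Cn n) Y (2 * s)),
    (∀ s, p ≤ s → s < m → IsKahlerForm 𝓘(ℂ, Cn m) τ (Ω s) ∧ ∀ x, IsPositiveAt (Ω s x)) ∧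
    (∀ s, q ≤ s → s < n → IsKahlerForm 𝓘(ℂ, Cn n) τ (Φ s) ∧ ∀ y, IsPositiveAt (Φ s y)) ∧
    (m - p ≤ n - q → ∀ a, 1 ≤ a → a < m - p →
      del 𝓘(ℂ, Cn m) (Ω (p + a)) = 0 ∨
        ∀ r, n - a ≤ r → r ≤ n - 1 → del 𝓘(ℂ, Cn n) (Φ r) = 0) ∧
    (n - q < m - p → ∀ a, 1 ≤ a → a < n - q →
      del 𝓘(ℂ, Cn n) (Φ (q + a)) = 0 ∨
        ∀ r, m - a ≤ r → r ≤ m - 1 → del 𝓘(ℂ, Cn m) (Ω r) = 0)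

/-- The bound `m + n - min (m - p) (n - q)`. -/
def generalBound : ℕ := m + n - min (m - p) (n - q)

/-- The situation in which sharpness of `generalBound m n p q` is discussed: the bound applies,
`(p, q) ≠ (1, 1)`, the indices `p` and `q` cannot be lowered by one, and the minimum of `m - p` and
`n - q` is not attained solely at a factor of index `1`. -/
structure GeneralSetting : Prop where
  one_le_p : 1 ≤ p
  p_le_m : p ≤ m
  one_le_q : 1 ≤ q
  q_le_n : q ≤ n
  ne_one_one : (p, q) ≠ (1, 1)
  left_index : m - p < n - q → p ≠ 1
  right_index : n - q < m - p → q ≠ 1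
  forms : HasPositiveForms τ m n p q X Y
  minimal_left : 2 ≤ p → ¬ IsPKahler 𝓘(ℂ, Cn m) X τ (p - 1)
  minimal_right : 2 ≤ q → ¬ IsPKahler 𝓘(ℂ, Cn n) Y τ (q - 1)

/-- The situation in which sharpness of the bound `m + q` is discussed: `X` is Kähler, `Y` is
`s`-Kähler of type `τ` for `q ≤ s < n`, `(1, q) ≠ (1, 1)`, and `q` cannot be lowered by one. -/
structure KahlerSetting : Prop where
  one_le_m : 1 ≤ m
  one_le_q : 1 ≤ q
  q_le_n : q ≤ n
  ne_one_one : ((1 : ℕ), q) ≠ (1, 1)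
  kahler_left : IsPKahler 𝓘(ℂ, Cn m) X .kahler 1
  kahler_right : ∀ s, q ≤ s → s < n → IsPKahler 𝓘(ℂ, Cn n) Y τ s
  minimal_right : ¬ IsPKahler 𝓘(ℂ, Cn n) Y τ (q - 1)

end Products

end GenKahler

end

/-!
**Sharpness for compact factors.** Let `π : X × Y → X` be the projection and let `Y` be compact of
dimension `n`. Integration along the fibres of `π` takes a form of bidegree `(r + n, r + n)` on the
product to one of bidegree `(r, r)` on `X`. It commutes with `d` by Stokes' theorem on `Y`
(`integralForm_extD`, `fibreIntegral_extD`). The fibres being complex, it also commutes with the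
complex structure, hence with `∂` and `∂̄`. It preserves transversality, because a complex
`r`-dimensional subspace of the tangent space of `X`, together with the tangent space of the fibre,
is a complex `(r + n)`-dimensional subspace. So each of the four closedness conditions descends, and
`X` is `r`-Kähler if `X × Y` is `(r + n)`-Kähler (`ProductCharts.isPKahler_base`). At the degree just
below the bounds this contradicts the minimality of `p` or of `q`, with `X` or `Y` as the base.

**Failure for a non-compact factor.** Take `X = ℂ²` and for `Y` the Iwasawa manifold, the quotient
of the complex Heisenberg group by a lattice, with `p = 1` and `q = 2`. Both bounds are `4`, and
the product must be shown to be `3`-Kähler.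

* The forms that are needed are closed. A closed transverse form is of all four types
  (`IsKahlerForm.of_kahler`). They are sums `∑ⱼ Lⱼ^* vol`, where the `Lⱼ : E → ℂ^p` are made of `p`
  members of the invariant coframe, `dz₀`, `dz₁`, `dz₂ - z₀ dz₁` on the Iwasawa manifold. Such a sum
  is transverse if on each complex `p`-dimensional subspace some `Lⱼ` is invertible. It is closed if
  the products of the chosen members are (`isKahlerForm_descend_volSum`). On the Iwasawa manifold
  all products of two members are closed, which gives a `2`-Kähler form. On the product, with
  coordinates `x₀`, `x₁` of the plane and `x₂ = z₀`, `x₃ = z₁`, `y = z₂`, the only product of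
  three members that is not closed is that of `dx₀`, `dx₁` and `dy - x₂ dx₃`. As the function `x₀`
  is defined on all of the plane, it may be replaced by the closed product of `d(x₀ + x₂)`, `dx₁` and
  `dy - (x₀ + x₂) dx₃` (`TwistedCoframe.exists_isKahlerForm_shift`).
* The Iwasawa manifold is not `1`-Kähler of any type. Each type implies `d d^c Ω = 0` in degree one
  (`extD_extDc_eq_zero`). The average of the lift of `Ω` over a fundamental domain of the lattice is
  a left-invariant form `B` with `d d^c B = 0`. But `d d^c B`, evaluated on `e₀, i e₀, e₁, i e₁`,
  is four times the value of `B` on the centre (`ddcFlat_invForm_frame`), which is positive since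
  `Ω` is transverse (`exists_ddcFlat_ne_zero`).
-/

noncomputable section

namespace GenKahler

/-! ### Forms in charts -/

section Charts

open Set Filter Topology

variable {E : Type*} [NormedAddCommGroup E] [NormedSpace ℂ E]
  {H : Type*} [TopologicalSpace H] (I : ModelWithCorners ℂ E H)
  {M : Type*} [TopologicalSpace M] [ChartedSpace H M]

/-- The change of coordinates from the preferred chart at `x₀` to the preferred chart at `x₁`. -/
def transition (x₀ x₁ : M) : E → E := extChartAt I x₁ ∘ (extChartAt I x₀).symm

/-- The open set on which `transition I x₀ x₁` is defined. -/
def overlap (x₀ x₁ : M) : Set E := ((extChartAt I x₀).symm ≫ extChartAt I x₁).source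

variable {I}

lemma mem_overlap {x₀ x₁ : M} {e : E} :
    e ∈ overlap I x₀ x₁ ↔
      e ∈ (extChartAt I x₀).target ∧ (extChartAt I x₀).symm e ∈ (extChartAt I x₁).source := by
  simp [overlap, PartialEquiv.trans_source]

lemma mem_overlap_self {x₀ : M} {e : E} (he : e ∈ (extChartAt I x₀).target) :
    e ∈ overlap I x₀ ((extChartAt I x₀).symm e) :=
  mem_overlap.2 ⟨he, mem_extChartAt_source _⟩

lemma transition_mem {x₀ x₁ : M} {e : E} (he : e ∈ overlap I x₀ x₁) :
    transition I x₀ x₁ e ∈ (extChartAt I x₁).target :=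
  (extChartAt I x₁).map_source (mem_overlap.1 he).2

lemma symm_transition {x₀ x₁ : M} {e : E} (he : e ∈ overlap I x₀ x₁) :
    (extChartAt I x₁).symm (transition I x₀ x₁ e) = (extChartAt I x₀).symm e :=
  (extChartAt I x₁).left_inv (mem_overlap.1 he).2

lemma transition_mem_overlap {x₀ x₁ : M} {e : E} (he : e ∈ overlap I x₀ x₁) :
    transition I x₀ x₁ e ∈ overlap I x₁ x₀ := by
  refine mem_overlap.2 ⟨transition_mem he, ?_⟩
  rw [symm_transition he]
  exact (extChartAt I x₀).map_target (mem_overlap.1 he).1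

lemma transition_transition {x₀ x₁ : M} {e : E} (he : e ∈ overlap I x₀ x₁) :
    transition I x₁ x₀ (transition I x₀ x₁ e) = e := by
  rw [transition, Function.comp_apply, symm_transition he]
  exact (extChartAt I x₀).right_inv (mem_overlap.1 he).1

lemma isOpen_overlap [I.Boundaryless] (x₀ x₁ : M) : IsOpen (overlap I x₀ x₁) := by
  have : overlap I x₀ x₁ =
      (extChartAt I x₀).target ∩ (extChartAt I x₀).symm ⁻¹' (extChartAt I x₁).source := by
    ext e; exact mem_overlap
  rw [this]
  exact (continuousOn_extChartAt_symm x₀).isOpen_inter_preimage (isOpen_extChartAt_target x₀)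
    (isOpen_extChartAt_source x₁)

lemma contDiffAt_transition [I.Boundaryless] [IsManifold I ω M] {x₀ x₁ : M} {e : E}
    (he : e ∈ overlap I x₀ x₁) : ContDiffAt ℂ ω (transition I x₀ x₁) e :=
  (contDiffOn_ext_coord_change x₁ x₀).contDiffAt ((isOpen_overlap x₀ x₁).mem_nhds he)

lemma differentiableAt_transition [I.Boundaryless] [IsManifold I ω M] {x₀ x₁ : M} {e : E}
    (he : e ∈ overlap I x₀ x₁) : DifferentiableAt ℂ (transition I x₀ x₁) e :=
  (contDiffAt_transition he).differentiableAt (by simp)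

lemma fderiv_real_transition [I.Boundaryless] [IsManifold I ω M] {x₀ x₁ : M} {e : E}
    (he : e ∈ overlap I x₀ x₁) :
    fderiv ℝ (transition I x₀ x₁) e = (fderiv ℂ (transition I x₀ x₁) e).restrictScalars ℝ :=
  (differentiableAt_transition he).fderiv_restrictScalars ℝ

lemma inChart_eq [I.Boundaryless] {k : ℕ} (θ : Form E M k) (x₀ : M) (e : E) :
    inChart I θ x₀ e = (θ ((extChartAt I x₀).symm e)).compContinuousLinearMap
      ((fderiv ℂ (transition I x₀ ((extChartAt I x₀).symm e)) e).restrictScalars ℝ) := by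
  rw [inChart, I.range_eq_univ, fderivWithin_univ]; rfl

lemma transition_comp [I.Boundaryless] {x₀ x₁ x₂ : M} {e : E} (he : e ∈ overlap I x₀ x₁) :
    transition I x₁ x₂ ∘ transition I x₀ x₁ =ᶠ[𝓝 e] transition I x₀ x₂ := by
  filter_upwards [(isOpen_overlap x₀ x₁).mem_nhds he] with e' he'
  simp only [Function.comp_apply, transition]
  rw [(extChartAt I x₁).left_inv (mem_overlap.1 he').2]

lemma fderiv_transition_comp [I.Boundaryless] [IsManifold I ω M] {x₀ x₁ x₂ : M} {e : E}
    (he : e ∈ overlap I x₀ x₁) (h2 : (extChartAt I x₀).symm e ∈ (extChartAt I x₂).source) :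
    fderiv ℂ (transition I x₀ x₂) e =
      (fderiv ℂ (transition I x₁ x₂) (transition I x₀ x₁ e)).comp
        (fderiv ℂ (transition I x₀ x₁) e) := by
  rw [← (transition_comp he).fderiv_eq, fderiv_comp]
  · refine differentiableAt_transition (mem_overlap.2 ⟨transition_mem he, ?_⟩)
    rwa [symm_transition he]
  · exact differentiableAt_transition he

/-- The derivatives of the two changes of coordinates between two charts are inverse. -/
lemma fderiv_transition_fderiv_transition [I.Boundaryless] [IsManifold I ω M] {x₀ x₁ : M} {e : E}
    (he : e ∈ overlap I x₀ x₁) (v : E) :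
    fderiv ℂ (transition I x₁ x₀) (transition I x₀ x₁ e) (fderiv ℂ (transition I x₀ x₁) e v)
      = v := by
  have h := fderiv_transition_comp (x₂ := x₀) he
    ((extChartAt I x₀).map_target (mem_overlap.1 he).1)
  have h' : transition I x₀ x₀ =ᶠ[𝓝 e] id := by
    filter_upwards [extChartAt_target_mem_nhds' (mem_overlap.1 he).1] with e' he'
    exact (extChartAt I x₀).right_inv he'
  rw [h'.fderiv_eq, fderiv_id] at h
  exact (DFunLike.congr_fun h v).symm

lemma injective_fderiv_transition [I.Boundaryless] [IsManifold I ω M] {x₀ x₁ : M} {e : E}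
    (he : e ∈ overlap I x₀ x₁) : Function.Injective (fderiv ℂ (transition I x₀ x₁) e) :=
  Function.LeftInverse.injective (fderiv_transition_fderiv_transition he)

/-- The transformation rule for the local expressions of a form. -/
lemma inChart_transition [I.Boundaryless] [IsManifold I ω M] {k : ℕ} (θ : Form E M k) {x₀ x₁ : M}
    {e : E} (he : e ∈ overlap I x₀ x₁) :
    inChart I θ x₀ e = (inChart I θ x₁ (transition I x₀ x₁ e)).compContinuousLinearMap
      ((fderiv ℂ (transition I x₀ x₁) e).restrictScalars ℝ) := by
  rw [inChart_eq, inChart_eq, symm_transition he, fderiv_transition_comp he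
    (mem_extChartAt_source _)]
  rfl

lemma inChart_self [I.Boundaryless] {k : ℕ} (θ : Form E M k) (x : M) :
    inChart I θ x (extChartAt I x x) = θ x := by
  rw [inChart_eq]
  have hx : (extChartAt I x).symm (extChartAt I x x) = x := extChartAt_to_inv x
  have h' : transition I x x =ᶠ[𝓝 (extChartAt I x x)] id := by
    filter_upwards [extChartAt_target_mem_nhds x] with e' he'
    exact (extChartAt I x).right_inv he'
  rw [hx, h'.fderiv_eq, fderiv_id]
  ext v; rfl

/-- A form is determined by its local expressions. -/
lemma form_ext_inChart [I.Boundaryless] {k : ℕ} {θ θ' : Form E M k}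
    (h : ∀ x, ∀ e ∈ (extChartAt I x).target, inChart I θ x e = inChart I θ' x e) : θ = θ' := by
  funext x
  rw [← inChart_self (I := I) θ x, ← inChart_self (I := I) θ' x]
  exact h x _ (mem_extChartAt_target x)

lemma inChart_eq_zero {k : ℕ} {θ : Form E M k} {x₀ : M} {e : E}
    (h : θ ((extChartAt I x₀).symm e) = 0) : inChart I θ x₀ e = 0 := by
  rw [inChart, h]; rfl

lemma inChart_zero {k : ℕ} (x₀ : M) : inChart I (0 : Form E M k) x₀ = 0 := rfl

lemma inChart_add {k : ℕ} (θ θ' : Form E M k) (x₀ : M) :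
    inChart I (θ + θ') x₀ = inChart I θ x₀ + inChart I θ' x₀ := rfl

lemma inChart_smul {k : ℕ} (c : ℂ) (θ : Form E M k) (x₀ : M) :
    inChart I (c • θ) x₀ = c • inChart I θ x₀ := rfl

lemma inChart_mul {k : ℕ} (f : M → ℝ) (θ : Form E M k) (x₀ : M) (e : E) :
    inChart I (fun x => f x • θ x) x₀ e = f ((extChartAt I x₀).symm e) • inChart I θ x₀ e := rfl

lemma inChart_sum {ι : Type*} {k : ℕ} (s : Finset ι) (θ : ι → Form E M k) (x₀ : M) :
    inChart I (∑ i ∈ s, θ i) x₀ = ∑ i ∈ s, inChart I (θ i) x₀ := by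
  classical
  induction s using Finset.induction_on with
  | empty => simp [inChart_zero]
  | insert a s ha ih => rw [Finset.sum_insert ha, Finset.sum_insert ha, inChart_add, ih]

/-- Pull-back of covectors by multiplication by `c`. -/
def scaleL (E : Type*) [NormedAddCommGroup E] [NormedSpace ℂ E] (k : ℕ) (c : ℂ) :
    E [⋀^Fin k]→L[ℝ] ℂ →L[ℝ] E [⋀^Fin k]→L[ℝ] ℂ :=
  ContinuousAlternatingMap.compContinuousLinearMapCLM
    ((c • ContinuousLinearMap.id ℂ E).restrictScalars ℝ)

lemma scaleL_apply {k : ℕ} (c : ℂ) (η : E [⋀^Fin k]→L[ℝ] ℂ) (v : Fin k → E) :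
    scaleL E k c η v = η (fun i => c • v i) := rfl

lemma scale_apply {N : Type*} {k : ℕ} (c : ℂ) (θ : Form E N k) (x : N) (v : Fin k → E) :
    scale c θ x v = θ x (fun i => c • v i) := rfl

lemma inChart_scale {k : ℕ} (c : ℂ) (θ : Form E M k) (x₀ : M) :
    inChart I (scale c θ) x₀ = fun e => scaleL E k c (inChart I θ x₀ e) := by
  funext e
  ext v
  simp only [inChart, scale, scaleL_apply, ContinuousAlternatingMap.compContinuousLinearMap_apply]
  congr 1
  funext i
  simp

/-! ### The exterior derivative in charts -/

lemma contDiffOn_extDeriv {k : ℕ} {η : E → E [⋀^Fin k]→L[ℝ] ℂ} {s : Set E} (hs : IsOpen s)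
    (hη : ContDiffOn ℝ ∞ η s) : ContDiffOn ℝ ∞ (extDeriv η) s := by
  have h1 : ContDiffOn ℝ ∞ (fderiv ℝ η) s := hη.fderiv_of_isOpen hs (by simp)
  exact (ContinuousAlternatingMap.alternatizeUncurryFinCLM (n := k) ℝ E ℂ).contDiff.comp_contDiffOn
    h1

lemma IsSmooth.differentiableAt [I.Boundaryless] {k : ℕ} {θ : Form E M k} (hθ : IsSmooth I θ)
    {x₀ : M} {e : E} (he : e ∈ (extChartAt I x₀).target) :
    DifferentiableAt ℝ (inChart I θ x₀) e :=
  ((hθ x₀).contDiffAt (extChartAt_target_mem_nhds' he)).differentiableAt (by simp)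

/-- The exterior derivative may be computed in any chart. -/
lemma inChart_extD [I.Boundaryless] [IsManifold I ω M] {k : ℕ} {θ : Form E M k}
    (hθ : IsSmooth I θ) {x₀ : M} {e : E} (he : e ∈ (extChartAt I x₀).target) :
    inChart I (extD I θ) x₀ e = extDeriv (inChart I θ x₀) e := by
  set y := (extChartAt I x₀).symm e with hy
  have hov : e ∈ overlap I x₀ y := mem_overlap_self he
  have hTe : transition I x₀ y e = extChartAt I y y := rfl
  have h1 : inChart I θ x₀ =ᶠ[𝓝 e] fun e' =>
      (inChart I θ y (transition I x₀ y e')).compContinuousLinearMap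
        (fderiv ℝ (transition I x₀ y) e') := by
    filter_upwards [(isOpen_overlap x₀ y).mem_nhds hov] with e' he'
    rw [inChart_transition θ he', fderiv_real_transition he']
  rw [h1.extDeriv_eq, extDeriv_pullback (r := ω), inChart_eq, fderiv_real_transition hov, hTe]
  · rfl
  · rw [hTe]; exact hθ.differentiableAt (mem_extChartAt_target y)
  · exact (contDiffAt_transition hov).restrict_scalars ℝ
  · simp

lemma IsSmooth.extD [I.Boundaryless] [IsManifold I ω M] {k : ℕ} {θ : Form E M k}
    (hθ : IsSmooth I θ) : IsSmooth I (extD I θ) := fun x₀ =>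
  (contDiffOn_extDeriv (isOpen_extChartAt_target x₀) (hθ x₀)).congr
    fun _ he => inChart_extD hθ he

lemma IsSmooth.add {k : ℕ} {θ θ' : Form E M k} (h : IsSmooth I θ) (h' : IsSmooth I θ') :
    IsSmooth I (θ + θ') := fun x₀ => (h x₀).add (h' x₀)

lemma IsSmooth.sub {k : ℕ} {θ θ' : Form E M k} (h : IsSmooth I θ) (h' : IsSmooth I θ') :
    IsSmooth I (θ - θ') := fun x₀ => (h x₀).sub (h' x₀)

lemma IsSmooth.smul {k : ℕ} {θ : Form E M k} (c : ℂ) (h : IsSmooth I θ) :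
    IsSmooth I (c • θ) := fun x₀ => (h x₀).const_smul c

lemma isSmooth_zero {k : ℕ} : IsSmooth I (0 : Form E M k) := fun _ => by
  rw [inChart_zero]; exact contDiffOn_const

lemma IsSmooth.sum {ι : Type*} {k : ℕ} {s : Finset ι} {θ : ι → Form E M k}
    (h : ∀ i ∈ s, IsSmooth I (θ i)) : IsSmooth I (∑ i ∈ s, θ i) := by
  classical
  induction s using Finset.induction_on with
  | empty => simpa using isSmooth_zero
  | insert a s ha ih =>
    rw [Finset.sum_insert ha]
    exact (h a (Finset.mem_insert_self a s)).add
      (ih fun i hi => h i (Finset.mem_insert_of_mem hi))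

lemma IsSmooth.scale {k : ℕ} {θ : Form E M k} (c : ℂ) (h : IsSmooth I θ) :
    IsSmooth I (scale c θ) := fun x₀ => by
  rw [inChart_scale]
  exact (scaleL E k c).contDiff.comp_contDiffOn (h x₀)

lemma IsSmooth.extDc [I.Boundaryless] [IsManifold I ω M] {k : ℕ} {θ : Form E M k}
    (hθ : IsSmooth I θ) : IsSmooth I (extDc I θ) := ((hθ.scale _).extD).scale _

lemma IsSmooth.delbar [I.Boundaryless] [IsManifold I ω M] {k : ℕ} {θ : Form E M k}
    (hθ : IsSmooth I θ) : IsSmooth I (delbar I θ) := (hθ.extD.sub (hθ.extDc.smul _)).smul _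

lemma extD_zero {k : ℕ} : extD I (0 : Form E M k) = 0 := by
  funext x
  have : inChart I (0 : Form E M k) x = fun _ => 0 := rfl
  rw [extD, this]
  ext v
  simp [extDeriv, ContinuousAlternatingMap.alternatizeUncurryFin_apply]

lemma extD_add [I.Boundaryless] {k : ℕ} {θ θ' : Form E M k} (h : IsSmooth I θ)
    (h' : IsSmooth I θ') : extD I (θ + θ') = extD I θ + extD I θ' := by
  funext x
  simp only [extD, inChart_add, Pi.add_apply]
  exact extDeriv_add (h.differentiableAt (mem_extChartAt_target x))
    (h'.differentiableAt (mem_extChartAt_target x))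

lemma extD_sum [I.Boundaryless] {ι : Type*} {k : ℕ} {s : Finset ι} {θ : ι → Form E M k}
    (h : ∀ i ∈ s, IsSmooth I (θ i)) : extD I (∑ i ∈ s, θ i) = ∑ i ∈ s, extD I (θ i) := by
  classical
  induction s using Finset.induction_on with
  | empty => simp [extD_zero]
  | insert a s ha ih =>
    have h2 : ∀ i ∈ s, IsSmooth I (θ i) := fun i hi => h i (Finset.mem_insert_of_mem hi)
    rw [Finset.sum_insert ha, Finset.sum_insert ha,
      extD_add (h a (Finset.mem_insert_self a s)) (IsSmooth.sum h2), ih h2]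

end Charts

/-! ### Integration of top degree forms on a compact complex manifold -/

section Integration

open Set Filter Topology MeasureTheory

variable {E : Type*} [NormedAddCommGroup E] [NormedSpace ℂ E]
  {F : Type*} [TopologicalSpace F] [ChartedSpace E F]

/-- The real manifold underlying a complex manifold. -/
lemma isManifold_real [IsManifold 𝓘(ℂ, E) ω F] : IsManifold 𝓘(ℝ, E) ∞ F := by
  refine isManifold_of_contDiffOn _ _ _ fun e e' he he' => ?_
  have h := (contDiffGroupoid ω 𝓘(ℂ, E)).compatible he he'
  rw [contDiffGroupoid, mem_groupoid_of_pregroupoid] at h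
  exact (h.1.of_le (by simp)).restrict_scalars ℝ

variable (E F) in
/-- A finite smooth partition of unity on `F` subordinate to preferred charts: `ρ y` has support
in the compact set `K y`, contained in the domain of the chart at `y`, for `y` in the finite set
`s`. -/
structure ChartPartition where
  s : Finset F
  ρ : F → F → ℝ
  K : F → Set F
  nonneg : ∀ y x, 0 ≤ ρ y x
  sum_eq_one : ∀ x, ∑ y ∈ s, ρ y x = 1
  isCompact : ∀ y, IsCompact (K y)
  subset : ∀ y, K y ⊆ (extChartAt 𝓘(ℂ, E) y).source
  zero_off : ∀ y x, x ∉ K y → ρ y x = 0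
  smooth : ∀ y x₀ : F, ContDiffOn ℝ ∞ (ρ y ∘ (extChartAt 𝓘(ℂ, E) x₀).symm)
    (extChartAt 𝓘(ℂ, E) x₀).target

theorem exists_chartPartition [FiniteDimensional ℂ E] [IsManifold 𝓘(ℂ, E) ω F] [T2Space F]
    [CompactSpace F] : Nonempty (ChartPartition E F) := by
  have : IsManifold 𝓘(ℝ, E) ∞ F := isManifold_real
  have : FiniteDimensional ℝ E := FiniteDimensional.complexToReal E
  obtain ⟨f, hf⟩ := SmoothPartitionOfUnity.exists_isSubordinate_chartAt_source 𝓘(ℝ, E) F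
  have hfin : {y | (Function.support (f y)).Nonempty}.Finite :=
    f.locallyFinite.finite_nonempty_of_compact
  refine ⟨⟨hfin.toFinset, fun y => f y, fun y => tsupport (f y), fun y x => f.nonneg y x,
    fun x => ?_, fun y => (isClosed_tsupport _).isCompact, fun y => ?_,
    fun y x hx => image_eq_zero_of_notMem_tsupport hx, fun y x₀ => ?_⟩⟩
  · rw [← f.sum_eq_one (mem_univ x)]
    symm
    refine finsum_eq_sum_of_support_subset _ fun y hy => ?_
    simp only [Set.Finite.coe_toFinset, mem_ofPred_eq]
    exact ⟨x, hy⟩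
  · rw [extChartAt_source]; exact hf y
  · have h1 : ContMDiff 𝓘(ℝ, E) 𝓘(ℝ, ℝ) ∞ (f y) := (f y).contMDiff
    have h2 : ContMDiffOn 𝓘(ℝ, E) 𝓘(ℝ, E) ∞ (extChartAt 𝓘(ℝ, E) x₀).symm
      (extChartAt 𝓘(ℝ, E) x₀).target := contMDiffOn_extChartAt_symm x₀
    exact (h1.comp_contMDiffOn h2).contDiffOn

lemma covector_zero_smul {d : ℕ} (η : E [⋀^Fin d]→L[ℝ] ℂ) : (0 : ℝ) • η = 0 := by
  ext v; simp

lemma covector_smul_zero {d : ℕ} (c : ℝ) : c • (0 : E [⋀^Fin d]→L[ℝ] ℂ) = 0 := by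
  ext v; simp

lemma det_restrictScalars_nonneg [FiniteDimensional ℂ E] (A : E →L[ℂ] E) :
    0 ≤ (A.restrictScalars ℝ).det := by
  have h : (A.restrictScalars ℝ).det = LinearMap.det ((A : E →ₗ[ℂ] E).restrictScalars ℝ) := rfl
  rw [h, LinearMap.det_restrictScalars, Algebra.norm_complex_apply]
  exact Complex.normSq_nonneg _

/-- A covector of top degree is multiplied by the determinant under a linear change of variables. -/
lemma map_basis_eq_det {V : Type*} [AddCommGroup V] [Module ℝ V] {d : ℕ}
    (b : Module.Basis (Fin d) ℝ V) (η : V [⋀^Fin d]→ₗ[ℝ] ℂ) (A : V →ₗ[ℝ] V) :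
    η (fun i => A (b i)) = (LinearMap.det A : ℝ) • η b := by
  have key : ∀ f : V [⋀^Fin d]→ₗ[ℝ] ℝ,
      f (fun i => A (b i)) = LinearMap.det A * f b := by
    intro f
    rw [f.eq_smul_basis_det b]
    have h := b.det_comp A b
    simp only [AlternatingMap.smul_apply, Module.Basis.det_self, smul_eq_mul, mul_one] at h ⊢
    have h' : b.det (fun i => A (b i)) = LinearMap.det A := h
    rw [h', mul_comm]
  have hre := key (Complex.reLm.compAlternatingMap η)
  have him := key (Complex.imLm.compAlternatingMap η)
  simp only [LinearMap.compAlternatingMap_apply, Complex.reLm_coe, Complex.imLm_coe] at hre him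
  apply Complex.ext <;> simp [hre, him]

/-- A smooth function on an open set with support in a compact subset extends by zero. -/
lemma contDiff_indicator {V W : Type*} [NormedAddCommGroup V] [NormedSpace ℝ V]
    [NormedAddCommGroup W] [NormedSpace ℝ W] {U K : Set V} {f : V → W} (hU : IsOpen U)
    (hK : IsClosed K) (hKU : K ⊆ U) (hf : ContDiffOn ℝ ∞ f U) (h0 : ∀ x ∈ U, x ∉ K → f x = 0) :
    ContDiff ℝ ∞ (U.indicator f) := by
  rw [contDiff_iff_contDiffAt]
  intro x
  by_cases hx : x ∈ K
  · refine ((hf.contDiffAt (hU.mem_nhds (hKU hx)))).congr_of_eventuallyEq ?_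
    filter_upwards [hU.mem_nhds (hKU hx)] with x' hx'
    exact indicator_of_mem hx' f
  · refine (contDiffAt_const (c := (0 : W))).congr_of_eventuallyEq ?_
    filter_upwards [hK.isOpen_compl.mem_nhds hx] with x' hx'
    by_cases h : x' ∈ U
    · rw [indicator_of_mem h, h0 x' h hx']
    · exact indicator_of_notMem h f

/-- The local expression of a form with compact support in a chart domain has compact support. -/
lemma isCompact_image_chart {K : Set F} {y : F} (hK : IsCompact K)
    (hKy : K ⊆ (extChartAt 𝓘(ℂ, E) y).source) : IsCompact (extChartAt 𝓘(ℂ, E) y '' K) :=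
  hK.image_of_continuousOn ((continuousOn_extChartAt y).mono hKy)

lemma inChart_eq_zero_of_notMem_image {K : Set F} {y : F} {d : ℕ} {θ : Form E F d}
    (h0 : ∀ x, x ∉ K → θ x = 0) {u : E} (hu : u ∈ (extChartAt 𝓘(ℂ, E) y).target)
    (hu' : u ∉ extChartAt 𝓘(ℂ, E) y '' K) : inChart 𝓘(ℂ, E) θ y u = 0 := by
  refine inChart_eq_zero (h0 _ fun h => hu' ⟨_, h, (extChartAt 𝓘(ℂ, E) y).right_inv hu⟩)

lemma contDiff_indicator_inChart {K : Set F} {y : F} {d : ℕ} {θ : Form E F d}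
    (hK : IsCompact K) (hKy : K ⊆ (extChartAt 𝓘(ℂ, E) y).source)
    (h0 : ∀ x, x ∉ K → θ x = 0) (hθ : IsSmooth 𝓘(ℂ, E) θ) :
    ContDiff ℝ ∞ ((extChartAt 𝓘(ℂ, E) y).target.indicator (inChart 𝓘(ℂ, E) θ y)) := by
  refine contDiff_indicator (isOpen_extChartAt_target y) (isCompact_image_chart hK hKy).isClosed
    ?_ (hθ y) fun u hu hu' => inChart_eq_zero_of_notMem_image h0 hu hu'
  rintro _ ⟨x, hx, rfl⟩
  exact (extChartAt 𝓘(ℂ, E) y).map_source (hKy hx)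

lemma hasCompactSupport_indicator_inChart {K : Set F} {y : F} {d : ℕ} {θ : Form E F d}
    (hK : IsCompact K) (hKy : K ⊆ (extChartAt 𝓘(ℂ, E) y).source) (h0 : ∀ x, x ∉ K → θ x = 0) :
    HasCompactSupport ((extChartAt 𝓘(ℂ, E) y).target.indicator (inChart 𝓘(ℂ, E) θ y)) := by
  refine HasCompactSupport.intro (isCompact_image_chart hK hKy) fun u hu => ?_
  by_cases h : u ∈ (extChartAt 𝓘(ℂ, E) y).target
  · rw [indicator_of_mem h, inChart_eq_zero_of_notMem_image h0 h hu]
  · exact indicator_of_notMem h _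

lemma ChartPartition.isSmooth_smul {d : ℕ} (P : ChartPartition E F) (y : F) {θ : Form E F d}
    (hθ : IsSmooth 𝓘(ℂ, E) θ) : IsSmooth 𝓘(ℂ, E) (fun x => P.ρ y x • θ x) := fun x₀ =>
  (P.smooth y x₀).smul (hθ x₀)

/-- The exterior derivative does not enlarge supports. -/
lemma extD_eq_zero_of_notMem {d : ℕ} {θ : Form E F d} {K : Set F} (hK : IsClosed K)
    (h0 : ∀ x, x ∉ K → θ x = 0) {x : F} (hx : x ∉ K) : extD 𝓘(ℂ, E) θ x = 0 := by
  have h1 : inChart 𝓘(ℂ, E) θ x =ᶠ[𝓝 (extChartAt 𝓘(ℂ, E) x x)] fun _ => 0 := by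
    have hc : ContinuousAt (extChartAt 𝓘(ℂ, E) x).symm (extChartAt 𝓘(ℂ, E) x x) :=
      continuousAt_extChartAt_symm x
    have hn : Kᶜ ∈ 𝓝 ((extChartAt 𝓘(ℂ, E) x).symm (extChartAt 𝓘(ℂ, E) x x)) := by
      rw [extChartAt_to_inv]; exact hK.isOpen_compl.mem_nhds hx
    filter_upwards [hc hn] with e he
    exact inChart_eq_zero (h0 _ he)
  rw [extD, h1.extDeriv_eq]
  ext v
  simp [extDeriv, ContinuousAlternatingMap.alternatizeUncurryFin_apply]

variable [MeasurableSpace E] [BorelSpace E] (μ : Measure E)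

/-- The integral of the local expression of the form `θ` of degree `d = dim F`, evaluated on the
constant frame `b`, over the domain of the chart at `y`. -/
def chartIntegral {d : ℕ} (b : Fin d → E) (θ : Form E F d) (y : F) : ℂ :=
  ∫ u in (extChartAt 𝓘(ℂ, E) y).target, inChart 𝓘(ℂ, E) θ y u b ∂μ

/-- The integral of a form of top degree. -/
def integralForm {d : ℕ} (P : ChartPartition E F) (b : Fin d → E) (θ : Form E F d) : ℂ :=
  ∑ y ∈ P.s, chartIntegral μ b (fun x => P.ρ y x • θ x) y

/-- Change of variables: the integral of a form vanishing outside the intersection of two chart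
domains can be computed in either chart. -/
lemma chartIntegral_eq [FiniteDimensional ℂ E] [IsManifold 𝓘(ℂ, E) ω F] [μ.IsAddHaarMeasure] {d : ℕ}
    (b : Module.Basis (Fin d) ℝ E) (θ : Form E F d) {y z : F}
    (hy : ∀ x, x ∉ (extChartAt 𝓘(ℂ, E) y).source → θ x = 0)
    (hz : ∀ x, x ∉ (extChartAt 𝓘(ℂ, E) z).source → θ x = 0) :
    chartIntegral μ b θ y = chartIntegral μ b θ z := by
  have : FiniteDimensional ℝ E := FiniteDimensional.complexToReal E
  have key : ∀ y z : F, (∀ x, x ∉ (extChartAt 𝓘(ℂ, E) z).source → θ x = 0) →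
      chartIntegral μ b θ y = ∫ u in overlap 𝓘(ℂ, E) y z, inChart 𝓘(ℂ, E) θ y u b ∂μ := by
    intro y z hz
    refine setIntegral_eq_of_subset_of_forall_sdiff_eq_zero
      (isOpen_extChartAt_target y).measurableSet (fun e he => (mem_overlap.1 he).1) ?_
    rintro e ⟨he, he'⟩
    rw [inChart_eq_zero]
    · rfl
    · exact hz _ fun h => he' (mem_overlap.2 ⟨he, h⟩)
  rw [key y z hz, key z y hy]
  have himg : transition 𝓘(ℂ, E) y z '' overlap 𝓘(ℂ, E) y z = overlap 𝓘(ℂ, E) z y := by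
    apply Subset.antisymm
    · rintro _ ⟨e, he, rfl⟩; exact transition_mem_overlap he
    · intro e he
      exact ⟨_, transition_mem_overlap he, transition_transition he⟩
  rw [← himg, integral_image_eq_integral_abs_det_fderiv_smul μ (isOpen_overlap y z).measurableSet
    (f' := fun e => (fderiv ℂ (transition 𝓘(ℂ, E) y z) e).restrictScalars ℝ)]
  · refine setIntegral_congr_fun (isOpen_overlap y z).measurableSet fun e he => ?_
    have h := map_basis_eq_det b
      (inChart 𝓘(ℂ, E) θ z (transition 𝓘(ℂ, E) y z e)).toAlternatingMap
      ((fderiv ℂ (transition 𝓘(ℂ, E) y z) e).restrictScalars ℝ).toLinearMap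
    rw [inChart_transition θ he, abs_of_nonneg (det_restrictScalars_nonneg _)]
    exact h
  · intro e he
    exact ((differentiableAt_transition he).hasFDerivAt.restrictScalars ℝ).hasFDerivWithinAt
  · intro e he e' he' h
    rw [← transition_transition he, h, transition_transition he']

lemma integrableOn_inChart [FiniteDimensional ℂ E] [IsFiniteMeasureOnCompacts μ]
    {K : Set F} {y : F} {d : ℕ}
    {θ : Form E F d} (b : Fin d → E) (hK : IsCompact K)
    (hKy : K ⊆ (extChartAt 𝓘(ℂ, E) y).source) (h0 : ∀ x, x ∉ K → θ x = 0)
    (hθ : IsSmooth 𝓘(ℂ, E) θ) :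
    IntegrableOn (fun u => inChart 𝓘(ℂ, E) θ y u b) (extChartAt 𝓘(ℂ, E) y).target μ := by
  have : FiniteDimensional ℝ E := FiniteDimensional.complexToReal E
  rw [← integrable_indicator_iff (isOpen_extChartAt_target y).measurableSet]
  have h1 := (contDiff_indicator_inChart hK hKy h0 hθ).continuous
  have h2 := hasCompactSupport_indicator_inChart hK hKy h0
  let L : E [⋀^Fin d]→L[ℝ] ℂ →L[ℝ] ℂ := ContinuousAlternatingMap.apply ℝ E ℂ b
  have h3 := (L.continuous.comp h1).integrable_of_hasCompactSupport (μ := μ)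
    (h2.comp_left (map_zero L))
  refine h3.congr (Eventually.of_forall fun u => ?_)
  by_cases h : u ∈ (extChartAt 𝓘(ℂ, E) y).target
  · rw [Function.comp_apply, indicator_of_mem h, indicator_of_mem h]; rfl
  · rw [Function.comp_apply, indicator_of_notMem h, indicator_of_notMem h, map_zero]

lemma integral_fderiv_eq_zero [FiniteDimensional ℝ E] [μ.IsAddHaarMeasure] {W : Type*}
    [NormedAddCommGroup W] [NormedSpace ℝ W] {g : E → W} (hg : ContDiff ℝ ∞ g)
    (hc : HasCompactSupport g) (v : E) : ∫ u, fderiv ℝ g u v ∂μ = 0 := by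
  have hi : Integrable (fun u => fderiv ℝ g u v) μ :=
    ((hg.continuous_fderiv (by simp)).clm_apply continuous_const).integrable_of_hasCompactSupport
      (hc.fderiv_apply ℝ v)
  have h := integral_smul_fderiv_eq_neg_fderiv_smul_of_integrable (𝕜 := ℝ) (μ := μ)
    (f := fun _ : E => (1 : ℝ)) (g := g) (v := v) (by simp) (by simpa using hi)
    (by simpa using hg.continuous.integrable_of_hasCompactSupport hc)
    (fun _ _ => differentiableAt_const _) (fun x _ => hg.differentiable (by simp) x)
  simpa using h

/-- Stokes' theorem for a form with compact support in the domain of a chart. -/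
lemma chartIntegral_extD_eq_zero [FiniteDimensional ℂ E] [IsManifold 𝓘(ℂ, E) ω F]
    [μ.IsAddHaarMeasure] {d : ℕ} (b : Fin (d + 1) → E) {η : Form E F d} {y : F} {K : Set F}
    (hK : IsCompact K) (hKy : K ⊆ (extChartAt 𝓘(ℂ, E) y).source) (h0 : ∀ x, x ∉ K → η x = 0)
    (hη : IsSmooth 𝓘(ℂ, E) η) : chartIntegral μ b (extD 𝓘(ℂ, E) η) y = 0 := by
  have : FiniteDimensional ℝ E := FiniteDimensional.complexToReal E
  set g := (extChartAt 𝓘(ℂ, E) y).target.indicator (inChart 𝓘(ℂ, E) η y) with hg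
  have hgs : ContDiff ℝ ∞ g := contDiff_indicator_inChart hK hKy h0 hη
  have hgc : HasCompactSupport g := hasCompactSupport_indicator_inChart hK hKy h0
  have h1 : chartIntegral μ b (extD 𝓘(ℂ, E) η) y = ∫ u, extDeriv g u b ∂μ := by
    have h3 : ∀ u ∈ (extChartAt 𝓘(ℂ, E) y).target,
        inChart 𝓘(ℂ, E) (extD 𝓘(ℂ, E) η) y u b = extDeriv g u b := by
      intro u hu
      have h2 : inChart 𝓘(ℂ, E) η y =ᶠ[𝓝 u] g := by
        filter_upwards [extChartAt_target_mem_nhds' hu] with u' hu'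
        rw [hg, indicator_of_mem hu']
      rw [inChart_extD hη hu, h2.extDeriv_eq]
    rw [chartIntegral, setIntegral_congr_fun (isOpen_extChartAt_target y).measurableSet h3]
    refine setIntegral_eq_integral_of_forall_compl_eq_zero fun u hu => ?_
    have h2 : g =ᶠ[𝓝 u] fun _ => 0 := by
      have hKc := (isCompact_image_chart hK hKy).isClosed
      have hu' : u ∉ extChartAt 𝓘(ℂ, E) y '' K := by
        rintro ⟨x, hx, rfl⟩
        exact hu ((extChartAt 𝓘(ℂ, E) y).map_source (hKy hx))
      filter_upwards [hKc.isOpen_compl.mem_nhds hu'] with u' h'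
      by_cases h : u' ∈ (extChartAt 𝓘(ℂ, E) y).target
      · rw [hg, indicator_of_mem h, inChart_eq_zero_of_notMem_image h0 h h']
      · exact indicator_of_notMem h _
    rw [h2.extDeriv_eq]
    simp [extDeriv, ContinuousAlternatingMap.alternatizeUncurryFin_apply]
  rw [h1]
  have h2 : ∀ i : Fin (d + 1), Integrable (fun u => fderiv ℝ g u (b i)) μ := fun i =>
    ((hgs.continuous_fderiv (by simp)).clm_apply continuous_const).integrable_of_hasCompactSupport
      (hgc.fderiv_apply ℝ _)
  let A : ∀ i : Fin (d + 1), E [⋀^Fin d]→L[ℝ] ℂ →L[ℝ] ℂ := fun i =>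
    ContinuousAlternatingMap.apply ℝ E ℂ (i.removeNth b)
  have h3 : ∀ u, extDeriv g u b =
      ∑ i : Fin (d + 1), ((-1 : ℝ) ^ (i : ℕ)) • A i (fderiv ℝ g u (b i)) := fun u => by
    rw [extDeriv, ContinuousAlternatingMap.alternatizeUncurryFin_apply]
    refine Finset.sum_congr rfl fun i _ => ?_
    rcases Nat.even_or_odd (i : ℕ) with h | h <;> simp [h.neg_one_pow, A]
  simp_rw [h3]
  have h4 : ∀ i ∈ (Finset.univ : Finset (Fin (d + 1))),
      Integrable (fun u => ((-1 : ℝ) ^ (i : ℕ)) • A i (fderiv ℝ g u (b i))) μ :=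
    fun i _ => Integrable.smul ((-1 : ℝ) ^ (i : ℕ)) ((A i).integrable_comp (h2 i))
  rw [integral_finsetSum _ h4]
  refine Finset.sum_eq_zero fun i _ => ?_
  rw [integral_smul, (A i).integral_comp_comm (h2 i), integral_fderiv_eq_zero μ hgs hgc, map_zero,
    smul_zero]

lemma chartIntegral_sum [FiniteDimensional ℂ E] [IsFiniteMeasureOnCompacts μ] {d : ℕ}
    (b : Fin d → E) {ι : Type*} (s : Finset ι) {θ : ι → Form E F d} {y : F} {K : ι → Set F}
    (hK : ∀ i, IsCompact (K i)) (hKy : ∀ i, K i ⊆ (extChartAt 𝓘(ℂ, E) y).source)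
    (h0 : ∀ i, ∀ x, x ∉ K i → θ i x = 0) (hθ : ∀ i, IsSmooth 𝓘(ℂ, E) (θ i)) :
    chartIntegral μ b (∑ i ∈ s, θ i) y = ∑ i ∈ s, chartIntegral μ b (θ i) y := by
  rw [chartIntegral, inChart_sum]
  simp only [Finset.sum_apply, ContinuousAlternatingMap.sum_apply]
  exact integral_finsetSum _ fun i _ => integrableOn_inChart μ b (hK i) (hKy i) (h0 i) (hθ i)

/-- Stokes' theorem: the integral of an exact form over a compact complex manifold vanishes. -/
theorem integralForm_extD [FiniteDimensional ℂ E] [IsManifold 𝓘(ℂ, E) ω F] [T2Space F]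
    [μ.IsAddHaarMeasure] {d : ℕ} (P : ChartPartition E F) (b : Module.Basis (Fin (d + 1)) ℝ E)
    {η : Form E F d} (hη : IsSmooth 𝓘(ℂ, E) η) :
    integralForm μ P b (extD 𝓘(ℂ, E) η) = 0 := by
  have hρη : ∀ z, IsSmooth 𝓘(ℂ, E) (fun x => P.ρ z x • η x) := fun z => P.isSmooth_smul z hη
  have hoff : ∀ z x, x ∉ P.K z → P.ρ z x • η x = 0 := fun z x hx => by
    rw [P.zero_off z x hx]; exact covector_zero_smul _
  have hdoff : ∀ z x, x ∉ P.K z → extD 𝓘(ℂ, E) (fun x => P.ρ z x • η x) x = 0 :=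
    fun z x hx => extD_eq_zero_of_notMem (P.isCompact z).isClosed (hoff z) hx
  have hdec : η = ∑ z ∈ P.s, fun x => P.ρ z x • η x := by
    funext x
    simp only [Finset.sum_apply]
    rw [← Finset.sum_smul, P.sum_eq_one, one_smul]
  have hd : extD 𝓘(ℂ, E) η = ∑ z ∈ P.s, extD 𝓘(ℂ, E) (fun x => P.ρ z x • η x) := by
    conv_lhs => rw [hdec]
    exact extD_sum fun z _ => hρη z
  have h1 : ∀ y, (fun x => P.ρ y x • extD 𝓘(ℂ, E) η x) =
      ∑ z ∈ P.s, fun x => P.ρ y x • extD 𝓘(ℂ, E) (fun x => P.ρ z x • η x) x := by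
    intro y
    funext x
    rw [hd]
    simp only [Finset.sum_apply, Finset.smul_sum]
  have hsm : ∀ y z, IsSmooth 𝓘(ℂ, E)
      (fun x => P.ρ y x • extD 𝓘(ℂ, E) (fun x => P.ρ z x • η x) x) := fun y z =>
    P.isSmooth_smul y (hρη z).extD
  calc integralForm μ P b (extD 𝓘(ℂ, E) η)
      = ∑ y ∈ P.s, ∑ z ∈ P.s, chartIntegral μ b
          (fun x => P.ρ y x • extD 𝓘(ℂ, E) (fun x => P.ρ z x • η x) x) y := by
        refine Finset.sum_congr rfl fun y _ => ?_
        rw [h1, chartIntegral_sum μ b P.s (K := fun _ => P.K y) (fun _ => P.isCompact y)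
          (fun _ => P.subset y) (fun z x hx => by rw [P.zero_off y x hx]; exact covector_zero_smul _)
          (hsm y)]
    _ = ∑ y ∈ P.s, ∑ z ∈ P.s, chartIntegral μ b
          (fun x => P.ρ y x • extD 𝓘(ℂ, E) (fun x => P.ρ z x • η x) x) z := by
        refine Finset.sum_congr rfl fun y _ => Finset.sum_congr rfl fun z _ => ?_
        refine chartIntegral_eq μ b _ (fun x hx => ?_) (fun x hx => ?_)
        · rw [P.zero_off y x fun h => hx (P.subset y h)]; exact covector_zero_smul _
        · rw [hdoff z x fun h => hx (P.subset z h)]; exact covector_smul_zero _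
    _ = ∑ z ∈ P.s, chartIntegral μ b (extD 𝓘(ℂ, E) (fun x => P.ρ z x • η x)) z := by
        rw [Finset.sum_comm]
        refine Finset.sum_congr rfl fun z _ => ?_
        rw [← chartIntegral_sum μ b P.s (K := fun _ => P.K z) (fun _ => P.isCompact z)
          (fun _ => P.subset z) (fun y x hx => by rw [hdoff z x hx]; exact covector_smul_zero _)
          (fun y => hsm y z)]
        congr 1
        funext x
        simp only [Finset.sum_apply]
        rw [← Finset.sum_smul, P.sum_eq_one, one_smul]
    _ = 0 := Finset.sum_eq_zero fun z _ =>
        chartIntegral_extD_eq_zero μ b (P.isCompact z) (P.subset z) (hoff z) (hρη z)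

end Integration

/-! ### Contraction of covectors with some of the arguments fixed -/

section Contraction

variable {B T : Type*} [NormedAddCommGroup B] [NormedSpace ℝ B]
  [NormedAddCommGroup T] [NormedSpace ℝ T]

lemma elim_update_comp {ι α β γ : Type*} [DecidableEq α] [DecidableEq ι] (σ : ι ≃ α ⊕ β)
    (f : α → γ) (g : β → γ) (a : α) (x : γ) :
    (fun j => Sum.elim (Function.update f a x) g (σ j)) =
      Function.update (fun j => Sum.elim f g (σ j)) (σ.symm (Sum.inl a)) x := by
  funext j
  by_cases h : j = σ.symm (Sum.inl a)
  · subst h; simp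
  · rw [Function.update_of_ne h]
    rcases hs : σ j with a' | b'
    · have : a' ≠ a := by rintro rfl; exact h (by rw [← hs, Equiv.symm_apply_apply])
      simp [Function.update_of_ne this]
    · simp

variable {ι α β : Type*} [Fintype ι] [Fintype α] [Fintype β]

/-- The contraction of a covector `θ` on `T`: the arguments with index in `β` are set to `b`, the
others are taken in `B` and mapped to `T` by `i`. -/
def contractAlt (σ : ι ≃ α ⊕ β) (i : B →L[ℝ] T) (b : β → T) (θ : T [⋀^ι]→L[ℝ] ℂ) :
    B [⋀^α]→ₗ[ℝ] ℂ where
  toFun v := θ fun j => Sum.elim (fun a => i (v a)) b (σ j)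
  map_update_add' v a x y := by
    classical
    have h : ∀ z, (fun a' => i (Function.update v a z a')) =
        Function.update (fun a' => i (v a')) a (i z) := fun z => by
      funext a'; by_cases h : a' = a
      · subst h; simp
      · simp [Function.update_of_ne h]
    convert! θ.map_update_add (fun j => Sum.elim (fun a => i (v a)) b (σ j)) (σ.symm (Sum.inl a))
      (i x) (i y) using 2
    · rw [← map_add, ← elim_update_comp, ← h]
    · rw [← elim_update_comp, ← h]
    · rw [← elim_update_comp, ← h]
  map_update_smul' v a c x := by
    classical
    have h : ∀ z, (fun a' => i (Function.update v a z a')) =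
        Function.update (fun a' => i (v a')) a (i z) := fun z => by
      funext a'; by_cases h : a' = a
      · subst h; simp
      · simp [Function.update_of_ne h]
    convert! θ.map_update_smul (fun j => Sum.elim (fun a => i (v a)) b (σ j)) (σ.symm (Sum.inl a))
      c (i x) using 2
    · rw [← map_smul, ← elim_update_comp, ← h]
    · rw [← elim_update_comp, ← h]
  map_eq_zero_of_eq' v a a' hv haa' := by
    refine θ.map_eq_zero_of_eq _ (i := σ.symm (Sum.inl a)) (j := σ.symm (Sum.inl a')) ?_ ?_
    · simp [hv]
    · simpa using haa'

lemma norm_contractAlt_le (σ : ι ≃ α ⊕ β) (i : B →L[ℝ] T) (b : β → T) (θ : T [⋀^ι]→L[ℝ] ℂ)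
    (v : α → B) : ‖contractAlt σ i b θ v‖ ≤
      ((‖i‖ ^ Fintype.card α * ∏ j, ‖b j‖) * ‖θ‖) * ∏ a, ‖v a‖ := by
  refine (θ.le_opNorm _).trans ?_
  have h1 : ∏ j, ‖Sum.elim (fun a => i (v a)) b (σ j)‖ = (∏ a, ‖i (v a)‖) * ∏ j, ‖b j‖ := by
    rw [σ.prod_comp fun s => ‖Sum.elim (fun a => i (v a)) b s‖, Fintype.prod_sum_type]
    rfl
  rw [h1]
  have h2 : ∏ a, ‖i (v a)‖ ≤ ‖i‖ ^ Fintype.card α * ∏ a, ‖v a‖ := by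
    calc ∏ a, ‖i (v a)‖ ≤ ∏ a, (‖i‖ * ‖v a‖) :=
          Finset.prod_le_prod (fun _ _ => norm_nonneg _) fun a _ => i.le_opNorm _
      _ = _ := by rw [Finset.prod_mul_distrib, Finset.prod_const, Finset.card_univ]
  have h3 : (0 : ℝ) ≤ ∏ j, ‖b j‖ := Finset.prod_nonneg fun _ _ => norm_nonneg _
  calc ‖θ‖ * ((∏ a, ‖i (v a)‖) * ∏ j, ‖b j‖)
      ≤ ‖θ‖ * ((‖i‖ ^ Fintype.card α * ∏ a, ‖v a‖) * ∏ j, ‖b j‖) := by gcongr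
    _ = _ := by ring

/-- The contraction `contractAlt` as a continuous linear map. -/
def contract (σ : ι ≃ α ⊕ β) (i : B →L[ℝ] T) (b : β → T) :
    T [⋀^ι]→L[ℝ] ℂ →L[ℝ] B [⋀^α]→L[ℝ] ℂ :=
  LinearMap.mkContinuous
    { toFun := fun θ => (contractAlt σ i b θ).mkContinuous _ (norm_contractAlt_le σ i b θ)
      map_add' := fun _ _ => rfl
      map_smul' := fun _ _ => rfl }
    (‖i‖ ^ Fintype.card α * ∏ j, ‖b j‖) fun θ => by
      refine AlternatingMap.mkContinuous_norm_le _ ?_ (norm_contractAlt_le σ i b θ)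
      have h3 : (0 : ℝ) ≤ ∏ j, ‖b j‖ := Finset.prod_nonneg fun _ _ => norm_nonneg _
      positivity

lemma contract_apply (σ : ι ≃ α ⊕ β) (i : B →L[ℝ] T) (b : β → T) (θ : T [⋀^ι]→L[ℝ] ℂ)
    (v : α → B) :
    contract σ i b θ v = θ fun j => Sum.elim (fun a => i (v a)) b (σ j) := rfl

lemma contract_comp {B' T' : Type*} [NormedAddCommGroup B'] [NormedSpace ℝ B']
    [NormedAddCommGroup T'] [NormedSpace ℝ T'] (σ : ι ≃ α ⊕ β) {i : B →L[ℝ] T} {b : β → T}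
    {i' : B' →L[ℝ] T'} {b' : β → T'} (θ : T' [⋀^ι]→L[ℝ] ℂ) {A : T →L[ℝ] T'} {A' : B →L[ℝ] B'}
    (hA : ∀ v, A (i v) = i' (A' v)) (hb : ∀ j, A (b j) = b' j) :
    contract σ i b (θ.compContinuousLinearMap A) =
      (contract σ i' b' θ).compContinuousLinearMap A' := by
  ext v
  simp only [contract_apply, ContinuousAlternatingMap.compContinuousLinearMap_apply]
  congr 1
  funext j
  rcases h : σ j with a | a
  · simp [h, hA]
  · simp [h, hb]

/-- The splitting of `K = k + d` indices into the first `k` and the last `d`. -/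
def splitFin {K k d : ℕ} (h : K = k + d) : Fin K ≃ Fin k ⊕ Fin d :=
  (finCongr h).trans finSumFinEquiv.symm

lemma splitFin_symm_inl {K k d : ℕ} (h : K = k + d) (a : Fin k) :
    ((splitFin h).symm (Sum.inl a) : ℕ) = a := by simp [splitFin]

lemma splitFin_symm_inr {K k d : ℕ} (h : K = k + d) (a : Fin d) :
    ((splitFin h).symm (Sum.inr a) : ℕ) = k + a := by simp [splitFin]

lemma elim_splitFin {γ : Type*} {K k d : ℕ} (h : K = k + d) (f : Fin k → γ) (g : Fin d → γ)
    (j : Fin K) :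
    Sum.elim f g (splitFin h j) =
      if hj : (j : ℕ) < k then f ⟨j, hj⟩ else g ⟨j - k, by omega⟩ := by
  obtain ⟨s, rfl⟩ := (splitFin h).symm.surjective j
  rw [Equiv.apply_symm_apply]
  rcases s with a | a
  · have := splitFin_symm_inl h a
    simp [this]
  · have := splitFin_symm_inr h a
    simp [this]

lemma val_succAbove {n : ℕ} (i : Fin (n + 1)) (j : Fin n) :
    (i.succAbove j : ℕ) = if (j : ℕ) < i then (j : ℕ) else j + 1 := by
  rw [Fin.succAbove]
  simp only [Fin.lt_def, Fin.val_castSucc]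
  split_ifs <;> simp

lemma removeNth_inl {γ : Type*} {K k d : ℕ} (h : K = k + d) (h' : K + 1 = k + 1 + d)
    (f : Fin (k + 1) → γ) (g : Fin d → γ) (a : Fin (k + 1)) :
    ((splitFin h').symm (Sum.inl a)).removeNth (fun j => Sum.elim f g (splitFin h' j)) =
      fun j => Sum.elim (a.removeNth f) g (splitFin h j) := by
  funext j
  have := a.2
  rcases lt_or_ge (j : ℕ) k with hj | hj
  · rw [elim_splitFin h, dif_pos hj]
    simp only [Fin.removeNth, elim_splitFin, val_succAbove, splitFin_symm_inl]
    split_ifs <;> first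
      | (exfalso; omega)
      | rfl
      | (congr 1; apply Fin.ext; simp only [val_succAbove]; split_ifs <;> omega)
  · rw [elim_splitFin h, dif_neg (not_lt.2 hj)]
    simp only [Fin.removeNth, elim_splitFin, val_succAbove, splitFin_symm_inl]
    split_ifs <;> first
      | (exfalso; omega)
      | (congr 1; apply Fin.ext; simp only; omega)

lemma removeNth_inr {γ : Type*} {K k d : ℕ} (h : K = k + d) (h' : K + 1 = k + (d + 1))
    (f : Fin k → γ) (g : Fin (d + 1) → γ) (a : Fin (d + 1)) :
    ((splitFin h').symm (Sum.inr a)).removeNth (fun j => Sum.elim f g (splitFin h' j)) =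
      fun j => Sum.elim f (a.removeNth g) (splitFin h j) := by
  funext j
  have := a.2
  rcases lt_or_ge (j : ℕ) k with hj | hj
  · rw [elim_splitFin h, dif_pos hj]
    simp only [Fin.removeNth, elim_splitFin, val_succAbove, splitFin_symm_inr]
    split_ifs <;> first
      | (exfalso; omega)
      | rfl
  · rw [elim_splitFin h, dif_neg (not_lt.2 hj)]
    simp only [Fin.removeNth, elim_splitFin, val_succAbove, splitFin_symm_inr]
    split_ifs <;> first
      | (exfalso; omega)
      | (congr 1; apply Fin.ext; simp only [val_succAbove]; split_ifs <;> omega)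

open ContinuousAlternatingMap in
/-- The terms of an exterior derivative, split according to the direction of the derivative. -/
lemma alternatizeUncurryFin_split {K k d : ℕ} (h₁ : K = k + d) (h : K + 1 = k + 1 + d)
    (A : T →L[ℝ] T [⋀^Fin K]→L[ℝ] ℂ) (v : Fin (k + 1) → T) (b : Fin d → T) :
    alternatizeUncurryFin A (fun j => Sum.elim v b (splitFin h j)) =
      ∑ a : Fin (k + 1), (-1 : ℤ) ^ (a : ℕ) •
        A (v a) (fun j => Sum.elim (a.removeNth v) b (splitFin h₁ j)) +
      ∑ a : Fin d, (-1 : ℤ) ^ (k + 1 + a : ℕ) •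
        A (b a) (((splitFin h).symm (Sum.inr a)).removeNth
          fun j => Sum.elim v b (splitFin h j)) := by
  rw [alternatizeUncurryFin_apply, ← (splitFin h).symm.sum_comp, Fintype.sum_sum_type]
  simp only [splitFin_symm_inl, splitFin_symm_inr, Equiv.apply_symm_apply, Sum.elim_inl,
    Sum.elim_inr, removeNth_inl h₁ h]

end Contraction

/-! ### Integrals depending on a parameter -/

section Parameter

open MeasureTheory Set

lemma convolution_neg_eq {P G V : Type*} [NormedAddCommGroup G] [NormedAddCommGroup V]
    [NormedSpace ℝ V] [MeasurableSpace G] {μ : Measure G} (w : G → ℝ) (f : P → G → V) (p : P) :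
    convolution (fun u => w u) (fun u => f p (-u)) (ContinuousLinearMap.lsmul ℝ ℝ) μ 0 =
      ∫ u, w u • f p u ∂μ := by
  simp [convolution]

variable {P G V : Type*} [NormedAddCommGroup P] [NormedSpace ℝ P] [NormedAddCommGroup G]
  [NormedSpace ℝ G] [NormedAddCommGroup V] [NormedSpace ℝ V]
  [MeasurableSpace G] [BorelSpace G] {μ : Measure G}

/-- Smoothness of an integral depending smoothly on a parameter. -/
lemma contDiffOn_integral [FiniteDimensional ℝ G] {w : G → ℝ} (hw : LocallyIntegrable w μ)
    {f : P → G → V} {s : Set P} {k : Set G} (hs : IsOpen s) (hk : IsCompact k)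
    (h0 : ∀ p ∈ s, ∀ u, u ∉ k → f p u = 0)
    (hf : ContDiffOn ℝ ∞ (fun q : P × G => f q.1 q.2) (s ×ˢ univ)) :
    ContDiffOn ℝ ∞ (fun p => ∫ u, w u • f p u ∂μ) s := by
  have h := contDiffOn_convolution_right_with_param_comp (μ := μ) (n := ⊤)
    (ContinuousLinearMap.lsmul ℝ ℝ) (v := fun _ : P => (0 : G)) contDiffOn_const
    (f := w) (g := fun p u => f p (-u)) (k := -k) hs hk.neg
    (fun p _ hp hx => h0 p hp _ fun h => hx (by simpa using h)) hw
    (by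
      refine hf.comp (t := s ×ˢ univ) (f := fun q : P × G => (q.1, -q.2))
        (contDiff_fst.prodMk contDiff_snd.neg).contDiffOn ?_
      rintro ⟨p, u⟩ ⟨hp, -⟩
      exact ⟨hp, mem_univ _⟩)
  refine h.congr fun p _ => (convolution_neg_eq w f p).symm

lemma integrable_of_param [IsFiniteMeasureOnCompacts μ] {f : P → G → V} {s : Set P} {k : Set G}
    (hk : IsCompact k)
    (h0 : ∀ p ∈ s, ∀ u, u ∉ k → f p u = 0)
    (hf : ContDiffOn ℝ ∞ (fun q : P × G => f q.1 q.2) (s ×ˢ univ)) {p : P} (hp : p ∈ s) :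
    Integrable (f p) μ :=
  Continuous.integrable_of_hasCompactSupport
    (hf.continuousOn.comp_continuous (Continuous.prodMk_right p) fun _ => ⟨hp, mem_univ _⟩)
    (HasCompactSupport.intro hk fun u hu => h0 p hp u hu)

lemma integrable_fderiv_of_param [IsFiniteMeasureOnCompacts μ] {f : P → G → V} {s : Set P}
    {k : Set G} (hs : IsOpen s)
    (hk : IsCompact k) (h0 : ∀ p ∈ s, ∀ u, u ∉ k → f p u = 0)
    (hf : ContDiffOn ℝ ∞ (fun q : P × G => f q.1 q.2) (s ×ˢ univ)) {p : P} (hp : p ∈ s) :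
    Integrable (fun u => fderiv ℝ (fun p => f p u) p) μ := by
  have hd : ∀ u, fderiv ℝ (fun p => f p u) p =
      (fderiv ℝ (fun q : P × G => f q.1 q.2) (p, u)).comp
        ((ContinuousLinearMap.id ℝ P).prod (0 : P →L[ℝ] G)) := fun u => by
    have hd := ((hf.contDiffAt (x := (p, u)) ((hs.prod isOpen_univ).mem_nhds
      ⟨hp, mem_univ u⟩)).differentiableAt (by simp)).hasFDerivAt
    have := HasFDerivAt.comp (f := fun p : P => (p, u)) p hd
      ((hasFDerivAt_id p).prodMk (hasFDerivAt_const u p))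
    exact HasFDerivAt.fderiv (by simpa [Function.comp_def] using this)
  refine Continuous.integrable_of_hasCompactSupport ?_ (HasCompactSupport.intro hk fun u hu => ?_)
  · simp_rw [hd]
    exact ((hf.continuousOn_fderiv_of_isOpen (hs.prod isOpen_univ) (by simp)).comp_continuous
      (Continuous.prodMk_right p) fun u => ⟨hp, mem_univ _⟩).clm_comp continuous_const
  · have hz : (fun p => f p u) =ᶠ[nhds p] fun _ => 0 := by
      filter_upwards [hs.mem_nhds hp] with q hq
      exact h0 q hq u hu
    rw [hz.fderiv_eq]
    simp

/-- Differentiation under the integral sign. -/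
lemma hasFDerivAt_integral [FiniteDimensional ℝ G] [CompleteSpace V] {w : G → ℝ}
    (hw : LocallyIntegrable w μ)
    {f : P → G → V} {s : Set P} {k : Set G} (hs : IsOpen s) (hk : IsCompact k)
    (h0 : ∀ p ∈ s, ∀ u, u ∉ k → f p u = 0)
    (hf : ContDiffOn ℝ ∞ (fun q : P × G => f q.1 q.2) (s ×ˢ univ)) {p : P} (hp : p ∈ s) :
    HasFDerivAt (fun p => ∫ u, w u • f p u ∂μ)
      (∫ u, w u • fderiv ℝ (fun p => f p u) p ∂μ) p := by
  have hneg : ContDiffOn ℝ ∞ (fun q : P × G => f q.1 (-q.2)) (s ×ˢ univ) := by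
    refine hf.comp (t := s ×ˢ univ) (f := fun q : P × G => (q.1, -q.2))
      (contDiff_fst.prodMk contDiff_snd.neg).contDiffOn ?_
    rintro ⟨p, u⟩ ⟨hp, -⟩
    exact ⟨hp, mem_univ _⟩
  have hsu : ∀ u : G, s ×ˢ (univ : Set G) ∈ nhds (p, u) := fun u =>
    (hs.prod isOpen_univ).mem_nhds ⟨hp, mem_univ _⟩
  have h := hasFDerivAt_convolution_right_with_param (μ := μ) (𝕜 := ℝ)
    (ContinuousLinearMap.lsmul ℝ ℝ)
    (f := w) (g := fun p u => f p (-u)) (k := -k) hs hk.neg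
    (fun p _ hp hx => h0 p hp _ fun h => hx (by simpa using h)) hw
    (hneg.of_le (by simp)) (p, 0) hp
  have h1 : HasFDerivAt (fun p : P => (p, (0 : G)))
      ((ContinuousLinearMap.id ℝ P).prod (0 : P →L[ℝ] G)) p :=
    (hasFDerivAt_id p).prodMk (hasFDerivAt_const (0 : G) p)
  have h2 := HasFDerivAt.comp (f := fun p : P => (p, (0 : G))) p h h1
  have h3 : (fun p => ∫ u, w u • f p u ∂μ) =
      (fun q : P × G => convolution w (fun u => f q.1 (-u)) (ContinuousLinearMap.lsmul ℝ ℝ) μ q.2) ∘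
        fun p => (p, 0) := by
    funext p; exact (convolution_neg_eq w f p).symm
  rw [h3]
  refine h2.congr_fderiv ?_
  have hg'c : Continuous fun u => fderiv ℝ (fun q : P × G => f q.1 (-q.2)) (p, u) :=
    (hneg.continuousOn_fderiv_of_isOpen (hs.prod isOpen_univ) (by simp)).comp_continuous
      (Continuous.prodMk_right p) fun u => ⟨hp, mem_univ _⟩
  have hg's : HasCompactSupport fun u => fderiv ℝ (fun q : P × G => f q.1 (-q.2)) (p, u) := by
    refine HasCompactSupport.intro hk.neg fun u hu => ?_
    have hz : (fun q : P × G => f q.1 (-q.2)) =ᶠ[nhds (p, u)] fun _ => 0 := by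
      filter_upwards [(hs.prod hk.neg.isClosed.isOpen_compl).mem_nhds ⟨hp, hu⟩] with q hq
      exact h0 _ hq.1 _ fun h => hq.2 (by simpa using h)
    rw [hz.fderiv_eq]
    simp
  have hint := hg's.convolutionExists_right
    ((ContinuousLinearMap.lsmul ℝ ℝ).precompR (P × G)) hw hg'c 0
  have hcomm := (((ContinuousLinearMap.compL ℝ P (P × G) V).flip
    ((ContinuousLinearMap.id ℝ P).prod (0 : P →L[ℝ] G)))).integral_comp_comm hint
  refine hcomm.symm.trans (integral_congr_ae (Filter.Eventually.of_forall fun t => ?_))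
  have hd : HasFDerivAt (fun q : P × G => f q.1 (-q.2))
      (fderiv ℝ (fun q : P × G => f q.1 (-q.2)) (p, -t)) (p, -t) :=
    ((hneg.contDiffAt (hsu (-t))).differentiableAt (by simp)).hasFDerivAt
  have hd2 : HasFDerivAt (fun p => f p t)
      ((fderiv ℝ (fun q : P × G => f q.1 (-q.2)) (p, -t)).comp
        ((ContinuousLinearMap.id ℝ P).prod (0 : P →L[ℝ] G))) p := by
    have := HasFDerivAt.comp (f := fun p : P => (p, -t)) p hd
      ((hasFDerivAt_id p).prodMk (hasFDerivAt_const (-t) p))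
    simpa [Function.comp_def] using this
  beta_reduce
  rw [hd2.fderiv, zero_sub]
  ext v
  simp [ContinuousLinearMap.precompR_apply]

end Parameter

/-! ### Integration along the fibres of a product -/

section FibreIntegration

open Set Filter Topology MeasureTheory

variable {B F T : Type*} [NormedAddCommGroup B] [NormedSpace ℂ B] [NormedAddCommGroup F]
  [NormedSpace ℂ F] [NormedAddCommGroup T] [NormedSpace ℂ T]
  {X : Type*} [TopologicalSpace X] [ChartedSpace B X]
  {Y : Type*} [TopologicalSpace Y] [ChartedSpace F Y]
  {H : Type*} [TopologicalSpace H] {J : ModelWithCorners ℂ T H}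
  {Z : Type*} [TopologicalSpace Z] [ChartedSpace H Z]

variable (B F X Y J Z) in
/-- An identification of the manifold `Z` with the product of the base `X` and the fibre `Y`, under
which the preferred charts of `Z` are the products of those of `X` and `Y`. It allows to treat the
projections of `X × Y` to its first and of `Y × X` to its second factor at the same time. -/
structure ProductCharts where
  pair : X → Y → Z
  inB : B →L[ℂ] T
  inF : F →L[ℂ] T
  prB : T →L[ℂ] B
  prF : T →L[ℂ] F
  prB_add : ∀ e u, prB (inB e + inF u) = e
  prF_add : ∀ e u, prF (inB e + inF u) = u
  add_pr : ∀ t, inB (prB t) + inF (prF t) = t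
  mem_target : ∀ x y e u, inB e + inF u ∈ (extChartAt J (pair x y)).target ↔
    e ∈ (extChartAt 𝓘(ℂ, B) x).target ∧ u ∈ (extChartAt 𝓘(ℂ, F) y).target
  mem_source : ∀ x y x' y', pair x' y' ∈ (extChartAt J (pair x y)).source ↔
    x' ∈ (extChartAt 𝓘(ℂ, B) x).source ∧ y' ∈ (extChartAt 𝓘(ℂ, F) y).source
  symm_apply : ∀ x y e u, (extChartAt J (pair x y)).symm (inB e + inF u) =
    pair ((extChartAt 𝓘(ℂ, B) x).symm e) ((extChartAt 𝓘(ℂ, F) y).symm u)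
  apply_pair : ∀ x y x' y', extChartAt J (pair x y) (pair x' y') =
    inB (extChartAt 𝓘(ℂ, B) x x') + inF (extChartAt 𝓘(ℂ, F) y y')

variable (D : ProductCharts B F X Y J Z)

namespace ProductCharts

/-- The inclusion of the base directions as a real linear map. -/
abbrev inBℝ : B →L[ℝ] T := D.inB.restrictScalars ℝ

/-- The inclusion of the fibre directions as a real linear map. -/
abbrev inFℝ : F →L[ℝ] T := D.inF.restrictScalars ℝ

variable {D}

lemma mem_overlap_pair {x x' : X} {y y' : Y} {e : B} {u : F} :
    D.inB e + D.inF u ∈ overlap J (D.pair x y) (D.pair x' y') ↔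
      e ∈ overlap 𝓘(ℂ, B) x x' ∧ u ∈ overlap 𝓘(ℂ, F) y y' := by
  rw [mem_overlap, mem_overlap, mem_overlap, D.mem_target, D.symm_apply, D.mem_source]
  tauto

lemma transition_pair (x x' : X) (y y' : Y) (e : B) (u : F) :
    transition J (D.pair x y) (D.pair x' y') (D.inB e + D.inF u) =
      D.inB (transition 𝓘(ℂ, B) x x' e) + D.inF (transition 𝓘(ℂ, F) y y' u) := by
  simp only [transition, Function.comp_apply, D.symm_apply, D.apply_pair]

lemma fderiv_transition_pair [IsManifold 𝓘(ℂ, B) ω X] [IsManifold 𝓘(ℂ, F) ω Y] {x x' : X}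
    {y y' : Y} {e : B} {u : F}
    (he : e ∈ overlap 𝓘(ℂ, B) x x') (hu : u ∈ overlap 𝓘(ℂ, F) y y') :
    fderiv ℂ (transition J (D.pair x y) (D.pair x' y')) (D.inB e + D.inF u) =
      D.inB.comp ((fderiv ℂ (transition 𝓘(ℂ, B) x x') e).comp D.prB) +
      D.inF.comp ((fderiv ℂ (transition 𝓘(ℂ, F) y y') u).comp D.prF) := by
  have h : transition J (D.pair x y) (D.pair x' y') = fun t =>
      D.inB (transition 𝓘(ℂ, B) x x' (D.prB t)) + D.inF (transition 𝓘(ℂ, F) y y' (D.prF t)) := by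
    funext t
    conv_lhs => rw [← D.add_pr t]
    exact transition_pair x x' y y' _ _
  rw [h]
  refine HasFDerivAt.fderiv (HasFDerivAt.add ?_ ?_)
  · refine D.inB.hasFDerivAt.comp _ (HasFDerivAt.comp (g := transition 𝓘(ℂ, B) x x') _ ?_
      D.prB.hasFDerivAt)
    rw [D.prB_add]
    exact (differentiableAt_transition he).hasFDerivAt
  · refine D.inF.hasFDerivAt.comp _ (HasFDerivAt.comp (g := transition 𝓘(ℂ, F) y y') _ ?_
      D.prF.hasFDerivAt)
    rw [D.prF_add]
    exact (differentiableAt_transition hu).hasFDerivAt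

end ProductCharts

lemma transition_self_eventuallyEq {y : Y} {u : F} (hu : u ∈ (extChartAt 𝓘(ℂ, F) y).target) :
    transition 𝓘(ℂ, F) y y =ᶠ[𝓝 u] id := by
  filter_upwards [extChartAt_target_mem_nhds' hu] with e' he'
  exact (extChartAt 𝓘(ℂ, F) y).right_inv he'

lemma mem_overlap_same {y : Y} {u : F} (hu : u ∈ (extChartAt 𝓘(ℂ, F) y).target) :
    u ∈ overlap 𝓘(ℂ, F) y y :=
  mem_overlap.2 ⟨hu, (extChartAt 𝓘(ℂ, F) y).map_target hu⟩

open ProductCharts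

section Contracted

variable [J.Boundaryless] [IsManifold 𝓘(ℂ, B) ω X] [IsManifold 𝓘(ℂ, F) ω Y] [IsManifold J ω Z]

/-- Contraction with fibre vectors is compatible with changes of charts on the base. -/
lemma contract_inChart_base {K k d : ℕ} (h : K = k + d) (b : Fin d → F) (Ω : Form T Z K)
    {x x' : X} {y : Y} {e : B} {u : F} (he : e ∈ overlap 𝓘(ℂ, B) x x')
    (hu : u ∈ (extChartAt 𝓘(ℂ, F) y).target) :
    contract (splitFin h) D.inBℝ (fun j => D.inF (b j))
        (inChart J Ω (D.pair x y) (D.inB e + D.inF u)) =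
      (contract (splitFin h) D.inBℝ (fun j => D.inF (b j))
        (inChart J Ω (D.pair x' y) (D.inB (transition 𝓘(ℂ, B) x x' e) + D.inF u))
        ).compContinuousLinearMap ((fderiv ℂ (transition 𝓘(ℂ, B) x x') e).restrictScalars ℝ) := by
  have hu' := mem_overlap_same hu
  have hid := transition_self_eventuallyEq hu
  rw [inChart_transition (I := J) Ω (mem_overlap_pair.2 ⟨he, hu'⟩), transition_pair,
    hid.eq_of_nhds, id]
  refine contract_comp _ _ (fun v => ?_) (fun j => ?_)
  · have h1 := D.prB_add v 0
    have h2 := D.prF_add v 0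
    rw [map_zero, add_zero] at h1 h2
    simp [fderiv_transition_pair he hu', h1, h2]
  · have h1 := D.prB_add 0 (b j)
    have h2 := D.prF_add 0 (b j)
    rw [map_zero, zero_add] at h1 h2
    simp [fderiv_transition_pair he hu', h1, h2, hid.fderiv_eq]

/-- Contraction with base vectors is compatible with changes of charts on the fibre. -/
lemma contract_inChart_fibre {K k d : ℕ} (h : K = k + d) (v : Fin k → B) (Ω : Form T Z K)
    {x : X} {y y' : Y} {e : B} {u : F} (he : e ∈ (extChartAt 𝓘(ℂ, B) x).target)
    (hu : u ∈ overlap 𝓘(ℂ, F) y y') :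
    contract ((splitFin h).trans (Equiv.sumComm _ _)) D.inFℝ (fun j => D.inB (v j))
        (inChart J Ω (D.pair x y) (D.inB e + D.inF u)) =
      (contract ((splitFin h).trans (Equiv.sumComm _ _)) D.inFℝ (fun j => D.inB (v j))
        (inChart J Ω (D.pair x y') (D.inB e + D.inF (transition 𝓘(ℂ, F) y y' u)))
        ).compContinuousLinearMap ((fderiv ℂ (transition 𝓘(ℂ, F) y y') u).restrictScalars ℝ) := by
  have he' := mem_overlap_same he
  have hid := transition_self_eventuallyEq he
  rw [inChart_transition (I := J) Ω (mem_overlap_pair.2 ⟨he', hu⟩), transition_pair,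
    hid.eq_of_nhds, id]
  refine contract_comp _ _ (fun v => ?_) (fun j => ?_)
  · have h1 := D.prB_add 0 v
    have h2 := D.prF_add 0 v
    rw [map_zero, zero_add] at h1 h2
    simp [fderiv_transition_pair he' hu, h1, h2]
  · have h1 := D.prB_add (v j) 0
    have h2 := D.prF_add (v j) 0
    rw [map_zero, add_zero] at h1 h2
    simp [fderiv_transition_pair he' hu, h1, h2, hid.fderiv_eq]

end Contracted

variable (P : ChartPartition F Y)

/-- The integrand of the fibre integral in the product of the charts at `x` and `y`, extended by
zero to all of the model space of the fibre. -/
def fibreIntegrand {K k d : ℕ} (h : K = k + d) (b : Fin d → F) (Ω : Form T Z K) (x : X) (y : Y)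
    (e : B) : F → B [⋀^Fin k]→L[ℝ] ℂ :=
  (extChartAt 𝓘(ℂ, F) y).target.indicator fun u =>
    P.ρ y ((extChartAt 𝓘(ℂ, F) y).symm u) •
      contract (splitFin h) D.inBℝ (fun j => D.inF (b j))
        (inChart J Ω (D.pair x y) (D.inB e + D.inF u))

lemma fibreIntegrand_of_mem {K k d : ℕ} (h : K = k + d) (b : Fin d → F) (Ω : Form T Z K) (x : X)
    {y : Y} (e : B) {u : F} (hu : u ∈ (extChartAt 𝓘(ℂ, F) y).target) :
    fibreIntegrand D P h b Ω x y e u = P.ρ y ((extChartAt 𝓘(ℂ, F) y).symm u) •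
      contract (splitFin h) D.inBℝ (fun j => D.inF (b j))
        (inChart J Ω (D.pair x y) (D.inB e + D.inF u)) := indicator_of_mem hu _

lemma fibreIntegrand_of_notMem {K k d : ℕ} (h : K = k + d) (b : Fin d → F) (Ω : Form T Z K)
    (x : X) {y : Y} (e : B) {u : F} (hu : u ∉ (extChartAt 𝓘(ℂ, F) y).target) :
    fibreIntegrand D P h b Ω x y e u = 0 := indicator_of_notMem hu _

lemma fibreIntegrand_eq_zero {K k d : ℕ} (h : K = k + d) (b : Fin d → F) (Ω : Form T Z K) (x : X)
    {y : Y} (e : B) {u : F} (hu : u ∉ extChartAt 𝓘(ℂ, F) y '' P.K y) :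
    fibreIntegrand D P h b Ω x y e u = 0 := by
  by_cases hu' : u ∈ (extChartAt 𝓘(ℂ, F) y).target
  · rw [fibreIntegrand_of_mem D P h b Ω x e hu', P.zero_off, covector_zero_smul]
    exact fun h => hu ⟨_, h, (extChartAt 𝓘(ℂ, F) y).right_inv hu'⟩
  · exact fibreIntegrand_of_notMem D P h b Ω x e hu'

lemma contDiffOn_fibreIntegrand {K k d : ℕ} (h : K = k + d) (b : Fin d → F) {Ω : Form T Z K}
    (hΩ : IsSmooth J Ω) (x : X) (y : Y) [J.Boundaryless] :
    ContDiffOn ℝ ∞ (fun q : B × F => fibreIntegrand D P h b Ω x y q.1 q.2)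
      ((extChartAt 𝓘(ℂ, B) x).target ×ˢ univ) := by
  rintro ⟨e, u⟩ ⟨he, -⟩
  refine ContDiffAt.contDiffWithinAt ?_
  by_cases hu : u ∈ (extChartAt 𝓘(ℂ, F) y).target
  · have h1 : (fun q : B × F => fibreIntegrand D P h b Ω x y q.1 q.2) =ᶠ[𝓝 (e, u)]
        fun q => P.ρ y ((extChartAt 𝓘(ℂ, F) y).symm q.2) •
          contract (splitFin h) D.inBℝ (fun j => D.inF (b j))
            (inChart J Ω (D.pair x y) (D.inB q.1 + D.inF q.2)) := by
      filter_upwards [(continuous_snd.tendsto (e, u)) (extChartAt_target_mem_nhds' hu)] with q hq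
      exact fibreIntegrand_of_mem D P h b Ω x q.1 hq
    refine ContDiffAt.congr_of_eventuallyEq ?_ h1
    have h2 : ContDiffAt ℝ ∞
        (fun q : B × F => P.ρ y ((extChartAt 𝓘(ℂ, F) y).symm q.2)) (e, u) :=
      ContDiffAt.comp (e, u) (f := Prod.snd)
        ((P.smooth y y).contDiffAt (extChartAt_target_mem_nhds' hu)) contDiffAt_snd
    have h3 : ContDiffAt ℝ ∞ (fun q : B × F => contract (splitFin h) D.inBℝ
        (fun j => D.inF (b j)) (inChart J Ω (D.pair x y) (D.inB q.1 + D.inF q.2))) (e, u) := by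
      refine ContDiffAt.comp (e, u) (contract (splitFin h) D.inBℝ _).contDiff.contDiffAt ?_
      refine ContDiffAt.comp (e, u) (f := fun q : B × F => D.inBℝ q.1 + D.inFℝ q.2)
        (g := inChart J Ω (D.pair x y)) ?_ ?_
      · exact (hΩ _).contDiffAt (extChartAt_target_mem_nhds' ((D.mem_target x y e u).2 ⟨he, hu⟩))
      · exact ((D.inBℝ.contDiff.comp contDiff_fst).add
          (D.inFℝ.contDiff.comp contDiff_snd)).contDiffAt
    exact h2.smul h3
  · have hK := (isCompact_image_chart (P.isCompact y) (P.subset y)).isClosed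
    have hu' : u ∉ extChartAt 𝓘(ℂ, F) y '' P.K y := by
      rintro ⟨z, hz, rfl⟩
      exact hu ((extChartAt 𝓘(ℂ, F) y).map_source (P.subset y hz))
    refine (contDiffAt_const (c := 0)).congr_of_eventuallyEq ?_
    filter_upwards [(continuous_snd.tendsto (e, u)) (hK.isOpen_compl.mem_nhds hu')] with q hq
    exact fibreIntegrand_eq_zero D P h b Ω x q.1 hq

variable [MeasurableSpace F] [BorelSpace F] (μ : Measure F)

/-- The fibre integral of a form, computed at `e` in the chart at `x` of the base. -/
def fibreIntegralAt {K k d : ℕ} (h : K = k + d) (b : Fin d → F) (Ω : Form T Z K) (x : X) (e : B) :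
    B [⋀^Fin k]→L[ℝ] ℂ :=
  ∑ y ∈ P.s, ∫ u, fibreIntegrand D P h b Ω x y e u ∂μ

/-- The integral of a form along the fibres of the projection to the base `X`. -/
def fibreIntegral {K k d : ℕ} (h : K = k + d) (b : Fin d → F) (Ω : Form T Z K) : Form B X k :=
  fun x => fibreIntegralAt D P μ h b Ω x (extChartAt 𝓘(ℂ, B) x x)

variable [J.Boundaryless] [μ.IsAddHaarMeasure]

lemma integrable_fibreIntegrand {K k d : ℕ} (h : K = k + d) (b : Fin d → F) {Ω : Form T Z K}
    (hΩ : IsSmooth J Ω) (x : X) (y : Y) {e : B} (he : e ∈ (extChartAt 𝓘(ℂ, B) x).target) :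
    Integrable (fibreIntegrand D P h b Ω x y e) μ :=
  integrable_of_param (isCompact_image_chart (P.isCompact y) (P.subset y))
    (fun p _ _ hu => fibreIntegrand_eq_zero D P h b Ω x p hu)
    (contDiffOn_fibreIntegrand D P h b hΩ x y) he

lemma fibreIntegralAt_apply {K k d : ℕ} (h : K = k + d) (b : Fin d → F) {Ω : Form T Z K}
    (hΩ : IsSmooth J Ω) (x : X) {e : B} (he : e ∈ (extChartAt 𝓘(ℂ, B) x).target)
    (v : Fin k → B) :
    fibreIntegralAt D P μ h b Ω x e v = ∑ y ∈ P.s, ∫ u, fibreIntegrand D P h b Ω x y e u v ∂μ := by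
  rw [fibreIntegralAt, ContinuousAlternatingMap.sum_apply]
  refine Finset.sum_congr rfl fun y _ => ?_
  exact ((ContinuousAlternatingMap.apply ℝ B ℂ v).integral_comp_comm
    (integrable_fibreIntegrand D P μ h b hΩ x y he)).symm

variable [IsManifold 𝓘(ℂ, B) ω X] [IsManifold 𝓘(ℂ, F) ω Y] [IsManifold J ω Z]

/-- The fibre integral may be computed in any chart of the base. -/
lemma inChart_fibreIntegral {K k d : ℕ} (h : K = k + d) (b : Fin d → F) {Ω : Form T Z K}
    (hΩ : IsSmooth J Ω) (x : X) {e : B} (he : e ∈ (extChartAt 𝓘(ℂ, B) x).target) :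
    inChart 𝓘(ℂ, B) (fibreIntegral D P μ h b Ω) x e = fibreIntegralAt D P μ h b Ω x e := by
  have hov := mem_overlap_self he
  set x' := (extChartAt 𝓘(ℂ, B) x).symm e with hx'
  ext v
  rw [inChart_eq, ContinuousAlternatingMap.compContinuousLinearMap_apply, fibreIntegral,
    fibreIntegralAt_apply D P μ h b hΩ _ (mem_extChartAt_target _),
    fibreIntegralAt_apply D P μ h b hΩ _ he]
  refine Finset.sum_congr rfl fun y _ => integral_congr_ae (Eventually.of_forall fun u => ?_)
  beta_reduce
  by_cases hu : u ∈ (extChartAt 𝓘(ℂ, F) y).target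
  · rw [fibreIntegrand_of_mem D P h b Ω _ _ hu, fibreIntegrand_of_mem D P h b Ω _ _ hu,
      contract_inChart_base D h b Ω hov hu]
    rfl
  · rw [fibreIntegrand_of_notMem D P h b Ω _ _ hu, fibreIntegrand_of_notMem D P h b Ω _ _ hu]
    rfl

variable [FiniteDimensional ℂ F]

lemma isSmooth_fibreIntegral {K k d : ℕ} (h : K = k + d) (b : Fin d → F) {Ω : Form T Z K}
    (hΩ : IsSmooth J Ω) : IsSmooth 𝓘(ℂ, B) (fibreIntegral D P μ h b Ω) := by
  have : FiniteDimensional ℝ F := FiniteDimensional.complexToReal F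
  intro x
  refine ContDiffOn.congr ?_ fun e he => inChart_fibreIntegral D P μ h b hΩ x he
  refine ContDiffOn.sum fun y _ => ?_
  have := contDiffOn_integral (μ := μ) (locallyIntegrable_const (1 : ℝ))
    (isOpen_extChartAt_target x) (isCompact_image_chart (P.isCompact y) (P.subset y))
    (fun p _ _ hu => fibreIntegrand_eq_zero D P h b Ω x p hu)
    (contDiffOn_fibreIntegrand D P h b hΩ x y)
  simpa only [one_smul] using this

end FibreIntegration

section FibreIntegralDerivative

open Set Filter Topology MeasureTheory ContinuousAlternatingMap

variable {B F T : Type*} [NormedAddCommGroup B] [NormedSpace ℂ B] [NormedAddCommGroup F]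
  [NormedSpace ℂ F] [NormedAddCommGroup T] [NormedSpace ℂ T]
  {X : Type*} [TopologicalSpace X] [ChartedSpace B X]
  {Y : Type*} [TopologicalSpace Y] [ChartedSpace F Y]
  {H : Type*} [TopologicalSpace H] {J : ModelWithCorners ℂ T H}
  {Z : Type*} [TopologicalSpace Z] [ChartedSpace H Z]
  [J.Boundaryless] [IsManifold 𝓘(ℂ, B) ω X] [IsManifold 𝓘(ℂ, F) ω Y] [IsManifold J ω Z]
  (D : ProductCharts B F X Y J Z) (P : ChartPartition F Y)

/-- The form on the fibre over `x` obtained by inserting constant base vectors `v`. -/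
def fibreForm {K k d : ℕ} (h : K = k + d) (Ω : Form T Z K) (x : X) (e : B) (v : Fin k → B) :
    Form F Y d := fun y =>
  contract ((splitFin h).trans (Equiv.sumComm _ _)) D.inFℝ (fun j => D.inB (v j))
    (inChart J Ω (D.pair x y) (D.inB e + D.inF (extChartAt 𝓘(ℂ, F) y y)))

lemma inChart_fibreForm {K k d : ℕ} (h : K = k + d) (Ω : Form T Z K) {x : X} {e : B}
    (he : e ∈ (extChartAt 𝓘(ℂ, B) x).target) (v : Fin k → B) {y : Y} {u : F}
    (hu : u ∈ (extChartAt 𝓘(ℂ, F) y).target) :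
    inChart 𝓘(ℂ, F) (fibreForm D h Ω x e v) y u =
      contract ((splitFin h).trans (Equiv.sumComm _ _)) D.inFℝ (fun j => D.inB (v j))
        (inChart J Ω (D.pair x y) (D.inB e + D.inF u)) := by
  rw [inChart_eq, contract_inChart_fibre D h v Ω he (mem_overlap_self hu)]
  rfl

lemma isSmooth_fibreForm {K k d : ℕ} (h : K = k + d) {Ω : Form T Z K} (hΩ : IsSmooth J Ω) {x : X}
    {e : B} (he : e ∈ (extChartAt 𝓘(ℂ, B) x).target) (v : Fin k → B) :
    IsSmooth 𝓘(ℂ, F) (fibreForm D h Ω x e v) := by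
  intro y
  refine ContDiffOn.congr ?_ fun u hu => inChart_fibreForm D h Ω he v hu
  refine (contract ((splitFin h).trans (Equiv.sumComm _ _)) D.inFℝ
    (fun j => D.inB (v j))).contDiff.comp_contDiffOn ?_
  refine (hΩ (D.pair x y)).comp (f := fun u => D.inB e + D.inFℝ u)
    (contDiff_const.add D.inFℝ.contDiff).contDiffOn fun u hu => ?_
  exact (D.mem_target x y e u).2 ⟨he, hu⟩

lemma inChart_extD_fibreForm {K k d : ℕ} (h : K = k + d) {Ω : Form T Z K} (hΩ : IsSmooth J Ω)
    {x : X} {e : B} (he : e ∈ (extChartAt 𝓘(ℂ, B) x).target) (v : Fin k → B) {y : Y} {u : F}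
    (hu : u ∈ (extChartAt 𝓘(ℂ, F) y).target) (b : Fin (d + 1) → F) :
    inChart 𝓘(ℂ, F) (extD 𝓘(ℂ, F) (fibreForm D h Ω x e v)) y u b =
      ∑ a : Fin (d + 1), (-1 : ℤ) ^ (a : ℕ) •
        fderiv ℝ (inChart J Ω (D.pair x y)) (D.inB e + D.inF u) (D.inF (b a))
          (fun j => Sum.elim (fun j => D.inB (v j)) (a.removeNth fun j => D.inF (b j))
            (splitFin h j)) := by
  rw [inChart_extD (isSmooth_fibreForm D h hΩ he v) hu]
  have h1 : inChart 𝓘(ℂ, F) (fibreForm D h Ω x e v) y =ᶠ[𝓝 u] fun u =>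
      contract ((splitFin h).trans (Equiv.sumComm _ _)) D.inFℝ (fun j => D.inB (v j))
        (inChart J Ω (D.pair x y) (D.inB e + D.inF u)) := by
    filter_upwards [extChartAt_target_mem_nhds' hu] with u' hu'
    exact inChart_fibreForm D h Ω he v hu'
  have ht : D.inB e + D.inF u ∈ (extChartAt J (D.pair x y)).target :=
    (D.mem_target x y e u).2 ⟨he, hu⟩
  have h2 : HasFDerivAt (fun u => contract ((splitFin h).trans (Equiv.sumComm _ _)) D.inFℝ
      (fun j => D.inB (v j)) (inChart J Ω (D.pair x y) (D.inB e + D.inF u)))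
      ((contract ((splitFin h).trans (Equiv.sumComm _ _)) D.inFℝ (fun j => D.inB (v j))).comp
        ((fderiv ℝ (inChart J Ω (D.pair x y)) (D.inB e + D.inF u)).comp D.inFℝ)) u :=
    (contract ((splitFin h).trans (Equiv.sumComm _ _)) D.inFℝ
      (fun j => D.inB (v j))).hasFDerivAt.comp u
      (HasFDerivAt.comp (f := fun u => D.inB e + D.inF u) (g := inChart J Ω (D.pair x y)) u
        (hΩ.differentiableAt ht).hasFDerivAt (D.inFℝ.hasFDerivAt.const_add (D.inB e)))
  rw [h1.extDeriv_eq, extDeriv, h2.fderiv, alternatizeUncurryFin_apply]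
  refine Finset.sum_congr rfl fun a _ => ?_
  congr 1
  simp only [ContinuousLinearMap.comp_apply, contract_apply]
  congr 1
  funext j
  rw [Equiv.trans_apply]
  rcases splitFin h j with i | i <;> rfl

lemma fderiv_fibreIntegrand {K k d : ℕ} (h : K = k + d) (b : Fin d → F) {Ω : Form T Z K}
    (hΩ : IsSmooth J Ω) {x : X} {y : Y} {e : B} (he : e ∈ (extChartAt 𝓘(ℂ, B) x).target) {u : F}
    (hu : u ∈ (extChartAt 𝓘(ℂ, F) y).target) :
    fderiv ℝ (fun e => fibreIntegrand D P h b Ω x y e u) e =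
      P.ρ y ((extChartAt 𝓘(ℂ, F) y).symm u) •
        (contract (splitFin h) D.inBℝ (fun j => D.inF (b j))).comp
          ((fderiv ℝ (inChart J Ω (D.pair x y)) (D.inB e + D.inF u)).comp D.inBℝ) := by
  have h1 : (fun e => fibreIntegrand D P h b Ω x y e u) = fun e =>
      P.ρ y ((extChartAt 𝓘(ℂ, F) y).symm u) •
      contract (splitFin h) D.inBℝ (fun j => D.inF (b j))
        (inChart J Ω (D.pair x y) (D.inB e + D.inF u)) := by
    funext e; exact fibreIntegrand_of_mem D P h b Ω x e hu
  have ht : D.inB e + D.inF u ∈ (extChartAt J (D.pair x y)).target :=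
    (D.mem_target x y e u).2 ⟨he, hu⟩
  rw [h1]
  have h2 : HasFDerivAt (fun e => contract (splitFin h) D.inBℝ (fun j => D.inF (b j))
      (inChart J Ω (D.pair x y) (D.inB e + D.inF u)))
      ((contract (splitFin h) D.inBℝ (fun j => D.inF (b j))).comp
        ((fderiv ℝ (inChart J Ω (D.pair x y)) (D.inB e + D.inF u)).comp D.inBℝ)) e :=
    (contract (splitFin h) D.inBℝ (fun j => D.inF (b j))).hasFDerivAt.comp e
      (HasFDerivAt.comp (f := fun e => D.inB e + D.inF u) (g := inChart J Ω (D.pair x y)) e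
        (hΩ.differentiableAt ht).hasFDerivAt (D.inBℝ.hasFDerivAt.add_const (D.inF u)))
  have h3 := h2.const_smul (P.ρ y ((extChartAt 𝓘(ℂ, F) y).symm u))
  exact h3.fderiv

/-- The difference of the exterior derivative and of the exterior derivative along the base, in
charts. -/
lemma fibreIntegrand_extD {K k d : ℕ} (h : K = k + d) (h' : K + 1 = k + 1 + d) (b : Fin d → F)
    {Ω : Form T Z K} (hΩ : IsSmooth J Ω) {x : X} {y : Y} {e : B}
    (he : e ∈ (extChartAt 𝓘(ℂ, B) x).target) {u : F}
    (hu : u ∈ (extChartAt 𝓘(ℂ, F) y).target) (v : Fin (k + 1) → B) :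
    fibreIntegrand D P h' b (extD J Ω) x y e u v =
      alternatizeUncurryFin (fderiv ℝ (fun e => fibreIntegrand D P h b Ω x y e u) e) v +
      P.ρ y ((extChartAt 𝓘(ℂ, F) y).symm u) • ∑ a : Fin d, (-1 : ℤ) ^ (k + 1 + a : ℕ) •
        fderiv ℝ (inChart J Ω (D.pair x y)) (D.inB e + D.inF u) (D.inF (b a))
          (((splitFin h').symm (Sum.inr a)).removeNth
          fun j => Sum.elim (fun j => D.inB (v j)) (fun j => D.inF (b j)) (splitFin h' j)) := by
  have ht : D.inB e + D.inF u ∈ (extChartAt J (D.pair x y)).target :=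
    (D.mem_target x y e u).2 ⟨he, hu⟩
  rw [fibreIntegrand_of_mem D P h' b _ x e hu, fderiv_fibreIntegrand D P h b hΩ he hu,
    inChart_extD hΩ ht, ContinuousAlternatingMap.smul_apply, contract_apply, extDeriv,
    alternatizeUncurryFin_split h h', smul_add, alternatizeUncurryFin_smul,
    ContinuousAlternatingMap.smul_apply, alternatizeUncurryFin_apply]
  rfl

variable [MeasurableSpace F] [BorelSpace F] (μ : Measure F) [FiniteDimensional ℂ F]
  [μ.IsAddHaarMeasure]

lemma extD_fibreIntegral_apply {K k d : ℕ} (h : K = k + d) (b : Fin d → F) {Ω : Form T Z K}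
    (hΩ : IsSmooth J Ω) (x : X) (v : Fin (k + 1) → B) :
    extD 𝓘(ℂ, B) (fibreIntegral D P μ h b Ω) x v = ∑ y ∈ P.s, ∫ u, alternatizeUncurryFin
      (fderiv ℝ (fun e => fibreIntegrand D P h b Ω x y e u) (extChartAt 𝓘(ℂ, B) x x)) v ∂μ := by
  have : FiniteDimensional ℝ F := FiniteDimensional.complexToReal F
  have hx := mem_extChartAt_target (I := 𝓘(ℂ, B)) x
  have h1 : inChart 𝓘(ℂ, B) (fibreIntegral D P μ h b Ω) x =ᶠ[𝓝 (extChartAt 𝓘(ℂ, B) x x)]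
      fibreIntegralAt D P μ h b Ω x := by
    filter_upwards [extChartAt_target_mem_nhds x] with e he
    exact inChart_fibreIntegral D P μ h b hΩ x he
  have h2 : HasFDerivAt (fibreIntegralAt D P μ h b Ω x)
      (∑ y ∈ P.s, ∫ u, fderiv ℝ (fun e => fibreIntegrand D P h b Ω x y e u)
        (extChartAt 𝓘(ℂ, B) x x) ∂μ) (extChartAt 𝓘(ℂ, B) x x) := by
    refine HasFDerivAt.fun_sum fun y _ => ?_
    have := hasFDerivAt_integral (μ := μ) (locallyIntegrable_const (1 : ℝ))
      (isOpen_extChartAt_target x) (isCompact_image_chart (P.isCompact y) (P.subset y))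
      (fun p _ _ hu => fibreIntegrand_eq_zero D P h b Ω x p hu)
      (contDiffOn_fibreIntegrand D P h b hΩ x y) hx
    simpa only [one_smul] using this
  let Λ := (ContinuousAlternatingMap.apply ℝ B ℂ v).comp
    (alternatizeUncurryFinCLM (n := k) ℝ B ℂ)
  have h3 : extD 𝓘(ℂ, B) (fibreIntegral D P μ h b Ω) x v =
      Λ (fderiv ℝ (fibreIntegralAt D P μ h b Ω x) (extChartAt 𝓘(ℂ, B) x x)) := by
    rw [extD, h1.extDeriv_eq]; rfl
  rw [h3, h2.fderiv, _root_.map_sum]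
  refine Finset.sum_congr rfl fun y _ => ?_
  exact (Λ.integral_comp_comm (integrable_fderiv_of_param (μ := μ) (isOpen_extChartAt_target x)
    (isCompact_image_chart (P.isCompact y) (P.subset y))
    (fun p _ _ hu => fibreIntegrand_eq_zero D P h b Ω x p hu)
    (contDiffOn_fibreIntegrand D P h b hΩ x y) hx)).symm

/-- Integration along the fibres commutes with the exterior derivative: the terms with derivatives
in the direction of the fibre integrate to zero by Stokes' theorem. -/
theorem fibreIntegral_extD [T2Space Y] {K k d : ℕ} (h : K = k + d) (h' : K + 1 = k + 1 + d)
    (b : Module.Basis (Fin d) ℝ F) {Ω : Form T Z K} (hΩ : IsSmooth J Ω) :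
    fibreIntegral D P μ h' b (extD J Ω) = extD 𝓘(ℂ, B) (fibreIntegral D P μ h b Ω) := by
  have : FiniteDimensional ℝ F := FiniteDimensional.complexToReal F
  funext x
  ext v
  have hx := mem_extChartAt_target (I := 𝓘(ℂ, B)) x
  set e := extChartAt 𝓘(ℂ, B) x x with he
  rw [extD_fibreIntegral_apply D P μ h b hΩ, fibreIntegral,
    fibreIntegralAt_apply D P μ h' b hΩ.extD x hx, ← sub_eq_zero, ← Finset.sum_sub_distrib]
  have hint1 : ∀ y, Integrable (fun u => fibreIntegrand D P h' b (extD J Ω) x y e u v) μ := fun y =>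
    (ContinuousAlternatingMap.apply ℝ B ℂ v).integrable_comp
      (integrable_fibreIntegrand D P μ h' b hΩ.extD x y hx)
  have hint2 : ∀ y, Integrable (fun u => alternatizeUncurryFin
      (fderiv ℝ (fun e => fibreIntegrand D P h b Ω x y e u) e) v) μ := fun y =>
    ((ContinuousAlternatingMap.apply ℝ B ℂ v).comp
      (alternatizeUncurryFinCLM (n := k) ℝ B ℂ)).integrable_comp
      (integrable_fderiv_of_param (isOpen_extChartAt_target x)
        (isCompact_image_chart (P.isCompact y) (P.subset y))
        (fun p _ _ hu => fibreIntegrand_eq_zero D P h b Ω x p hu)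
        (contDiffOn_fibreIntegrand D P h b hΩ x y) hx)
  have hzero : ∀ y u, u ∉ (extChartAt 𝓘(ℂ, F) y).target →
      fibreIntegrand D P h' b (extD J Ω) x y e u v - alternatizeUncurryFin
        (fderiv ℝ (fun e => fibreIntegrand D P h b Ω x y e u) e) v = 0 := by
    intro y u hu
    have h1 : (fun e => fibreIntegrand D P h b Ω x y e u) = fun _ => 0 := by
      funext e; exact fibreIntegrand_of_notMem D P h b Ω x e hu
    rw [fibreIntegrand_of_notMem D P h' b _ x e hu, h1]
    simp [alternatizeUncurryFin_apply]
  rw [Finset.sum_congr rfl fun y _ => (integral_sub (hint1 y) (hint2 y)).symm]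
  cases d with
  | zero =>
    refine Finset.sum_eq_zero fun y _ => integral_eq_zero_of_ae (Eventually.of_forall fun u => ?_)
    by_cases hu : u ∈ (extChartAt 𝓘(ℂ, F) y).target
    · simp [fibreIntegrand_extD D P h h' b hΩ hx hu v]
    · exact hzero y u hu
  | succ d =>
    have hK : K = k + 1 + d := by omega
    have hst := integralForm_extD μ P b (isSmooth_fibreForm D hK hΩ hx v)
    rw [integralForm] at hst
    have key : ∀ y, ∫ u, (fibreIntegrand D P h' b (extD J Ω) x y e u v - alternatizeUncurryFin
        (fderiv ℝ (fun e => fibreIntegrand D P h b Ω x y e u) e) v) ∂μ =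
        (-1 : ℂ) ^ (k + 1) * chartIntegral μ b (fun z => P.ρ y z •
          extD 𝓘(ℂ, F) (fibreForm D hK Ω x e v) z) y := by
      intro y
      rw [← setIntegral_eq_integral_of_forall_compl_eq_zero (fun u hu => hzero y u hu),
        chartIntegral, ← integral_const_mul]
      refine setIntegral_congr_fun (isOpen_extChartAt_target y).measurableSet fun u hu => ?_
      rw [fibreIntegrand_extD D P h h' b hΩ hx hu v, add_sub_cancel_left, inChart_mul,
        ContinuousAlternatingMap.smul_apply, inChart_extD_fibreForm D hK hΩ hx v hu]
      simp only [removeNth_inr hK h', pow_add]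
      rw [Finset.smul_sum, Finset.smul_sum, Finset.mul_sum]
      refine Finset.sum_congr rfl fun a _ => ?_
      simp only [zsmul_eq_mul, Complex.real_smul]
      push_cast
      ring
    simp_rw [key]
    rw [← Finset.mul_sum, hst, mul_zero]

end FibreIntegralDerivative

section FibreIntegralOperations

open Set Filter Topology MeasureTheory

/-! ### Fibre integration and the complex structure -/

/-- The determinant of multiplication by a complex number, as a real linear map. -/
lemma det_restrictScalars_smul {V : Type*} [AddCommGroup V] [Module ℂ V] [Module.Finite ℂ V]
    {n : ℕ} (hn : Module.finrank ℂ V = n) (c : ℂ) :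
    LinearMap.det ((c • (LinearMap.id : V →ₗ[ℂ] V)).restrictScalars ℝ) = Complex.normSq c ^ n := by
  rw [LinearMap.det_restrictScalars, LinearMap.det_smul, LinearMap.det_id, mul_one,
    Algebra.norm_complex_apply, map_pow, hn]

variable {B F T : Type*} [NormedAddCommGroup B] [NormedSpace ℂ B] [NormedAddCommGroup F]
  [NormedSpace ℂ F] [NormedAddCommGroup T] [NormedSpace ℂ T]
  {X : Type*} [TopologicalSpace X] [ChartedSpace B X]
  {Y : Type*} [TopologicalSpace Y] [ChartedSpace F Y]
  {H : Type*} [TopologicalSpace H] {J : ModelWithCorners ℂ T H}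
  {Z : Type*} [TopologicalSpace Z] [ChartedSpace H Z]

/-- Fibre integration does not depend on the names of the degrees. -/
lemma fibreIntegral_cast (D : ProductCharts B F X Y J Z) (P : ChartPartition F Y)
    [MeasurableSpace F] (μ : Measure F) {K K' k k' d : ℕ} (hK : K = K') (hk : k = k')
    (h : K = k + d) (h' : K' = k' + d) (b : Fin d → F) {Ω : Form T Z K'} {Ω' : Form T Z K}
    (H : ∀ z v, Ω z v = Ω' z (v ∘ Fin.cast hK)) (x : X) (v : Fin k' → B) :
    fibreIntegral D P μ h' b Ω x v = fibreIntegral D P μ h b Ω' x (v ∘ Fin.cast hk) := by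
  subst hK hk
  have : Ω = Ω' := by funext z; ext v; exact H z v
  rw [this]
  rfl

variable [J.Boundaryless] (D : ProductCharts B F X Y J Z) (P : ChartPartition F Y)
  [MeasurableSpace F] [BorelSpace F] (μ : Measure F) [μ.IsAddHaarMeasure]

lemma fibreIntegral_apply {K k d : ℕ} (h : K = k + d) (b : Fin d → F) {Ω : Form T Z K}
    (hΩ : IsSmooth J Ω) (x : X) (v : Fin k → B) :
    fibreIntegral D P μ h b Ω x v =
      ∑ y ∈ P.s, ∫ u, fibreIntegrand D P h b Ω x y (extChartAt 𝓘(ℂ, B) x x) u v ∂μ :=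
  fibreIntegralAt_apply D P μ h b hΩ x (mem_extChartAt_target x) v

lemma integrable_fibreIntegrand_apply {K k d : ℕ} (h : K = k + d) (b : Fin d → F) {Ω : Form T Z K}
    (hΩ : IsSmooth J Ω) (x : X) (y : Y) (v : Fin k → B) :
    Integrable (fun u => fibreIntegrand D P h b Ω x y (extChartAt 𝓘(ℂ, B) x x) u v) μ :=
  (ContinuousAlternatingMap.apply ℝ B ℂ v).integrable_comp
    (integrable_fibreIntegrand D P μ h b hΩ x y (mem_extChartAt_target x))

lemma fibreIntegral_add {K k d : ℕ} (h : K = k + d) (b : Fin d → F) {Ω Ω' : Form T Z K}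
    (hΩ : IsSmooth J Ω) (hΩ' : IsSmooth J Ω') :
    fibreIntegral D P μ h b (Ω + Ω') = fibreIntegral D P μ h b Ω + fibreIntegral D P μ h b Ω' := by
  funext x
  ext v
  rw [Pi.add_apply, ContinuousAlternatingMap.add_apply, fibreIntegral_apply D P μ h b (hΩ.add hΩ'),
    fibreIntegral_apply D P μ h b hΩ, fibreIntegral_apply D P μ h b hΩ', ← Finset.sum_add_distrib]
  refine Finset.sum_congr rfl fun y _ => ?_
  rw [← integral_add (integrable_fibreIntegrand_apply D P μ h b hΩ x y v)
    (integrable_fibreIntegrand_apply D P μ h b hΩ' x y v)]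
  refine integral_congr_ae (Eventually.of_forall fun u => ?_)
  beta_reduce
  by_cases hu : u ∈ (extChartAt 𝓘(ℂ, F) y).target
  · rw [fibreIntegrand_of_mem D P h b _ _ _ hu, fibreIntegrand_of_mem D P h b _ _ _ hu,
      fibreIntegrand_of_mem D P h b _ _ _ hu, inChart_add, Pi.add_apply, map_add]
    exact smul_add _ _ _
  · rw [fibreIntegrand_of_notMem D P h b _ _ _ hu, fibreIntegrand_of_notMem D P h b _ _ _ hu,
      fibreIntegrand_of_notMem D P h b _ _ _ hu]
    exact (add_zero _).symm

/-- Forms that differ pointwise by a constant factor and a linear change of the base vectors have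
fibre integrals that differ in the same way. -/
lemma fibreIntegral_eq_mul {K k d : ℕ} (h : K = k + d) (b : Fin d → F) {Ω Ω' : Form T Z K}
    (hΩ : IsSmooth J Ω) (hΩ' : IsSmooth J Ω') (c : ℂ) {x : X} {v v' : Fin k → B}
    (H : ∀ (z : Z) (t : T), (inChart J Ω' z t) (fun j => Sum.elim (fun j => D.inB (v' j))
        (fun j => D.inF (b j)) (splitFin h j)) = c * (inChart J Ω z t)
        (fun j => Sum.elim (fun j => D.inB (v j)) (fun j => D.inF (b j)) (splitFin h j))) :
    fibreIntegral D P μ h b Ω' x v' = c * fibreIntegral D P μ h b Ω x v := by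
  rw [fibreIntegral_apply D P μ h b hΩ, fibreIntegral_apply D P μ h b hΩ', Finset.mul_sum]
  refine Finset.sum_congr rfl fun y _ => ?_
  rw [← integral_const_mul]
  refine integral_congr_ae (Eventually.of_forall fun u => ?_)
  beta_reduce
  by_cases hu : u ∈ (extChartAt 𝓘(ℂ, F) y).target
  · rw [fibreIntegrand_of_mem D P h b _ _ _ hu, fibreIntegrand_of_mem D P h b _ _ _ hu,
      ContinuousAlternatingMap.smul_apply, ContinuousAlternatingMap.smul_apply, contract_apply,
      contract_apply]
    simp only [ContinuousLinearMap.coe_restrictScalars', H, Complex.real_smul]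
    ring
  · rw [fibreIntegrand_of_notMem D P h b _ _ _ hu, fibreIntegrand_of_notMem D P h b _ _ _ hu]
    simp

variable [FiniteDimensional ℂ F]

lemma fibreIntegral_smul {K k d : ℕ} (h : K = k + d) (b : Fin d → F) {Ω : Form T Z K}
    (hΩ : IsSmooth J Ω) (c : ℂ) :
    fibreIntegral D P μ h b (c • Ω) = c • fibreIntegral D P μ h b Ω := by
  funext x
  ext v
  exact fibreIntegral_eq_mul D P μ h b hΩ (hΩ.smul c) c fun z t => rfl

lemma fibreIntegral_zero {K k d : ℕ} (h : K = k + d) (b : Fin d → F) :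
    fibreIntegral D P μ h b (0 : Form T Z K) = 0 := by
  have h0 : (0 : ℂ) • (0 : Form T Z K) = 0 := by funext z; ext v; simp
  rw [← h0, fibreIntegral_smul D P μ h b isSmooth_zero]
  funext x; ext v; simp

lemma fibreIntegral_sum {ι : Type*} {K k d : ℕ} (h : K = k + d) (b : Fin d → F) {s : Finset ι}
    {Ω : ι → Form T Z K} (hΩ : ∀ i ∈ s, IsSmooth J (Ω i)) :
    fibreIntegral D P μ h b (∑ i ∈ s, Ω i) = ∑ i ∈ s, fibreIntegral D P μ h b (Ω i) := by
  classical
  induction s using Finset.induction_on with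
  | empty => simp [fibreIntegral_zero]
  | insert a s ha ih =>
    have h2 : ∀ i ∈ s, IsSmooth J (Ω i) := fun i hi => hΩ i (Finset.mem_insert_of_mem hi)
    rw [Finset.sum_insert ha, Finset.sum_insert ha, fibreIntegral_add D P μ h b
      (hΩ a (Finset.mem_insert_self _ _)) (IsSmooth.sum h2), ih h2]

/-- Multiplication by `c` on the total space acts on the fibres with determinant `|c| ^ (2 n)`. -/
lemma fibreIntegral_scale {K k d n : ℕ} (hn : Module.finrank ℂ F = n) (h : K = k + d)
    (b : Module.Basis (Fin d) ℝ F) {Ω : Form T Z K} (hΩ : IsSmooth J Ω) (c : ℂ) :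
    fibreIntegral D P μ h b (scale c Ω) =
      ((Complex.normSq c ^ n : ℝ) : ℂ) • scale c (fibreIntegral D P μ h b Ω) := by
  funext x
  ext v
  refine fibreIntegral_eq_mul D P μ h b hΩ (hΩ.scale c) (v := fun j => c • v j) _ fun z t => ?_
  rw [inChart_scale, scaleL_apply]
  have key := map_basis_eq_det b (contract ((splitFin h).trans (Equiv.sumComm _ _)) D.inFℝ
    (fun j => D.inB (c • v j)) (inChart J Ω z t)).toAlternatingMap
    ((c • (LinearMap.id : F →ₗ[ℂ] F)).restrictScalars ℝ)
  rw [det_restrictScalars_smul hn, Complex.real_smul] at key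
  convert key using 2
  · change _ = (inChart J Ω z t) _
    congr 1
    funext j
    rw [Equiv.trans_apply]
    rcases splitFin h j with i | i <;> simp
  · change _ = (inChart J Ω z t) _
    congr 1
    funext j
    rw [Equiv.trans_apply]
    rcases splitFin h j with i | i <;> simp

lemma isReal_fibreIntegral {K k d : ℕ} (h : K = k + d) (b : Fin d → F) {Ω : Form T Z K}
    (hΩ : IsSmooth J Ω) (hr : IsReal Ω) : IsReal (fibreIntegral D P μ h b Ω) := by
  intro x v
  rw [fibreIntegral_apply D P μ h b hΩ, map_sum]
  refine Finset.sum_congr rfl fun y _ => ?_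
  rw [← integral_conj]
  refine integral_congr_ae (Eventually.of_forall fun u => ?_)
  beta_reduce
  by_cases hu : u ∈ (extChartAt 𝓘(ℂ, F) y).target
  · rw [fibreIntegrand_of_mem D P h b _ _ _ hu, ContinuousAlternatingMap.smul_apply,
      contract_apply, Complex.real_smul, map_mul, Complex.conj_ofReal, inChart]
    congr 1
    exact hr _ _
  · rw [fibreIntegrand_of_notMem D P h b _ _ _ hu]
    simp

lemma delbar_eq {E H : Type*} [NormedAddCommGroup E] [NormedSpace ℂ E] [TopologicalSpace H]
    (I : ModelWithCorners ℂ E H) {M : Type*} [TopologicalSpace M] [ChartedSpace H M] {k : ℕ}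
    (θ : Form E M k) : delbar I θ = (1 / 2 : ℂ) • (extD I θ + (-Complex.I) • extDc I θ) := by
  funext x
  ext v
  simp [delbar, sub_eq_add_neg]

section Derivatives

variable [T2Space Y] [IsManifold 𝓘(ℂ, B) ω X] [IsManifold 𝓘(ℂ, F) ω Y] [IsManifold J ω Z]

lemma fibreIntegral_extDc {K k d n : ℕ} (hn : Module.finrank ℂ F = n) (h : K = k + d)
    (h' : K + 1 = k + 1 + d) (b : Module.Basis (Fin d) ℝ F) {Ω : Form T Z K}
    (hΩ : IsSmooth J Ω) :
    fibreIntegral D P μ h' b (extDc J Ω) = extDc 𝓘(ℂ, B) (fibreIntegral D P μ h b Ω) := by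
  rw [extDc, fibreIntegral_scale D P μ hn h' b (hΩ.scale _).extD,
    fibreIntegral_extD D P μ h h' b (hΩ.scale _), fibreIntegral_scale D P μ hn h b hΩ]
  simp [extDc]

lemma fibreIntegral_del {K k d n : ℕ} (hn : Module.finrank ℂ F = n) (h : K = k + d)
    (h' : K + 1 = k + 1 + d) (b : Module.Basis (Fin d) ℝ F) {Ω : Form T Z K}
    (hΩ : IsSmooth J Ω) :
    fibreIntegral D P μ h' b (del J Ω) = del 𝓘(ℂ, B) (fibreIntegral D P μ h b Ω) := by
  rw [del, fibreIntegral_smul D P μ h' b (hΩ.extD.add (hΩ.extDc.smul _)),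
    fibreIntegral_add D P μ h' b hΩ.extD (hΩ.extDc.smul _),
    fibreIntegral_smul D P μ h' b hΩ.extDc, fibreIntegral_extD D P μ h h' b hΩ,
    fibreIntegral_extDc D P μ hn h h' b hΩ]
  rfl

lemma fibreIntegral_delbar {K k d n : ℕ} (hn : Module.finrank ℂ F = n) (h : K = k + d)
    (h' : K + 1 = k + 1 + d) (b : Module.Basis (Fin d) ℝ F) {Ω : Form T Z K}
    (hΩ : IsSmooth J Ω) :
    fibreIntegral D P μ h' b (delbar J Ω) = delbar 𝓘(ℂ, B) (fibreIntegral D P μ h b Ω) := by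
  rw [delbar_eq, fibreIntegral_smul D P μ h' b
    (hΩ.extD.add (hΩ.extDc.smul _)), fibreIntegral_add D P μ h' b hΩ.extD (hΩ.extDc.smul _),
    fibreIntegral_smul D P μ h' b hΩ.extDc, fibreIntegral_extD D P μ h h' b hΩ,
    fibreIntegral_extDc D P μ hn h h' b hΩ, delbar_eq]

end Derivatives

end FibreIntegralOperations

/-! ### Bidegrees -/

section Bidegree

open Polynomial

variable {E : Type*} [NormedAddCommGroup E] [NormedSpace ℂ E]

lemma HasBidegree.scale_eq_smul {N : Type*} {k a b : ℕ} {θ : Form E N k}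
    (h : ∀ x, HasBidegree a b (θ x)) (c : ℂ) :
    scale c θ = (c ^ a * (starRingEnd ℂ c) ^ b) • θ := by
  funext x
  ext v
  exact (h x).2 c v

/-- The value of a covector on the vectors `(1 + i t) v_j` is a polynomial in `t`. -/
lemma exists_polynomial_eval {k : ℕ} (η : E [⋀^Fin k]→L[ℝ] ℂ) (v : Fin k → E) :
    ∃ p : ℂ[X], ∀ t : ℝ, p.eval (t : ℂ) = η fun j => (1 + Complex.I * t : ℂ) • v j := by
  classical
  refine ⟨∑ s : Finset (Fin k), C (η (s.piecewise v fun j => Complex.I • v j)) * X ^ (sᶜ.card),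
    fun t => ?_⟩
  have h1 : (fun j => (1 + Complex.I * t : ℂ) • v j) = v + fun j => t • (Complex.I • v j) := by
    funext j
    rw [Pi.add_apply, add_smul, one_smul, mul_comm, mul_smul]
    rfl
  have h2 : ∀ w, η w = η.toMultilinearMap w := fun _ => rfl
  rw [h1, h2, MultilinearMap.map_add_univ, eval_finsetSum]
  refine Finset.sum_congr rfl fun s _ => ?_
  have h3 : s.piecewise v (fun j => t • (Complex.I • v j)) =
      sᶜ.piecewise (fun j => (fun _ => t) j • (s.piecewise v fun j => Complex.I • v j) j)
        (s.piecewise v fun j => Complex.I • v j) := by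
    funext j
    by_cases hj : j ∈ s <;> simp [Finset.piecewise, hj]
  rw [h3, MultilinearMap.map_piecewise_smul]
  simp only [Finset.prod_const, eval_mul, eval_C, eval_pow, eval_X, Complex.real_smul]
  push_cast
  rw [mul_comm]
  rfl

/-- A covector for which multiplication of the arguments by `c` amounts to multiplication by
`c ^ (a - n) * c̄ ^ (b - n)` vanishes if `a < n` or `b < n`. -/
lemma eq_zero_of_bidegree_lt {k a b n : ℕ} (hab : a < n ∨ b < n) {η : E [⋀^Fin k]→L[ℝ] ℂ}
    {v : Fin k → E}
    (h : ∀ c : ℂ, ((Complex.normSq c ^ n : ℝ) : ℂ) * η (fun j => c • v j) =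
      c ^ a * (starRingEnd ℂ c) ^ b * η v) : η v = 0 := by
  obtain ⟨p, hp⟩ := exists_polynomial_eval η v
  set q₁ : ℂ[X] := 1 + C Complex.I * X with hq₁
  set q₂ : ℂ[X] := 1 - C Complex.I * X with hq₂
  have h1 : q₁ ≠ 0 := fun h0 => by simpa [hq₁] using congrArg (eval 0) h0
  have h2 : q₂ ≠ 0 := fun h0 => by simpa [hq₂] using congrArg (eval 0) h0
  have key : q₁ ^ n * q₂ ^ n * p = q₁ ^ a * q₂ ^ b * C (η v) := by
    refine Polynomial.eq_of_infinite_eval_eq _ _ ((Set.infinite_range_of_injective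
      Complex.ofReal_injective).mono ?_)
    rintro _ ⟨t, rfl⟩
    have h3 : (starRingEnd ℂ) (1 + Complex.I * (t : ℂ)) = 1 - Complex.I * t := by
      simp [sub_eq_add_neg]
    have := h (1 + Complex.I * t)
    rw [← hp, Complex.ofReal_pow, ← Complex.mul_conj, h3, mul_pow] at this
    simpa [hq₁, hq₂] using this
  rcases hab with hab | hab
  · obtain ⟨m, rfl⟩ := Nat.exists_eq_add_of_lt hab
    have h4 : q₁ ^ (m + 1) * q₂ ^ (a + m + 1) * p = q₂ ^ b * C (η v) := by
      refine mul_left_cancel₀ (pow_ne_zero a h1) ?_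
      linear_combination key
    have h5 := congrArg (eval Complex.I) h4
    simp only [hq₁, hq₂, eval_mul, eval_pow, eval_add, eval_sub, eval_one, eval_C, eval_X,
      Complex.I_mul_I] at h5
    norm_num at h5
    exact h5
  · obtain ⟨m, rfl⟩ := Nat.exists_eq_add_of_lt hab
    have h4 : q₁ ^ (b + m + 1) * q₂ ^ (m + 1) * p = q₁ ^ a * C (η v) := by
      refine mul_left_cancel₀ (pow_ne_zero b h2) ?_
      linear_combination key
    have h5 := congrArg (eval (-Complex.I)) h4
    simp only [hq₁, hq₂, eval_mul, eval_pow, eval_add, eval_sub, eval_one, eval_C, eval_X,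
      mul_neg, Complex.I_mul_I] at h5
    norm_num at h5
    exact h5

/-- The components of a smooth form are smooth: they are combinations of the forms obtained
from it by multiplication of the tangent vectors by the numbers `1 + i j`, `0 ≤ j ≤ K`. -/
lemma isSmooth_component {H : Type*} [TopologicalSpace H] {I : ModelWithCorners ℂ E H}
    {M : Type*} [TopologicalSpace M] [ChartedSpace H M] {K : ℕ} {Ψ : Form E M K}
    (hΨ : IsSmooth I Ψ) {comp : ℕ → Form E M K}
    (hc : ∀ a ≤ K, ∀ x, HasBidegree a (K - a) (comp a x))
    (hsum : Ψ = ∑ a ∈ Finset.range (K + 1), comp a) {b : ℕ} (hb : b ≤ K) :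
    IsSmooth I (comp b) := by
  set c : ℕ → ℂ := fun j => 1 + Complex.I * j with hcdef
  have hconj : ∀ j, (starRingEnd ℂ) (c j) = 1 - Complex.I * j := fun j => by
    simp [hcdef, sub_eq_add_neg]
  have hc0 : ∀ j, (starRingEnd ℂ) (c j) ≠ 0 := fun j h0 => by
    rw [hconj] at h0
    have := congrArg Complex.re h0
    simp at this
  set w : ℕ → ℂ := fun j => c j / (starRingEnd ℂ) (c j) with hw
  have hinj : Set.InjOn w (Finset.range (K + 1)) := by
    intro j _ l _ hjl
    simp only [hw] at hjl
    rw [div_eq_div_iff (hc0 j) (hc0 l), hconj, hconj] at hjl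
    have := congrArg Complex.im hjl
    simp [hcdef] at this
    have h2 : (j : ℝ) = l := by linarith
    exact_mod_cast h2
  set L : ℕ → ℂ := fun j => (Lagrange.basis (Finset.range (K + 1)) w j).coeff b with hL
  have hdelta : ∀ a ≤ K, ∑ j ∈ Finset.range (K + 1), w j ^ a * L j = if b = a then 1 else 0 := by
    intro a ha
    have h1 := Lagrange.eq_interpolate (f := (X ^ a : ℂ[X])) hinj (by
      rw [degree_X_pow, Finset.card_range]
      exact_mod_cast Nat.lt_succ_of_le ha)
    have h2 := congrArg (fun p : ℂ[X] => p.coeff b) h1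
    simp only [Lagrange.interpolate_apply, finsetSum_coeff, coeff_C_mul, coeff_X_pow, eval_pow,
      eval_X] at h2
    exact h2.symm
  have key : comp b = ∑ j ∈ Finset.range (K + 1),
      (L j / (starRingEnd ℂ) (c j) ^ K) • scale (c j) Ψ := by
    funext x
    ext v
    simp only [Finset.sum_apply, ContinuousAlternatingMap.sum_apply, Pi.smul_apply,
      ContinuousAlternatingMap.smul_apply, scale_apply, smul_eq_mul]
    have h1 : ∀ j, Ψ x (fun i => c j • v i) = ∑ a ∈ Finset.range (K + 1),
        w j ^ a * (starRingEnd ℂ) (c j) ^ K * comp a x v := by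
      intro j
      rw [hsum, Finset.sum_apply, ContinuousAlternatingMap.sum_apply]
      refine Finset.sum_congr rfl fun a ha => ?_
      have ha' : a ≤ K := by simpa [Nat.lt_succ_iff] using ha
      rw [(hc a ha' x).2]
      congr 1
      obtain ⟨m, rfl⟩ := Nat.exists_eq_add_of_le ha'
      rw [add_tsub_cancel_left, hw, div_pow, pow_add]
      field_simp [hc0 j]
    simp only [h1, Finset.mul_sum]
    rw [Finset.sum_comm]
    rw [Finset.sum_eq_single b]
    · have h2 := hdelta b hb
      rw [if_pos rfl] at h2
      calc comp b x v = (∑ j ∈ Finset.range (K + 1), w j ^ b * L j) * comp b x v := by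
            rw [h2, one_mul]
        _ = _ := by
            rw [Finset.sum_mul]
            refine Finset.sum_congr rfl fun j _ => ?_
            have := pow_ne_zero K (hc0 j)
            field_simp
    · intro a ha hab
      have ha' : a ≤ K := by simpa [Nat.lt_succ_iff] using ha
      have h2 := hdelta a ha'
      rw [if_neg (Ne.symm hab)] at h2
      calc _ = (∑ j ∈ Finset.range (K + 1), w j ^ a * L j) * comp a x v := by
            rw [Finset.sum_mul]
            refine Finset.sum_congr rfl fun j _ => ?_
            have := pow_ne_zero K (hc0 j)
            field_simp
        _ = 0 := by rw [h2, zero_mul]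
    · intro hb'
      exact absurd (Finset.mem_range.2 (Nat.lt_succ_of_le hb)) hb'
  rw [key]
  exact IsSmooth.sum fun j _ => (hΨ.scale _).smul _

end Bidegree

/-! ### Complex frames -/

section Frames

variable {E : Type*} [NormedAddCommGroup E] [NormedSpace ℂ E]

lemma complexFrame_map {E' : Type*} [NormedAddCommGroup E'] [NormedSpace ℂ E'] {p : ℕ}
    (A : E →L[ℂ] E') (v : Fin p → E) :
    complexFrame (fun j => A (v j)) = fun j => A (complexFrame v j) := by
  funext j
  rw [complexFrame, complexFrame, map_smul]

lemma complexFrame_elim {s r n : ℕ} (hs : s = r + n) (h : 2 * s = 2 * r + 2 * n) (f : Fin r → E)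
    (g : Fin n → E) :
    complexFrame (fun j => Sum.elim f g (splitFin hs j)) =
      fun j => Sum.elim (complexFrame f) (complexFrame g) (splitFin h j) := by
  funext j
  rw [complexFrame, elim_splitFin, elim_splitFin]
  rcases lt_or_ge (j : ℕ) (2 * r) with hj | hj
  · rw [dif_pos hj, dif_pos (by simp only; omega)]
    rfl
  · rw [dif_neg (not_lt.2 hj), dif_neg (by simp only; omega), complexFrame]
    have h1 : ((j : ℕ) - 2 * r) % 2 = (j : ℕ) % 2 := by omega
    have h2 : ((j : ℕ) - 2 * r) / 2 = (j : ℕ) / 2 - r := by omega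
    simp only [h1, h2]

/-- The frame `(w₀, i w₀, w₁, i w₁, …)` of a complex basis `w` is a real basis. -/
lemma exists_basis_eq_complexFrame {n : ℕ} (w : Module.Basis (Fin n) ℂ E) :
    ∃ b : Module.Basis (Fin (2 * n)) ℝ E, ⇑b = complexFrame w := by
  refine ⟨(Complex.basisOneI.smulTower w).reindex
    (((Equiv.prodComm _ _).trans finProdFinEquiv).trans (finCongr (mul_comm n 2))), ?_⟩
  funext j
  obtain ⟨⟨i, l⟩, rfl⟩ :=
    (((Equiv.prodComm _ _).trans finProdFinEquiv).trans (finCongr (mul_comm n 2))).surjective j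
  rw [Module.Basis.reindex_apply, Equiv.symm_apply_apply, Module.Basis.smulTower_apply,
    complexFrame]
  have h1 : (((((Equiv.prodComm (Fin 2) (Fin n)).trans finProdFinEquiv).trans
      (finCongr (mul_comm n 2))) (i, l) : Fin (2 * n)) : ℕ) = i + 2 * l := by simp
  have hl : (⟨(i + 2 * l : ℕ) / 2, by omega⟩ : Fin n) = l := Fin.ext (by simp only; omega)
  simp only [h1, hl]
  fin_cases i
  · simp [Complex.coe_basisOneI]
  · simp [Complex.coe_basisOneI, Nat.add_mod]

lemma IsTransverseAt.comp {E' : Type*} [NormedAddCommGroup E'] [NormedSpace ℂ E'] {p : ℕ}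
    {Ω : E' [⋀^Fin (2 * p)]→L[ℝ] ℂ} (hΩ : IsTransverseAt Ω) {A : E →L[ℂ] E'}
    (hA : Function.Injective A) :
    IsTransverseAt (Ω.compContinuousLinearMap (A.restrictScalars ℝ)) := by
  intro v hv
  have h1 := hΩ (fun j => A (v j)) (hv.map' (A : E →ₗ[ℂ] E') (LinearMap.ker_eq_bot.2 hA))
  rw [complexFrame_map] at h1
  exact h1

end Frames

/-! ### Fibre integrals of generalized Kähler forms -/

section FibreIntegralKahler

open Set Filter Topology MeasureTheory

variable {B F T : Type*} [NormedAddCommGroup B] [NormedSpace ℂ B] [NormedAddCommGroup F]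
  [NormedSpace ℂ F] [NormedAddCommGroup T] [NormedSpace ℂ T]
  {X : Type*} [TopologicalSpace X] [ChartedSpace B X]
  {Y : Type*} [TopologicalSpace Y] [ChartedSpace F Y]
  {H : Type*} [TopologicalSpace H] {J : ModelWithCorners ℂ T H}
  {Z : Type*} [TopologicalSpace Z] [ChartedSpace H Z]

lemma ProductCharts.linearIndependent (D : ProductCharts B F X Y J Z) {s r n : ℕ}
    (hs : s = r + n) {v : Fin r → B} {w : Fin n → F} (hv : LinearIndependent ℂ v)
    (hw : LinearIndependent ℂ w) :
    LinearIndependent ℂ fun j => Sum.elim (fun i => D.inB (v i)) (fun i => D.inF (w i))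
      (splitFin hs j) := by
  have h1 : LinearIndependent ℂ (Sum.elim (LinearMap.inl ℂ B F ∘ v) (LinearMap.inr ℂ B F ∘ w)) :=
    linearIndependent_inl_union_inr' hv hw
  have hinj : Function.Injective (D.inB.coprod D.inF) := by
    intro p q hpq
    have h2 := congrArg D.prB hpq
    have h3 := congrArg D.prF hpq
    simp only [ContinuousLinearMap.coprod_apply, D.prB_add, D.prF_add] at h2 h3
    exact Prod.ext h2 h3
  have h2 := h1.map' (D.inB.coprod D.inF : B × F →ₗ[ℂ] T) (LinearMap.ker_eq_bot.2 hinj)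
  have h3 : (fun j => Sum.elim (fun i => D.inB (v i)) (fun i => D.inF (w i)) (splitFin hs j)) =
      (⇑(D.inB.coprod D.inF : B × F →ₗ[ℂ] T) ∘
        Sum.elim (LinearMap.inl ℂ B F ∘ v) (LinearMap.inr ℂ B F ∘ w)) ∘ splitFin hs := by
    funext j
    simp only [Function.comp_apply]
    rcases splitFin hs j with i | i <;> simp
  rw [h3]
  exact h2.comp _ (splitFin hs).injective

variable [J.Boundaryless] (D : ProductCharts B F X Y J Z) (P : ChartPartition F Y)
  [MeasurableSpace F] [BorelSpace F] (μ : Measure F) [FiniteDimensional ℂ F] [μ.IsAddHaarMeasure]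

lemma fibreIntegral_apply_scale {K k d n : ℕ} (hn : Module.finrank ℂ F = n) (h : K = k + d)
    (b : Module.Basis (Fin d) ℝ F) {Ω : Form T Z K} (hΩ : IsSmooth J Ω) {a a' : ℕ}
    (hbi : ∀ z, HasBidegree a a' (Ω z)) (x : X) (v : Fin k → B) (c : ℂ) :
    ((Complex.normSq c ^ n : ℝ) : ℂ) * fibreIntegral D P μ h b Ω x (fun j => c • v j) =
      c ^ a * (starRingEnd ℂ c) ^ a' * fibreIntegral D P μ h b Ω x v := by
  have h1 := fibreIntegral_scale D P μ hn h b hΩ c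
  rw [HasBidegree.scale_eq_smul hbi, fibreIntegral_smul D P μ h b hΩ] at h1
  exact (DFunLike.congr_fun (congrFun h1 x) v).symm

/-- Fibre integration lowers both degrees by the dimension of the fibre. -/
lemma hasBidegree_fibreIntegral {K k n : ℕ} (hn : Module.finrank ℂ F = n) (h : K = k + 2 * n)
    (b : Module.Basis (Fin (2 * n)) ℝ F) {Ω : Form T Z K} (hΩ : IsSmooth J Ω) {a a' : ℕ}
    (hbi : ∀ z, HasBidegree (a + n) (a' + n) (Ω z)) (haa' : a + a' = k) (x : X) :
    HasBidegree a a' (fibreIntegral D P μ h b Ω x) := by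
  refine ⟨haa', fun c v => ?_⟩
  have h1 := fibreIntegral_apply_scale D P μ hn h b hΩ hbi x v c
  by_cases hc : c = 0
  · subst hc
    rcases Nat.eq_zero_or_pos k with hk | hk
    · have ha : a = 0 := by omega
      have ha' : a' = 0 := by omega
      subst hk ha ha'
      rw [Subsingleton.elim (fun i => (0 : ℂ) • v i) v]
      simp
    · rw [ContinuousAlternatingMap.map_coord_zero (i := ⟨0, hk⟩) _ (by simp)]
      rcases Nat.eq_zero_or_pos a with ha | ha
      · have ha' : a' ≠ 0 := by omega
        simp [ha']
      · simp [ha.ne']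
  · have hc' : c ^ n * (starRingEnd ℂ c) ^ n ≠ 0 :=
      mul_ne_zero (pow_ne_zero _ hc) (pow_ne_zero _ (by simpa using hc))
    refine mul_left_cancel₀ hc' ?_
    rw [Complex.ofReal_pow, ← Complex.mul_conj, mul_pow] at h1
    rw [h1]
    ring

lemma fibreIntegral_eq_zero_of_bidegree_lt {K k d n : ℕ} (hn : Module.finrank ℂ F = n)
    (h : K = k + d) (b : Module.Basis (Fin d) ℝ F) {Ω : Form T Z K} (hΩ : IsSmooth J Ω)
    {a a' : ℕ} (hbi : ∀ z, HasBidegree a a' (Ω z)) (haa' : a < n ∨ a' < n) :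
    fibreIntegral D P μ h b Ω = 0 := by
  funext x
  ext v
  exact eq_zero_of_bidegree_lt haa' fun c => fibreIntegral_apply_scale D P μ hn h b hΩ hbi x v c

lemma isTransverseAt_inChart [IsManifold J ω Z] {p : ℕ} {Ω : Form T Z (2 * p)}
    (hΩ : ∀ z, IsTransverseAt (Ω z)) {z : Z} {t : T} (ht : t ∈ (extChartAt J z).target) :
    IsTransverseAt (inChart J Ω z t) := by
  rw [inChart_eq]
  exact (hΩ _).comp (injective_fderiv_transition (mem_overlap_self ht))

/-- The fibre integral of a transverse form is transverse: the integrands are non-negative, and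
positive where the partition of unity is. -/
lemma isTransverseAt_fibreIntegral [IsManifold J ω Z] [Nonempty Y] {s r n : ℕ} (hs : s = r + n)
    (h : 2 * s = 2 * r + 2 * n) (w : Module.Basis (Fin n) ℂ F) {Ω : Form T Z (2 * s)}
    (hΩ : IsSmooth J Ω) (hT : ∀ z, IsTransverseAt (Ω z)) (x : X) :
    IsTransverseAt (fibreIntegral D P μ h (complexFrame w) Ω x) := by
  intro v hv
  set e := extChartAt 𝓘(ℂ, B) x x with he
  have hx : e ∈ (extChartAt 𝓘(ℂ, B) x).target := mem_extChartAt_target x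
  set g : Y → F → ℝ := fun y u =>
    (fibreIntegrand D P h (complexFrame w) Ω x y e u (complexFrame v)).re with hg
  have hg_mem : ∀ y, ∀ u ∈ (extChartAt 𝓘(ℂ, F) y).target, ∃ a : ℝ, 0 < a ∧
      g y u = P.ρ y ((extChartAt 𝓘(ℂ, F) y).symm u) * a := by
    intro y u hu
    have ht : D.inB e + D.inF u ∈ (extChartAt J (D.pair x y)).target :=
      (D.mem_target x y e u).2 ⟨hx, hu⟩
    refine ⟨_, isTransverseAt_inChart hT ht _ (D.linearIndependent hs hv w.linearIndependent), ?_⟩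
    simp only [hg]
    rw [fibreIntegrand_of_mem D P h _ _ _ _ hu, ContinuousAlternatingMap.smul_apply,
      contract_apply, Complex.smul_re, complexFrame_elim hs h, complexFrame_map, complexFrame_map]
    rfl
  have hg_nonneg : ∀ y, 0 ≤ g y := by
    intro y u
    by_cases hu : u ∈ (extChartAt 𝓘(ℂ, F) y).target
    · obtain ⟨a, ha, hga⟩ := hg_mem y u hu
      rw [Pi.zero_apply, hga]
      exact mul_nonneg (P.nonneg _ _) ha.le
    · simp only [hg]
      rw [fibreIntegrand_of_notMem D P h _ _ _ _ hu]
      simp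
  have hre : (fibreIntegral D P μ h (complexFrame w) Ω x (complexFrame v)).re =
      ∑ y ∈ P.s, ∫ u, g y u ∂μ := by
    rw [fibreIntegral_apply D P μ h _ hΩ, Complex.re_sum]
    refine Finset.sum_congr rfl fun y _ => ?_
    exact (Complex.reCLM.integral_comp_comm
      (integrable_fibreIntegrand_apply D P μ h _ hΩ x y (complexFrame v))).symm
  rw [hre]
  obtain ⟨z⟩ := ‹Nonempty Y›
  obtain ⟨y, hy, hyz⟩ : ∃ y ∈ P.s, 0 < P.ρ y z := by
    by_contra! hcon
    have h1 := P.sum_eq_one z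
    have h2 : ∑ y ∈ P.s, P.ρ y z ≤ 0 := Finset.sum_nonpos hcon
    linarith
  refine Finset.sum_pos' (fun y _ => integral_nonneg (hg_nonneg y)) ⟨y, hy, ?_⟩
  have hzK : z ∈ P.K y := by
    by_contra hz
    exact hyz.ne' (P.zero_off y z hz)
  have hzs := P.subset y hzK
  have hcont : Continuous (g y) := by
    have h1 : Continuous fun u => fibreIntegrand D P h (complexFrame w) Ω x y e u := by
      have h2 := (contDiffOn_fibreIntegrand D P h (complexFrame w) hΩ x y).continuousOn
      exact h2.comp_continuous (f := fun u : F => (e, u)) (by fun_prop) fun u => ⟨hx, mem_univ _⟩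
    exact Complex.continuous_re.comp
      ((ContinuousAlternatingMap.apply ℝ B ℂ (complexFrame v)).continuous.comp h1)
  refine hcont.integral_pos_of_hasCompactSupport_nonneg_nonzero
    (x := extChartAt 𝓘(ℂ, F) y z) ?_ (hg_nonneg y) ?_
  · refine HasCompactSupport.intro (isCompact_image_chart (P.isCompact y) (P.subset y))
      fun u hu => ?_
    simp only [hg]
    rw [fibreIntegrand_eq_zero D P h _ _ _ _ hu]
    simp
  · obtain ⟨a, ha, hga⟩ := hg_mem y _ ((extChartAt 𝓘(ℂ, F) y).map_source hzs)
    rw [hga, (extChartAt 𝓘(ℂ, F) y).left_inv hzs]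
    exact (mul_pos hyz ha).ne'

section Types

variable [T2Space Y] [IsManifold 𝓘(ℂ, B) ω X] [IsManifold 𝓘(ℂ, F) ω Y] [IsManifold J ω Z]

/-- Fibre integration preserves the four closedness conditions. -/
lemma isClosedOfType_fibreIntegral {τ : KahlerType} {s r n : ℕ} (hs : s = r + n) (hr : 1 ≤ r)
    (hn : Module.finrank ℂ F = n) (h : 2 * s = 2 * r + 2 * n)
    (b : Module.Basis (Fin (2 * n)) ℝ F) {Ω : Form T Z (2 * s)} (hΩ : IsSmooth J Ω)
    (hc : IsClosedOfType J Ω τ) :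
    IsClosedOfType 𝓘(ℂ, B) (fibreIntegral D P μ h b Ω) τ := by
  cases τ with
  | kahler =>
    rw [IsClosedOfType] at hc ⊢
    rw [← fibreIntegral_extD D P μ h (by omega) b hΩ, hc, fibreIntegral_zero]
  | weaklyKahler =>
    obtain ⟨k, hk, α, hα, hΩα⟩ := hc
    have hkn : k = 2 * r - 1 + 2 * n := by omega
    refine ⟨2 * r - 1, by omega, fibreIntegral D P μ hkn b α,
      isSmooth_fibreIntegral D P μ hkn b hα, fun x v => ?_⟩
    rw [← fibreIntegral_del D P μ hn h (by omega) b hΩ, ← fibreIntegral_delbar D P μ hn hkn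
      (by omega) b hα, ← fibreIntegral_del D P μ hn _ (by omega) b hα.delbar]
    exact fibreIntegral_cast D P μ hk _ _ _ b hΩα x v
  | symplectic =>
    obtain ⟨Ψ, comp, hΨ, hreal, hd, hbi, hsum, hcomp⟩ := hc
    have hsm : ∀ a ≤ 2 * s, IsSmooth J (comp a) := fun a ha => isSmooth_component hΨ hbi hsum ha
    refine ⟨fibreIntegral D P μ h b Ψ, fun a => fibreIntegral D P μ h b (comp (n + a)),
      isSmooth_fibreIntegral D P μ h b hΨ, isReal_fibreIntegral D P μ h b hΨ hreal, ?_, ?_, ?_, ?_⟩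
    · rw [← fibreIntegral_extD D P μ h (by omega) b hΨ, hd, fibreIntegral_zero]
    · intro a ha x
      refine hasBidegree_fibreIntegral D P μ hn h b (hsm _ (by omega)) (fun z => ?_) (by omega) x
      have := hbi (n + a) (by omega) z
      have e2 : 2 * s - (n + a) = 2 * r - a + n := by omega
      rw [e2] at this
      have e1 : a + n = n + a := add_comm a n
      rwa [e1]
    · have hzero : ∀ a ≤ 2 * s, a < n ∨ 2 * s - a < n →
          fibreIntegral D P μ h b (comp a) = 0 := fun a ha hlt =>
        fibreIntegral_eq_zero_of_bidegree_lt D P μ hn h b (hsm a ha) (hbi a ha) hlt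
      have hN : 2 * s + 1 = n + (2 * r + 1) + n := by omega
      rw [hsum, fibreIntegral_sum D P μ h b fun a ha => hsm a
        (by simpa [Nat.lt_succ_iff] using ha), hN, Finset.sum_range_add, Finset.sum_range_add]
      rw [Finset.sum_eq_zero (s := Finset.range n)
        (f := fun a => fibreIntegral D P μ h b (comp a)), Finset.sum_eq_zero
        (f := fun a => fibreIntegral D P μ h b (comp (n + (2 * r + 1) + a))), zero_add, add_zero]
      · intro a ha
        rw [Finset.mem_range] at ha
        exact hzero _ (by omega) (by omega)
      · intro a ha
        rw [Finset.mem_range] at ha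
        exact hzero _ (by omega) (by omega)
    · have : n + r = s := by omega
      beta_reduce
      rw [this, hcomp]
  | pluriclosed =>
    rw [IsClosedOfType] at hc ⊢
    rw [← fibreIntegral_delbar D P μ hn h (by omega) b hΩ,
      ← fibreIntegral_del D P μ hn _ (by omega) b hΩ.delbar, hc, fibreIntegral_zero]

end Types

end FibreIntegralKahler

section Base

variable {B F T : Type*} [NormedAddCommGroup B] [NormedSpace ℂ B] [NormedAddCommGroup F]
  [NormedSpace ℂ F] [FiniteDimensional ℂ F] [NormedAddCommGroup T] [NormedSpace ℂ T]
  {X : Type*} [TopologicalSpace X] [ChartedSpace B X] [IsManifold 𝓘(ℂ, B) ω X]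
  {Y : Type*} [TopologicalSpace Y] [ChartedSpace F Y] [IsManifold 𝓘(ℂ, F) ω Y]
  [T2Space Y] [Nonempty Y] [CompactSpace Y]
  {H : Type*} [TopologicalSpace H] {J : ModelWithCorners ℂ T H} [J.Boundaryless]
  {Z : Type*} [TopologicalSpace Z] [ChartedSpace H Z] [IsManifold J ω Z]

/-- If the product of a base and a compact fibre of dimension `n` is `(r + n)`-Kähler of some type,
then the base is `r`-Kähler of the same type. -/
theorem ProductCharts.isPKahler_base (D : ProductCharts B F X Y J Z) {τ : KahlerType} {s r n : ℕ}
    (hs : s = r + n) (hr : 1 ≤ r) (hn : Module.finrank ℂ F = n) (hZ : IsPKahler J Z τ s) :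
    IsPKahler 𝓘(ℂ, B) X τ r := by
  have : FiniteDimensional ℝ F := FiniteDimensional.complexToReal F
  let _ : MeasurableSpace F := borel F
  have : BorelSpace F := ⟨rfl⟩
  obtain ⟨P⟩ := exists_chartPartition (E := F) (F := Y)
  let w := Module.finBasisOfFinrankEq ℂ F hn
  obtain ⟨b, hb⟩ := exists_basis_eq_complexFrame w
  obtain ⟨Ω, hΩ⟩ := hZ
  have h : 2 * s = 2 * r + 2 * n := by omega
  refine ⟨fibreIntegral D P MeasureTheory.Measure.addHaar h b Ω, ?_, ?_, ?_, ?_, ?_⟩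
  · exact isSmooth_fibreIntegral D P _ h b hΩ.smooth
  · exact isReal_fibreIntegral D P _ h b hΩ.smooth hΩ.real
  · refine hasBidegree_fibreIntegral D P _ hn h b hΩ.smooth (fun z => ?_) (by omega)
    have := hΩ.bidegree z
    subst hs
    exact this
  · rw [hb]
    exact isTransverseAt_fibreIntegral D P _ hs h w hΩ.smooth hΩ.transverse
  · exact isClosedOfType_fibreIntegral D P _ hs hr hn h b hΩ.smooth hΩ.closed

end Base

/-! ### The two projections of a product -/

section ProductManifold

open Set Filter Topology

variable {B F : Type*} [NormedAddCommGroup B] [NormedSpace ℂ B] [NormedAddCommGroup F]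
  [NormedSpace ℂ F] {X : Type*} [TopologicalSpace X] [ChartedSpace B X]
  {Y : Type*} [TopologicalSpace Y] [ChartedSpace F Y]

variable (B F X Y) in
/-- The product `X × Y` with base `X`. -/
def productChartsLeft : ProductCharts B F X Y ((𝓘(ℂ, B)).prod 𝓘(ℂ, F)) (X × Y) where
  pair x y := (x, y)
  inB := ContinuousLinearMap.inl ℂ B F
  inF := ContinuousLinearMap.inr ℂ B F
  prB := ContinuousLinearMap.fst ℂ B F
  prF := ContinuousLinearMap.snd ℂ B F
  prB_add e u := by simp
  prF_add e u := by simp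
  add_pr t := by simp
  mem_target x y e u := by
    rw [extChartAt_prod, PartialEquiv.prod_target, mem_prod]; simp
  mem_source x y x' y' := by simp
  symm_apply x y e u := by
    rw [extChartAt_prod, PartialEquiv.prod_symm, PartialEquiv.prod_coe]; simp
  apply_pair x y x' y' := by simp

variable (B F X Y) in
/-- The product `X × Y` with base `Y`. -/
def productChartsRight : ProductCharts F B Y X ((𝓘(ℂ, B)).prod 𝓘(ℂ, F)) (X × Y) where
  pair y x := (x, y)
  inB := ContinuousLinearMap.inr ℂ B F
  inF := ContinuousLinearMap.inl ℂ B F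
  prB := ContinuousLinearMap.snd ℂ B F
  prF := ContinuousLinearMap.fst ℂ B F
  prB_add e u := by simp
  prF_add e u := by simp
  add_pr t := by simp
  mem_target x y e u := by
    rw [extChartAt_prod, PartialEquiv.prod_target, mem_prod, and_comm]; simp
  mem_source x y x' y' := by simp [and_comm]
  symm_apply x y e u := by
    rw [extChartAt_prod, PartialEquiv.prod_symm, PartialEquiv.prod_coe]; simp
  apply_pair x y x' y' := by simp

end ProductManifold

section Sharpness

variable {τ : KahlerType} {m n p q : ℕ}
  {X : Type*} [TopologicalSpace X] [ChartedSpace (Cn m) X] [IsManifold 𝓘(ℂ, Cn m) ω X]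
  {Y : Type*} [TopologicalSpace Y] [ChartedSpace (Cn n) Y] [IsManifold 𝓘(ℂ, Cn n) ω Y]

/-- Integration along a compact second factor lowers the degree by the dimension of that factor. -/
lemma isPKahler_left [T2Space Y] [Nonempty Y] [CompactSpace Y] {s r : ℕ} (hs : s = r + n)
    (hr : 1 ≤ r) (h : ProductIsPKahler τ m n X Y s) :
    IsPKahler 𝓘(ℂ, Cn m) X τ r :=
  (productChartsLeft (Cn m) (Cn n) X Y).isPKahler_base hs hr (by simp) h

/-- Integration along a compact first factor lowers the degree by the dimension of that factor. -/
lemma isPKahler_right [T2Space X] [Nonempty X] [CompactSpace X] {s r : ℕ} (hs : s = r + m)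
    (hr : 1 ≤ r) (h : ProductIsPKahler τ m n X Y s) :
    IsPKahler 𝓘(ℂ, Cn n) Y τ r :=
  (productChartsRight (Cn m) (Cn n) X Y).isPKahler_base hs hr (by simp) h

/-- The bound for the general product is sharp: a form of lower degree on the product could be
integrated along the fibres of one of the projections. -/
theorem GeneralSetting.not_productIsPKahler [T2Space X] [Nonempty X] [CompactSpace X]
    [T2Space Y] [Nonempty Y] [CompactSpace Y] (h : GeneralSetting τ m n p q X Y) :
    ¬ ProductIsPKahler τ m n X Y (generalBound m n p q - 1) := by
  intro hZ
  obtain ⟨hp, hpm, hq, hqn, hne, hl, hr, -, hX, hY⟩ := h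
  rw [generalBound] at hZ
  have hne' : ¬ (p = 1 ∧ q = 1) := fun h => hne (by rw [h.1, h.2])
  -- `X` is the base if the minimum is `m - p` and `p` can be lowered; otherwise `left_index` and
  -- `right_index` force the minimum to be `n - q` with `2 ≤ q`
  by_cases hX' : m - p ≤ n - q ∧ 2 ≤ p
  · exact hX hX'.2 (isPKahler_left (s := m + n - min (m - p) (n - q) - 1) (by omega) (by omega) hZ)
  · have hpq : n - q ≤ m - p ∧ 2 ≤ q := by omega
    exact hY hpq.2 (isPKahler_right (s := m + n - min (m - p) (n - q) - 1) (by omega) (by omega) hZ)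

/-- The bound for the product with a Kähler manifold is sharp. -/
theorem KahlerSetting.not_productIsPKahler [T2Space X] [Nonempty X] [CompactSpace X]
    (h : KahlerSetting τ m n q X Y) : ¬ ProductIsPKahler τ m n X Y (m + q - 1) := by
  intro hZ
  obtain ⟨hm, hq, hqn, hne, -, -, hY⟩ := h
  have hq' : q ≠ 1 := fun h => hne (by rw [h])
  exact hY (isPKahler_right (s := m + q - 1) (by omega) (by omega) hZ)

end Sharpness

/-! ### The relations between `d` and `d^c` -/

section Relations

open Set Filter Topology ContinuousAlternatingMap

variable {E : Type*} [NormedAddCommGroup E] [NormedSpace ℂ E]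

lemma scaleL_scaleL {k : ℕ} {c c' : ℂ} (h : c * c' = 1) (η : E [⋀^Fin k]→L[ℝ] ℂ) :
    scaleL E k c (scaleL E k c' η) = η := by
  ext v
  rw [scaleL_apply, scaleL_apply]
  simp only [smul_smul, mul_comm c', h, one_smul]

/-- The operator `d^c` is the exterior derivative with respect to the vectors `- i v`. -/
lemma scaleL_extDeriv_scaleL {k : ℕ} {η : E → E [⋀^Fin k]→L[ℝ] ℂ} {e : E}
    (hη : DifferentiableAt ℝ η e) :
    scaleL E (k + 1) (-Complex.I) (extDeriv (fun e => scaleL E k Complex.I (η e)) e) =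
      alternatizeUncurryFin ((fderiv ℝ η e).comp
        (((-Complex.I) • ContinuousLinearMap.id ℂ E).restrictScalars ℝ)) := by
  have h1 : fderiv ℝ (fun e => scaleL E k Complex.I (η e)) e =
      (scaleL E k Complex.I).comp (fderiv ℝ η e) :=
    ((scaleL E k Complex.I).hasFDerivAt.comp e hη.hasFDerivAt).fderiv
  ext v
  rw [scaleL_apply, extDeriv, h1, alternatizeUncurryFin_apply, alternatizeUncurryFin_apply]
  refine Finset.sum_congr rfl fun i _ => ?_
  congr 1
  rw [ContinuousLinearMap.comp_apply, scaleL_apply, ContinuousLinearMap.comp_apply]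
  congr 1
  funext j
  simp [Fin.removeNth, smul_smul]

/-- The local form of `d d^c = - d^c d`. It holds because the second derivative of `η` is symmetric,
so that the two directions of differentiation, one of them multiplied by `-i`, can be exchanged. -/
lemma extDeriv_twisted {k : ℕ} {η : E → E [⋀^Fin k]→L[ℝ] ℂ} {e : E} (hη : ContDiffAt ℝ ∞ η e) :
    extDeriv (fun e => scaleL E (k + 1) (-Complex.I)
      (extDeriv (fun e => scaleL E k Complex.I (η e)) e)) e =
    - scaleL E (k + 1 + 1) (-Complex.I)
      (extDeriv (fun e => scaleL E (k + 1) Complex.I (extDeriv η e)) e) := by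
  set S : E →L[ℝ] E := ((-Complex.I) • ContinuousLinearMap.id ℂ E).restrictScalars ℝ with hS
  set alt := alternatizeUncurryFinCLM (n := k) ℝ E ℂ with halt
  set Λ := alt.comp ((ContinuousLinearMap.compL ℝ E E (E [⋀^Fin k]→L[ℝ] ℂ)).flip S) with hΛ
  have hev : ∀ᶠ e' in 𝓝 e, ContDiffAt ℝ 1 η e' := (hη.of_le (by simp)).eventually (by simp)
  have hd : DifferentiableAt ℝ (fderiv ℝ η) e :=
    (hη.fderiv_right (m := ∞) (by simp)).differentiableAt (by simp)
  have h1 : (fun e => scaleL E (k + 1) (-Complex.I)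
      (extDeriv (fun e => scaleL E k Complex.I (η e)) e)) =ᶠ[𝓝 e]
      fun e' => Λ (fderiv ℝ η e') := by
    filter_upwards [hev] with e' he'
    exact scaleL_extDeriv_scaleL (he'.differentiableAt (by simp))
  have h2 : HasFDerivAt (fun e' => Λ (fderiv ℝ η e')) (Λ.comp (fderiv ℝ (fderiv ℝ η) e)) e :=
    HasFDerivAt.comp (g := Λ) (f := fderiv ℝ η) e Λ.hasFDerivAt hd.hasFDerivAt
  set Λ' := alt.comp ((ContinuousLinearMap.compL ℝ E E (E [⋀^Fin k]→L[ℝ] ℂ)).flip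
    (ContinuousLinearMap.id ℝ E)) with hΛ'
  have h3 : HasFDerivAt (extDeriv η) (Λ'.comp (fderiv ℝ (fderiv ℝ η) e)) e :=
    HasFDerivAt.comp (g := Λ') (f := fderiv ℝ η) e Λ'.hasFDerivAt hd.hasFDerivAt
  rw [h1.extDeriv_eq, extDeriv, h2.fderiv, scaleL_extDeriv_scaleL h3.differentiableAt, h3.fderiv,
    eq_neg_iff_add_eq_zero, ← alternatizeUncurryFin_add]
  have h4 : Λ.comp (fderiv ℝ (fderiv ℝ η) e) + (Λ'.comp (fderiv ℝ (fderiv ℝ η) e)).comp S =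
      alt.comp (((ContinuousLinearMap.compL ℝ E E (E [⋀^Fin k]→L[ℝ] ℂ)).flip S).comp
        (fderiv ℝ (fderiv ℝ η) e) + (fderiv ℝ (fderiv ℝ η) e).comp S) := by
    ext u v
    simp only [hΛ, hΛ', _root_.add_apply, ContinuousLinearMap.comp_apply, map_add]
    rfl
  rw [← hS, h4]
  refine alternatizeUncurryFin_alternatizeUncurryFinCLM_comp_of_symmetric fun u w => ?_
  have hsym : IsSymmSndFDerivAt ℝ η e := hη.isSymmSndFDerivAt
    (by rw [minSmoothness_of_isRCLikeNormedField]; exact WithTop.coe_le_coe.2 le_top)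
  simp only [_root_.add_apply, ContinuousLinearMap.comp_apply,
    ContinuousLinearMap.flip_apply, ContinuousLinearMap.compL_apply]
  rw [hsym.eq u (S w), hsym.eq (S u) w, add_comm]

lemma scale_scale {M : Type*} {k : ℕ} {c c' : ℂ} (h : c * c' = 1) (θ : Form E M k) :
    scale c (scale c' θ) = θ := by
  funext x
  exact scaleL_scaleL h (θ x)

lemma scale_zero_form {M : Type*} (k : ℕ) (c : ℂ) : scale c (0 : Form E M k) = 0 := rfl

variable {H : Type*} [TopologicalSpace H] {I : ModelWithCorners ℂ E H}
  {M : Type*} [TopologicalSpace M] [ChartedSpace H M]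

lemma delbar_zero {k : ℕ} : delbar I (0 : Form E M k) = 0 := by
  rw [delbar, extDc, scale_zero_form, extD_zero, scale_zero_form]
  funext x; ext v; simp

lemma del_zero {k : ℕ} : del I (0 : Form E M k) = 0 := by
  rw [del, extDc, scale_zero_form, extD_zero, scale_zero_form]
  funext x; ext v; simp

/-- Forms of bidegree `(p, p)` are invariant under the complex structure. -/
lemma scale_eq_self {N : Type*} {k p : ℕ} {Ω : Form E N k} (h : ∀ x, HasBidegree p p (Ω x)) {c : ℂ}
    (hc : c * (starRingEnd ℂ) c = 1) : scale c Ω = Ω := by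
  rw [HasBidegree.scale_eq_smul h, ← mul_pow, hc, one_pow]
  funext x; ext v; simp

lemma extDc_eq_zero {p : ℕ} {Ω : Form E M (2 * p)} (hb : ∀ x, HasBidegree p p (Ω x))
    (hd : extD I Ω = 0) : extDc I Ω = 0 := by
  rw [extDc, scale_eq_self hb (by simp), hd, scale_zero_form]

/-- A closed transverse form satisfies each of the four closedness conditions. -/
lemma IsKahlerForm.of_kahler {p : ℕ} (hp : 1 ≤ p) {Ω : Form E M (2 * p)}
    (h : IsKahlerForm I .kahler Ω) (τ : KahlerType) : IsKahlerForm I τ Ω := by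
  refine ⟨h.smooth, h.real, h.bidegree, h.transverse, ?_⟩
  have hd : extD I Ω = 0 := h.closed
  have hdc : extDc I Ω = 0 := extDc_eq_zero h.bidegree hd
  have hdel : del I Ω = 0 := by rw [del, hd, hdc]; funext x; ext v; simp
  have hdelbar : delbar I Ω = 0 := by rw [delbar, hd, hdc]; funext x; ext v; simp
  cases τ with
  | kahler => exact hd
  | weaklyKahler =>
    refine ⟨2 * p - 1, by omega, 0, isSmooth_zero, fun x v => ?_⟩
    rw [hdel, delbar_zero, del_zero]
    rfl
  | symplectic =>
    refine ⟨Ω, fun a => if a = p then Ω else 0, h.smooth, h.real, hd, fun a ha x => ?_, ?_, ?_⟩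
    · refine ⟨by omega, fun c v => ?_⟩
      by_cases hap : a = p
      · subst hap
        have h2 : 2 * a - a = a := by omega
        simp only [if_true, h2]
        exact (h.bidegree x).2 c v
      · simp [hap]
    · rw [Finset.sum_ite_eq' (Finset.range (2 * p + 1)) p fun _ => Ω, if_pos]
      exact Finset.mem_range.2 (by omega)
    · simp
  | pluriclosed =>
    rw [IsClosedOfType, hdelbar, del_zero]

variable [I.Boundaryless]

lemma extD_smul {k : ℕ} {θ : Form E M k} (c : ℂ) (h : IsSmooth I θ) :
    extD I (c • θ) = c • extD I θ := by
  funext x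
  ext v
  have h1 := h.differentiableAt (mem_extChartAt_target x)
  have h2 : fderiv ℝ (c • inChart I θ x) (extChartAt I x x) =
    c • fderiv ℝ (inChart I θ x) (extChartAt I x x) := (h1.hasFDerivAt.const_smul c).fderiv
  simp only [extD, inChart_smul, extDeriv, h2, Pi.smul_apply, alternatizeUncurryFin_apply,
    ContinuousAlternatingMap.smul_apply, _root_.smul_apply, Finset.smul_sum]
  exact Finset.sum_congr rfl fun i _ => smul_comm _ _ _

lemma extDc_add {k : ℕ} {θ θ' : Form E M k} (h : IsSmooth I θ) (h' : IsSmooth I θ') :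
    extDc I (θ + θ') = extDc I θ + extDc I θ' := by
  have : scale Complex.I (θ + θ') = scale Complex.I θ + scale Complex.I θ' := rfl
  rw [extDc, this, extD_add (h.scale _) (h'.scale _)]
  rfl

lemma extDc_smul {k : ℕ} {θ : Form E M k} (c : ℂ) (h : IsSmooth I θ) :
    extDc I (c • θ) = c • extDc I θ := by
  have : scale Complex.I (c • θ) = c • scale Complex.I θ := rfl
  rw [extDc, this, extD_smul c (h.scale _)]
  rfl

variable [IsManifold I ω M]

lemma extD_extD {k : ℕ} {θ : Form E M k} (h : IsSmooth I θ) : extD I (extD I θ) = 0 := by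
  refine form_ext_inChart (I := I) fun x e he => ?_
  have h1 : inChart I (extD I θ) x =ᶠ[𝓝 e] extDeriv (inChart I θ x) := by
    filter_upwards [extChartAt_target_mem_nhds' he] with e' he' using inChart_extD h he'
  rw [inChart_extD h.extD he, h1.extDeriv_eq]
  exact extDeriv_extDeriv_apply ((h x).contDiffAt (extChartAt_target_mem_nhds' he))
    (by rw [minSmoothness_of_isRCLikeNormedField]; exact WithTop.coe_le_coe.2 le_top)

lemma extDc_extDc {k : ℕ} {θ : Form E M k} (h : IsSmooth I θ) : extDc I (extDc I θ) = 0 := by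
  rw [extDc, extDc, scale_scale (by simp), extD_extD (h.scale _), scale_zero_form]

lemma inChart_extDc {k : ℕ} {θ : Form E M k} (h : IsSmooth I θ) {x : M} {e : E}
    (he : e ∈ (extChartAt I x).target) :
    inChart I (extDc I θ) x e = scaleL E (k + 1) (-Complex.I)
      (extDeriv (fun e => scaleL E k Complex.I (inChart I θ x e)) e) := by
  rw [extDc, inChart_scale]
  beta_reduce
  rw [inChart_extD (h.scale _) he, inChart_scale]

lemma inChart_extD_extDc {k : ℕ} {θ : Form E M k} (h : IsSmooth I θ) {x : M} {e : E}
    (he : e ∈ (extChartAt I x).target) :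
    inChart I (extD I (extDc I θ)) x e = extDeriv (fun e => scaleL E (k + 1) (-Complex.I)
      (extDeriv (fun e => scaleL E k Complex.I (inChart I θ x e)) e)) e := by
  rw [inChart_extD h.extDc he]
  refine Filter.EventuallyEq.extDeriv_eq ?_
  filter_upwards [extChartAt_target_mem_nhds' he] with e' he' using inChart_extDc h he'

lemma extDc_extD {k : ℕ} {θ : Form E M k} (h : IsSmooth I θ) :
    extDc I (extD I θ) = - extD I (extDc I θ) := by
  refine form_ext_inChart (I := I) fun x e he => ?_
  have h0 : inChart I (-extD I (extDc I θ)) x = - inChart I (extD I (extDc I θ)) x := rfl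
  rw [h0, Pi.neg_apply, inChart_extD_extDc h he, extDeriv_twisted
    ((h x).contDiffAt (extChartAt_target_mem_nhds' he)), neg_neg, inChart_extDc h.extD he]
  congr 1
  refine Filter.EventuallyEq.extDeriv_eq ?_
  filter_upwards [extChartAt_target_mem_nhds' he] with e' he'
  rw [inChart_extD h he']

lemma del_delbar {k : ℕ} {θ : Form E M k} (h : IsSmooth I θ) :
    del I (delbar I θ) = (-Complex.I / 2) • extD I (extDc I θ) := by
  have h1 : IsSmooth I (extD I θ + (-Complex.I) • extDc I θ) := h.extD.add (h.extDc.smul _)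
  rw [del, delbar_eq, extD_smul _ h1, extDc_smul _ h1, extD_add h.extD (h.extDc.smul _),
    extDc_add h.extD (h.extDc.smul _), extD_smul _ h.extDc, extDc_smul _ h.extDc, extD_extD h,
    extDc_extDc h, extDc_extD h]
  funext x
  ext v
  simp only [Pi.smul_apply, Pi.add_apply, Pi.zero_apply, Pi.neg_apply,
    ContinuousAlternatingMap.smul_apply, ContinuousAlternatingMap.add_apply,
    ContinuousAlternatingMap.neg_apply, smul_eq_mul]
  have h0 : (0 : E [⋀^Fin (k + 1 + 1)]→L[ℝ] ℂ) v = 0 := rfl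
  rw [h0]
  ring_nf

/-- A transverse `(1, 1)`-form of any of the four types is pluriclosed. -/
lemma IsKahlerForm.extD_extDc_eq_zero {τ : KahlerType} {Ω : Form E M (2 * 1)}
    (h : IsKahlerForm I τ Ω) : extD I (extDc I Ω) = 0 := by
  have hs := h.smooth
  have hc := h.closed
  have hscale : scale Complex.I Ω = Ω := scale_eq_self h.bidegree (by simp)
  cases τ with
  | kahler =>
    have hd : extD I Ω = 0 := hc
    rw [extDc_eq_zero h.bidegree hd, extD_zero]
  | weaklyKahler =>
    obtain ⟨k, hk, α, hα, hΩα⟩ := hc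
    obtain rfl : k = 1 := by omega
    have h1 : del I Ω = del I (delbar I α) := by funext x; ext v; exact hΩα x v
    rw [del_delbar hα] at h1
    have h2 := congrArg (extD I) h1
    rw [extD_smul _ hα.extDc.extD, extD_extD hα.extDc, del,
      extD_smul _ (hs.extD.add (hs.extDc.smul _)), extD_add hs.extD (hs.extDc.smul _),
      extD_extD hs, extD_smul _ hs.extDc] at h2
    funext x
    ext v
    have h3 := DFunLike.congr_fun (congrFun h2 x) v
    simpa using h3
  | symplectic =>
    obtain ⟨Ψ, comp, hΨ, -, hd, hb, hsum, hcomp⟩ := hc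
    have h1 : Ω = (1 / 2 : ℂ) • (Ψ + scale Complex.I Ψ) := by
      funext x
      ext v
      have e0 := (hb 0 (by omega) x).2 Complex.I v
      have e1 := (hb 1 (by omega) x).2 Complex.I v
      have e2 := (hb 2 (by omega) x).2 Complex.I v
      have e : ∀ w, Ψ x w = comp 0 x w + comp 1 x w + comp 2 x w := fun w => by
        rw [hsum]
        simp [Finset.sum_range_succ]
      simp only [Pi.smul_apply, Pi.add_apply, ContinuousAlternatingMap.smul_apply,
        ContinuousAlternatingMap.add_apply, scale_apply, e, e0, e1, e2, ← hcomp, smul_eq_mul]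
      norm_num
      ring
    have h2 : extDc I Ω = (1 / 2 : ℂ) • extDc I Ψ := by
      have h3 : extDc I Ω = scale (-Complex.I) (extD I Ω) := by rw [extDc, hscale]
      rw [h3]
      conv_lhs => rw [h1]
      rw [extD_smul _ (hΨ.add (hΨ.scale _)), extD_add hΨ (hΨ.scale _), hd, zero_add]
      rfl
    have h4 := extDc_extD hΨ
    rw [hd, extDc, scale_zero_form, extD_zero, scale_zero_form] at h4
    rw [h2, extD_smul _ hΨ.extDc, ← neg_eq_iff_eq_neg.2 h4]
    funext x; ext v; simp
  | pluriclosed =>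
    have h1 : del I (delbar I Ω) = 0 := hc
    rw [del_delbar hs] at h1
    funext x
    ext v
    have h3 := DFunLike.congr_fun (congrFun h1 x) v
    simpa using h3

end Relations

/-! ### The standard volume form -/

section Volume

/-- The standard complex basis of `ℂ^p`. -/
def stdBasis (p : ℕ) : Module.Basis (Fin p) ℂ (Cn p) := (EuclideanSpace.basisFun (Fin p) ℂ).toBasis

lemma stdBasis_apply (p : ℕ) (i j : Fin p) : stdBasis p i j = if j = i then 1 else 0 := by
  simp [stdBasis]

lemma stdBasis_repr (p : ℕ) (v : Cn p) (i : Fin p) : (stdBasis p).repr v i = v i := by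
  simp [stdBasis]

/-- The real basis `(e₀, i e₀, e₁, i e₁, …)` of `ℂ^p`. -/
def frameBasis (p : ℕ) : Module.Basis (Fin (2 * p)) ℝ (Cn p) :=
  (exists_basis_eq_complexFrame (stdBasis p)).choose

lemma coe_frameBasis (p : ℕ) : ⇑(frameBasis p) = complexFrame (stdBasis p) :=
  (exists_basis_eq_complexFrame (stdBasis p)).choose_spec

/-- The standard volume form of `ℂ^p`, as a complex-valued covector of degree `2 p`. -/
def vol (p : ℕ) : Cn p [⋀^Fin (2 * p)]→L[ℝ] ℂ :=
  { Complex.ofRealCLM.toLinearMap.compAlternatingMap (frameBasis p).det with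
    cont := by
      have h : Continuous fun v : Fin (2 * p) → Cn p =>
          (((frameBasis p).toMatrix v).det : ℂ) := by
        refine Complex.continuous_ofReal.comp (Continuous.matrix_det ?_)
        refine continuous_matrix fun i j => ?_
        exact (LinearMap.continuous_of_finiteDimensional
          ((frameBasis p).coord i)).comp (continuous_apply j)
      exact h }

lemma vol_apply (p : ℕ) (v : Fin (2 * p) → Cn p) : vol p v = ((frameBasis p).det v : ℂ) := rfl

lemma vol_map {p : ℕ} (A : Cn p →ₗ[ℂ] Cn p) (v : Fin (2 * p) → Cn p) :
    vol p (fun j => A (v j)) = Complex.normSq (LinearMap.det A) * vol p v := by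
  have h := (frameBasis p).det_comp (A.restrictScalars ℝ) v
  rw [LinearMap.det_restrictScalars, Algebra.norm_complex_apply] at h
  rw [vol_apply, vol_apply, ← Complex.ofReal_mul, ← h]
  rfl

lemma vol_complexFrame {p : ℕ} (v : Fin p → Cn p) :
    vol p (complexFrame v) = Complex.normSq (Matrix.of fun i j => v i j).det := by
  set A : Cn p →ₗ[ℂ] Cn p := (stdBasis p).constr ℂ v with hA
  have h1 : ∀ j, A (stdBasis p j) = v j := fun j => (stdBasis p).constr_basis ℂ v j
  have h2 : LinearMap.det A = (Matrix.of fun i j => v i j).det := by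
    have h3 := (stdBasis p).det_comp A (stdBasis p)
    rw [Module.Basis.det_self, mul_one, Module.Basis.det_apply, ← Matrix.det_transpose] at h3
    rw [← h3]
    congr 1
    ext i j
    simp [Module.Basis.toMatrix_apply, stdBasis_repr, h1, Matrix.transpose_apply]
  have h4 : complexFrame v = fun j => A (frameBasis p j) := by
    rw [coe_frameBasis]
    funext j
    rw [complexFrame, complexFrame, map_smul, h1]
  rw [h4, vol_map, h2, vol_apply, Module.Basis.det_self]
  simp

lemma vol_real {p : ℕ} (v : Fin (2 * p) → Cn p) : (starRingEnd ℂ) (vol p v) = vol p v := by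
  rw [vol_apply, Complex.conj_ofReal]

lemma vol_smul {p : ℕ} (c : ℂ) (v : Fin (2 * p) → Cn p) :
    vol p (fun j => c • v j) = c ^ p * (starRingEnd ℂ c) ^ p * vol p v := by
  have h := vol_map (c • (LinearMap.id : Cn p →ₗ[ℂ] Cn p)) v
  rw [LinearMap.det_smul, LinearMap.det_id, mul_one, finrank_euclideanSpace, Fintype.card_fin,
    map_pow, Complex.ofReal_pow, ← Complex.mul_conj, mul_pow] at h
  exact h

lemma ext_of_basis {V : Type*} [AddCommGroup V] [Module ℝ V] {d : ℕ}
    (b : Module.Basis (Fin d) ℝ V) {f g : V [⋀^Fin d]→ₗ[ℝ] ℂ} (h : f b = g b) : f = g := by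
  ext w
  have hw : w = fun i => b.constr ℝ w (b i) := by
    funext i; exact (b.constr_basis ℝ w i).symm
  rw [hw, map_basis_eq_det b f, map_basis_eq_det b g, h]

/-- The determinant on `ℂ^p`, as a complex multilinear covector. -/
def cdet (p : ℕ) : Cn p [⋀^Fin p]→L[ℂ] ℂ :=
  { (stdBasis p).det with
    cont := by
      have h : Continuous fun v : Fin p → Cn p => ((stdBasis p).toMatrix v).det := by
        refine Continuous.matrix_det ?_
        refine continuous_matrix fun i j => ?_
        exact (LinearMap.continuous_of_finiteDimensional
          ((stdBasis p).coord i)).comp (continuous_apply j)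
      exact h }

lemma cdet_apply {p : ℕ} (v : Fin p → Cn p) : cdet p v = (Matrix.of fun i j => v i j).det := by
  have : cdet p v = ((stdBasis p).toMatrix v).det := rfl
  rw [this, ← Matrix.det_transpose]
  congr 1

section Wedge

variable {E : Type*} [NormedAddCommGroup E] [NormedSpace ℂ E]

/-- The wedge product of the pull-back of the determinant and its conjugate is the determinant of
the coordinates and their conjugates. -/
lemma wedgeConj_cdet {p : ℕ} (L : E →L[ℂ] Cn p) (v : Fin p ⊕ Fin p → E) :
    wedgeConj ((cdet p).compContinuousLinearMap L) v =
      (Matrix.of fun a b : Fin p ⊕ Fin p =>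
        Sum.elim (fun i => L (v a) i) (fun i => (starRingEnd ℂ) (L (v a) i)) b).det := by
  set coord : Fin p → E →ₗ[ℝ] ℂ := fun i =>
    (((stdBasis p).coord i).restrictScalars ℝ).comp (L.toLinearMap.restrictScalars ℝ) with hcoord
  have hcoord' : ∀ i x, coord i x = L x i := fun i x => stdBasis_repr p (L x) i
  set m : MultilinearMap ℝ (fun _ : Fin p => E) ℂ :=
    (MultilinearMap.mkPiAlgebra ℝ (Fin p) ℂ).compLinearMap coord with hm
  set m' : MultilinearMap ℝ (fun _ : Fin p => E) ℂ :=
    (MultilinearMap.mkPiAlgebra ℝ (Fin p) ℂ).compLinearMap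
      fun i => Complex.conjAe.toLinearMap.comp (coord i) with hm'
  have h1 : (((cdet p).compContinuousLinearMap L).restrictScalars ℝ).toAlternatingMap =
      MultilinearMap.alternatization m := by
    ext w
    rw [MultilinearMap.alternatization_apply]
    have : (((cdet p).compContinuousLinearMap L).restrictScalars ℝ).toAlternatingMap w =
      cdet p fun i => L (w i) := rfl
    rw [this, cdet_apply, Matrix.det_apply]
    refine Finset.sum_congr rfl fun σ _ => ?_
    simp [hm, hcoord']
  have h2 : Complex.conjAe.toLinearMap.compAlternatingMap
      (((cdet p).compContinuousLinearMap L).restrictScalars ℝ).toAlternatingMap =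
      MultilinearMap.alternatization m' := by
    rw [h1]
    ext w
    rw [LinearMap.compAlternatingMap_apply, MultilinearMap.alternatization_apply,
      MultilinearMap.alternatization_apply, map_sum]
    refine Finset.sum_congr rfl fun σ _ => ?_
    rw [Units.smul_def, Units.smul_def, map_zsmul]
    simp [hm, hm']
  rw [wedgeConj, h2, h1, ← MultilinearMap.domCoprod_alternization,
    LinearMap.compAlternatingMap_apply, MultilinearMap.alternatization_apply, map_sum,
    Matrix.det_apply]
  refine Finset.sum_congr rfl fun σ _ => ?_
  rw [Units.smul_def, map_zsmul, Units.smul_def, Fintype.prod_sum_type]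
  simp [hm, hm', hcoord']

/-- The matrix of the coordinates of the frame `(e₀, i e₀, e₁, i e₁, …)` and their conjugates has
determinant `σ_p⁻¹`, here only for the two degrees that are needed. -/
lemma sigma_mul_det_frame {p : ℕ} (hp : p = 1 ∨ p = 2) :
    sigma p * (Matrix.of fun a b : Fin p ⊕ Fin p =>
        Sum.elim (fun i => complexFrame (stdBasis p) ((blocks p).symm a) i)
          (fun i => (starRingEnd ℂ) (complexFrame (stdBasis p) ((blocks p).symm a) i)) b).det
      = 1 := by
  rw [← Matrix.det_submatrix_equiv_self (blocks p)]
  rcases hp with rfl | rfl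
  · have h : (Matrix.of fun a b : Fin 1 ⊕ Fin 1 =>
        Sum.elim (fun i => complexFrame (stdBasis 1) ((blocks 1).symm a) i)
          (fun i => (starRingEnd ℂ) (complexFrame (stdBasis 1) ((blocks 1).symm a) i)) b).submatrix
          (blocks 1) (blocks 1) = !![1, 1; Complex.I, -Complex.I] := by
      ext a b
      fin_cases a <;> fin_cases b <;>
        simp [complexFrame, blocks, finSumFinEquiv, Fin.addCases, stdBasis_apply]
    rw [h, Matrix.det_fin_two_of, sigma]
    norm_num
    linear_combination -Complex.I_mul_I
  · have h : (Matrix.of fun a b : Fin 2 ⊕ Fin 2 =>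
        Sum.elim (fun i => complexFrame (stdBasis 2) ((blocks 2).symm a) i)
          (fun i => (starRingEnd ℂ) (complexFrame (stdBasis 2) ((blocks 2).symm a) i)) b).submatrix
          (blocks 2) (blocks 2) = !![1, 0, 1, 0; Complex.I, 0, -Complex.I, 0;
            0, 1, 0, 1; 0, Complex.I, 0, -Complex.I] := by
      ext a b
      fin_cases a <;> fin_cases b <;>
        simp [complexFrame, blocks, finSumFinEquiv, Fin.addCases, stdBasis_apply]
    rw [h, sigma]
    simp [Matrix.det_succ_row_zero, Fin.sum_univ_succ, Fin.succAbove]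
    norm_num
    linear_combination -Complex.I_mul_I

/-- In degrees one and two, the volume form is `σ_p η ∧ η̄` for the determinant `η`. -/
lemma vol_comp_blocks {p : ℕ} (hp : p = 1 ∨ p = 2) (L : E →L[ℂ] Cn p) (v : Fin p ⊕ Fin p → E) :
    vol p (fun j => L (v (blocks p j))) =
      sigma p * wedgeConj ((cdet p).compContinuousLinearMap L) v := by
  set g : Cn p [⋀^Fin (2 * p)]→ₗ[ℝ] ℂ := (LinearMap.mulLeft ℝ (sigma p)).compAlternatingMap
    ((wedgeConj ((cdet p).compContinuousLinearMap (ContinuousLinearMap.id ℂ _))).domDomCongr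
      (blocks p).symm) with hg
  have hg' : ∀ w, g w = sigma p * (Matrix.of fun a b : Fin p ⊕ Fin p =>
        Sum.elim (fun i => w ((blocks p).symm a) i)
          (fun i => (starRingEnd ℂ) (w ((blocks p).symm a) i)) b).det := fun w => by
    have : g w = sigma p * wedgeConj ((cdet p).compContinuousLinearMap
      (ContinuousLinearMap.id ℂ _)) fun a => w ((blocks p).symm a) := rfl
    rw [this, wedgeConj_cdet]
    rfl
  have h1 : (vol p).toAlternatingMap = g := by
    refine ext_of_basis (frameBasis p) ?_
    have h2 : (vol p).toAlternatingMap (frameBasis p) = 1 := by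
      have : (vol p).toAlternatingMap (frameBasis p) = vol p (frameBasis p) := rfl
      rw [this, vol_apply, Module.Basis.det_self, Complex.ofReal_one]
    rw [h2, hg', coe_frameBasis, sigma_mul_det_frame hp]
  have h3 : vol p (fun j => L (v (blocks p j))) = g fun j => L (v (blocks p j)) := by
    rw [← h1]; rfl
  rw [h3, hg', wedgeConj_cdet]
  simp

end Wedge

end Volume

/-! ### Forms invariant under deck transformations -/

section Descent

open Set Filter Topology

variable {E : Type*} [NormedAddCommGroup E] [NormedSpace ℂ E]

/-- A covector-valued map is smooth as soon as its values on all tuples of vectors are. -/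
lemma contDiffOn_covector [FiniteDimensional ℂ E] {V : Type*} [NormedAddCommGroup V]
    [NormedSpace ℝ V] {k : ℕ} {f : V → E [⋀^Fin k]→L[ℝ] ℂ} {s : Set V}
    (h : ∀ v : Fin k → E, ContDiffOn ℝ ∞ (fun x => f x v) s) : ContDiffOn ℝ ∞ f s := by
  have : FiniteDimensional ℝ E := FiniteDimensional.complexToReal E
  set b := Module.finBasis ℝ E
  set T : E [⋀^Fin k]→L[ℝ] ℂ →ₗ[ℝ] (Fin k → Fin (Module.finrank ℝ E)) → ℂ :=
    { toFun := fun η i => η fun j => b (i j)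
      map_add' := fun _ _ => rfl
      map_smul' := fun _ _ => rfl }
  have hT : LinearMap.ker T = ⊥ := by
    rw [LinearMap.ker_eq_bot']
    intro η hη
    have h0 : η.toAlternatingMap = 0 := by
      refine Module.Basis.ext_alternating b fun i _ => ?_
      exact congrFun hη i
    ext v
    exact DFunLike.congr_fun h0 v
  obtain ⟨S, hS⟩ := T.exists_leftInverse_of_injective hT
  have hf : f = fun x => S.toContinuousLinearMap (T (f x)) := by
    funext x
    exact (LinearMap.congr_fun hS (f x)).symm
  rw [hf]
  refine S.toContinuousLinearMap.contDiff.comp_contDiffOn ?_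
  exact contDiffOn_pi.2 fun i => h _

variable {H : Type*} [TopologicalSpace H] (I : ModelWithCorners ℂ E H)
  (M : Type*) [TopologicalSpace M] [ChartedSpace H M]

/-- All changes of coordinates between preferred charts of `M` belong locally to `G`. -/
def HasDeck (G : Set (E → E)) : Prop :=
  ∀ (x x' : M), ∀ e ∈ overlap I x x', ∃ g ∈ G, transition I x x' =ᶠ[𝓝 e] g

/-- A form on the model space which is invariant under `G`. -/
def IsDeckInvariant (G : Set (E → E)) {k : ℕ} (η : E → E [⋀^Fin k]→L[ℝ] ℂ) : Prop :=
  ∀ g ∈ G, ∀ e, (η (g e)).compContinuousLinearMap ((fderiv ℂ g e).restrictScalars ℝ) = η e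

/-- The form on `M` given in all charts by the same form on the model space. -/
def descend {k : ℕ} (η : E → E [⋀^Fin k]→L[ℝ] ℂ) : Form E M k := fun x => η (extChartAt I x x)

variable {I M} {G : Set (E → E)}

lemma inChart_descend [I.Boundaryless] (hG : HasDeck I M G) {k : ℕ}
    {η : E → E [⋀^Fin k]→L[ℝ] ℂ} (hη : IsDeckInvariant G η) {x : M} {e : E}
    (he : e ∈ (extChartAt I x).target) : inChart I (descend I M η) x e = η e := by
  obtain ⟨g, hg, h⟩ := hG x _ e (mem_overlap_self he)
  rw [inChart_eq, h.fderiv_eq, ← hη g hg e, ← h.eq_of_nhds]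
  rfl

lemma isSmooth_descend [I.Boundaryless] (hG : HasDeck I M G) {k : ℕ}
    {η : E → E [⋀^Fin k]→L[ℝ] ℂ} (hη : IsDeckInvariant G η) (hs : ContDiff ℝ ∞ η) :
    IsSmooth I (descend I M η) := fun _ =>
  hs.contDiffOn.congr fun _ he => inChart_descend hG hη he

lemma extD_descend [I.Boundaryless] (hG : HasDeck I M G) {k : ℕ}
    {η : E → E [⋀^Fin k]→L[ℝ] ℂ} (hη : IsDeckInvariant G η) :
    extD I (descend I M η) = descend I M (extDeriv η) := by
  funext x
  have h : inChart I (descend I M η) x =ᶠ[𝓝 (extChartAt I x x)] η := by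
    filter_upwards [(isOpen_extChartAt_target x).mem_nhds (mem_extChartAt_target x)] with e he
    exact inChart_descend hG hη he
  rw [extD, h.extDeriv_eq]
  rfl

/-! ### Sums of pulled-back volume forms -/

/-- The form `∑ⱼ Lⱼ^* vol` for a family of fields of linear maps to `ℂ^p`. -/
def volSum {ι : Type*} [Fintype ι] {p : ℕ} (L : ι → E → E →L[ℂ] Cn p) (e : E) :
    E [⋀^Fin (2 * p)]→L[ℝ] ℂ :=
  ∑ j, (vol p).compContinuousLinearMap ((L j e).restrictScalars ℝ)

section VolSum

variable {ι : Type*} [Fintype ι] {p : ℕ} {L : ι → E → E →L[ℂ] Cn p}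

lemma volSum_apply (e : E) (v : Fin (2 * p) → E) :
    volSum L e v = ∑ j, vol p fun i => L j e (v i) := by
  simp [volSum, Function.comp_def]

/-- The field `L` of linear maps is, up to unimodular matrices, the derivative of a holomorphic
map, so that `L^* vol` is closed. -/
def IsUnimodularDerivative (L : E → E →L[ℂ] Cn p) : Prop :=
  ∃ F : E → Cn p, ContDiff ℂ ω F ∧ ∀ e, ∃ U : Cn p →ₗ[ℂ] Cn p, LinearMap.det U = 1 ∧
    ∀ v, fderiv ℂ F e v = U (L e v)

/-- The field `L` of linear maps is invariant under `G`. -/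
def IsDeckInvariantField (G : Set (E → E)) (L : E → E →L[ℂ] Cn p) : Prop :=
  ∀ g ∈ G, ∀ e v, L (g e) (fderiv ℂ g e v) = L e v

lemma IsUnimodularDerivative.eq_pullback {L : E → E →L[ℂ] Cn p} {F : E → Cn p}
    (hF : ContDiff ℂ ω F) (h : ∀ e, ∃ U : Cn p →ₗ[ℂ] Cn p, LinearMap.det U = 1 ∧
    ∀ v, fderiv ℂ F e v = U (L e v)) (e : E) :
    (vol p).compContinuousLinearMap ((L e).restrictScalars ℝ) =
      (vol p).compContinuousLinearMap (fderiv ℝ F e) := by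
  obtain ⟨U, hU, hL⟩ := h e
  rw [((hF.differentiable (by simp)) e).fderiv_restrictScalars ℝ]
  ext v
  have h1 := vol_map U fun i => L e (v i)
  rw [hU, map_one, Complex.ofReal_one, one_mul] at h1
  refine h1.symm.trans ?_
  simp only [← hL]
  rfl

lemma IsUnimodularDerivative.contDiff [FiniteDimensional ℂ E] {L : E → E →L[ℂ] Cn p}
    (h : IsUnimodularDerivative L) :
    ContDiff ℝ ∞ fun e => (vol p).compContinuousLinearMap ((L e).restrictScalars ℝ) := by
  obtain ⟨F, hF, h⟩ := h
  have h1 : (fun e => (vol p).compContinuousLinearMap ((L e).restrictScalars ℝ)) = fun e =>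
      (vol p).compContinuousLinearMap (fderiv ℝ F e) :=
    funext fun e => IsUnimodularDerivative.eq_pullback hF h e
  rw [h1, ← contDiffOn_univ]
  refine contDiffOn_covector fun v => ?_
  have hF' : ContDiff ℝ ∞ F := (hF.restrict_scalars ℝ).of_le le_top
  have h2 : ContDiff ℝ ∞ (fderiv ℝ F) := hF'.fderiv_right (by exact le_rfl)
  refine ContDiff.contDiffOn ?_
  exact (vol p).toContinuousMultilinearMap.contDiff.comp
    (contDiff_pi.2 fun i => h2.clm_apply contDiff_const)

lemma IsUnimodularDerivative.extDeriv_eq_zero {L : E → E →L[ℂ] Cn p}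
    (h : IsUnimodularDerivative L) (e : E) :
    extDeriv (fun e => (vol p).compContinuousLinearMap ((L e).restrictScalars ℝ)) e = 0 := by
  obtain ⟨F, hF, h⟩ := h
  have h1 : (fun e => (vol p).compContinuousLinearMap ((L e).restrictScalars ℝ)) = fun e =>
      (vol p).compContinuousLinearMap (fderiv ℝ F e) :=
    funext fun e => IsUnimodularDerivative.eq_pullback hF h e
  have hF' : ContDiff ℝ ∞ F := (hF.restrict_scalars ℝ).of_le le_top
  have h2 : extDeriv (fun _ : Cn p => vol p) (F e) = 0 := by
    ext v
    simp [extDeriv, ContinuousAlternatingMap.alternatizeUncurryFin_apply]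
  have h3 := extDeriv_pullback (f := F) (x := e) (r := ∞) (differentiableAt_const (vol p))
    hF'.contDiffAt
    (by rw [minSmoothness_of_isRCLikeNormedField]; exact WithTop.coe_le_coe.2 le_top)
  rw [h1, h3, h2]
  rfl

lemma isDeckInvariant_volSum (hL : ∀ j, IsDeckInvariantField G (L j)) :
    IsDeckInvariant G (volSum L) := by
  intro g hg e
  ext v
  have h1 : (volSum L (g e)).compContinuousLinearMap ((fderiv ℂ g e).restrictScalars ℝ) v =
      volSum L (g e) fun i => fderiv ℂ g e (v i) := rfl
  rw [h1, volSum_apply, volSum_apply]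
  simp only [hL _ g hg e]

lemma contDiff_volSum [FiniteDimensional ℂ E] (hL : ∀ j, IsUnimodularDerivative (L j)) :
    ContDiff ℝ ∞ (volSum L) :=
  ContDiff.sum fun j _ => (hL j).contDiff

lemma extDeriv_volSum [FiniteDimensional ℂ E] (hL : ∀ j, IsUnimodularDerivative (L j)) (e : E) :
    extDeriv (volSum L) e = 0 := by
  have h : volSum L = ∑ j, fun e =>
      (vol p).compContinuousLinearMap ((L j e).restrictScalars ℝ) := by
    funext e; rw [volSum, Finset.sum_apply]
  have h2 : fderiv ℝ (volSum L) e = ∑ j, fderiv ℝ (fun e =>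
      (vol p).compContinuousLinearMap ((L j e).restrictScalars ℝ)) e := by
    rw [h]
    exact fderiv_sum fun j _ => (hL j).contDiff.differentiable (by simp) e
  have h3 : ∀ j, ContinuousAlternatingMap.alternatizeUncurryFin (fderiv ℝ (fun e =>
      (vol p).compContinuousLinearMap ((L j e).restrictScalars ℝ)) e) = 0 := fun j =>
    (hL j).extDeriv_eq_zero e
  rw [extDeriv, h2]
  have h4 := _root_.map_sum (ContinuousAlternatingMap.alternatizeUncurryFinCLM ℝ E ℂ (n := 2 * p))
    (fun j => fderiv ℝ (fun e =>
      (vol p).compContinuousLinearMap ((L j e).restrictScalars ℝ)) e) Finset.univ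
  refine h4.trans (Finset.sum_eq_zero fun j _ => h3 j)

lemma volSum_real (e : E) (v : Fin (2 * p) → E) :
    (starRingEnd ℂ) (volSum L e v) = volSum L e v := by
  rw [volSum_apply, _root_.map_sum]
  simp only [vol_real]

lemma hasBidegree_volSum (e : E) : HasBidegree p p (volSum L e) := by
  refine ⟨(two_mul p).symm, fun c v => ?_⟩
  rw [volSum_apply, volSum_apply, Finset.mul_sum]
  simp only [map_smul, vol_smul]

lemma isTransverseAt_volSum {e : E}
    (h : ∀ v : Fin p → E, LinearIndependent ℂ v →
      ∃ j, (Matrix.of fun i k => L j e (v i) k).det ≠ 0) : IsTransverseAt (volSum L e) := by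
  intro v hv
  have h1 : volSum L e (complexFrame v) =
      (∑ j, Complex.normSq (Matrix.of fun i k => L j e (v i) k).det : ℝ) := by
    rw [volSum_apply, Complex.ofReal_sum]
    refine Finset.sum_congr rfl fun j _ => ?_
    rw [← complexFrame_map, vol_complexFrame]
  obtain ⟨j, hj⟩ := h v hv
  rw [h1, Complex.ofReal_re]
  exact Finset.sum_pos' (fun j _ => Complex.normSq_nonneg _)
    ⟨j, Finset.mem_univ _, Complex.normSq_pos.2 hj⟩

lemma isPositiveAt_volSum (hp : p = 1 ∨ p = 2) (e : E) : IsPositiveAt (volSum L e) := by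
  refine ⟨Fintype.card ι, fun j => (cdet p).compContinuousLinearMap
    (L ((Fintype.equivFin ι).symm j) e), fun v => ?_⟩
  rw [volSum_apply, Finset.mul_sum, ← (Fintype.equivFin ι).symm.sum_comp]
  exact Finset.sum_congr rfl fun j _ => vol_comp_blocks hp _ v

/-- A sum of invariant pulled-back volume forms that vanish nowhere simultaneously on a subspace of
dimension `p` defines a closed transverse form. -/
theorem isKahlerForm_descend_volSum [FiniteDimensional ℂ E] [I.Boundaryless] (hG : HasDeck I M G)
    (hinv : ∀ j, IsDeckInvariantField G (L j)) (hd : ∀ j, IsUnimodularDerivative (L j))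
    (h : ∀ e, ∀ v : Fin p → E, LinearIndependent ℂ v →
      ∃ j, (Matrix.of fun i k => L j e (v i) k).det ≠ 0) :
    IsKahlerForm I .kahler (descend I M (volSum L)) where
  smooth := isSmooth_descend hG (isDeckInvariant_volSum hinv) (contDiff_volSum hd)
  real _ _ := volSum_real _ _
  bidegree _ := hasBidegree_volSum _
  transverse _ := isTransverseAt_volSum (h _)
  closed := by
    change extD I _ = 0
    rw [extD_descend hG (isDeckInvariant_volSum hinv)]
    funext x
    exact extDeriv_volSum hd _

end VolSum

end Descent

/-! ### Closed fields of linear maps built from a twisted coframe -/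

section Coframe

open Set Filter Topology

variable {E : Type*} [NormedAddCommGroup E] [NormedSpace ℂ E]

/-- Independent vectors have a nonzero minor with respect to jointly injective functionals. -/
lemma exists_minor_ne_zero {κ : Type*} [Fintype κ] {p : ℕ} {f : κ → E →L[ℂ] ℂ}
    (hf : ∀ v, (∀ i, f i v = 0) → v = 0) {v : Fin p → E} (hv : LinearIndependent ℂ v) :
    ∃ s : Fin p → κ, Function.Injective s ∧ (Matrix.of fun i j => f (s j) (v i)).det ≠ 0 := by
  set A : Matrix (Fin p) κ ℂ := Matrix.of fun i j => f j (v i) with hA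
  have hrow : LinearIndependent ℂ A.row := by
    have h1 := hv.map' (LinearMap.pi fun i => (f i).toLinearMap) (by
      rw [LinearMap.ker_eq_bot']
      intro x hx
      exact hf x fun i => congrFun hx i)
    exact h1
  have hrank : A.rank = p := by rw [hrow.rank_matrix, Fintype.card_fin]
  obtain ⟨ι, a, ha, hspan, hli⟩ := exists_linearIndependent' ℂ A.col
  have : Finite ι := Finite.of_injective a ha
  have : Fintype ι := Fintype.ofFinite ι
  have hcard : Fintype.card ι = p := by
    rw [linearIndependent_iff_card_eq_finrank_span.mp hli, Set.finrank, hspan,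
      ← Matrix.rank_eq_finrank_span_cols, hrank]
  set σ : Fin p ≃ ι := (Fintype.equivFinOfCardEq hcard).symm
  refine ⟨fun j => a (σ j), ha.comp σ.injective, ?_⟩
  have h2 : LinearIndependent ℂ (Matrix.of fun i j => f (a (σ j)) (v i)).transpose.row :=
    hli.comp σ σ.injective
  rw [← Matrix.det_transpose]
  exact ((Matrix.isUnit_iff_isUnit_det _).1
    (Matrix.linearIndependent_rows_iff_isUnit.1 h2)).ne_zero

/-- If replacing any of `p` functionals by `g` gives a vanishing minor, while the original minor
does not vanish, then `g` vanishes on the given vectors. -/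
lemma eq_zero_of_minors {p : ℕ} {f : Fin p → E →L[ℂ] ℂ} {g : E →L[ℂ] ℂ} {v : Fin p → E}
    (hf : (Matrix.of fun i j => f j (v i)).det ≠ 0)
    (hg : ∀ j, (Matrix.of fun i k => Function.update f j g k (v i)).det = 0) (i : Fin p) :
    g (v i) = 0 := by
  set A : Matrix (Fin p) (Fin p) ℂ := Matrix.of fun i j => f j (v i) with hA
  have h1 : A.cramer (fun i => g (v i)) = 0 := by
    funext j
    rw [Matrix.cramer_apply, Pi.zero_apply, ← hg j]
    congr 1
    ext a b
    rw [Matrix.updateCol_apply, Matrix.of_apply, Function.update_apply]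
    split_ifs <;> rfl
  have h2 := Matrix.mulVec_cramer A (fun i => g (v i))
  rw [h1, Matrix.mulVec_zero] at h2
  have h3 := congrFun h2.symm i
  simpa [hf] using h3

/-- Functionals `x₀, …, x_{N-1}`, closed as constant `1`-forms, together with the functional `y`
that is used through the non-closed `1`-form `dy - x_{i₁} dx_{i₂}`. -/
structure TwistedCoframe (E : Type*) [NormedAddCommGroup E] [NormedSpace ℂ E] (N : ℕ) where
  x : Fin N → E →L[ℂ] ℂ
  y : E →L[ℂ] ℂ
  i₁ : Fin N
  i₂ : Fin N

variable {N p : ℕ} (T : TwistedCoframe E N)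

/-- The value of the coframe at a point; the index `none` stands for `dy - x_{i₁} dx_{i₂}`. -/
def TwistedCoframe.form (e : E) : Option (Fin N) → E →L[ℂ] ℂ
  | some i => T.x i
  | none => T.y - T.x T.i₁ e • T.x T.i₂

/-- The field of linear maps to `ℂ^p` given by the members `s₀, …, s_{p-1}` of the coframe. -/
def TwistedCoframe.field (s : Fin p → Option (Fin N)) (e : E) : E →L[ℂ] Cn p :=
  (EuclideanSpace.equiv (Fin p) ℂ).symm.toContinuousLinearMap.comp
    (ContinuousLinearMap.pi fun j => T.form e (s j))

lemma TwistedCoframe.field_apply (s : Fin p → Option (Fin N)) (e v : E) (j : Fin p) :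
    T.field s e v j = T.form e (s j) v := rfl

/-- Index tuples for which the product of the members of the coframe is closed, because the factor
`dy - x_{i₁} dx_{i₂}` is accompanied by `dx_{i₁}` or `dx_{i₂}`. -/
def TwistedCoframe.IsGood (s : Fin p → Option (Fin N)) : Prop :=
  Function.Injective s ∧ (none ∈ range s → some T.i₁ ∈ range s ∨ some T.i₂ ∈ range s)

/-- Holomorphic maps with prescribed derivatives of their components. -/
lemma isUnimodularDerivative_of_components {L : E → E →L[ℂ] Cn p} (f : Fin p → E → ℂ)
    (f' : Fin p → E → E →L[ℂ] ℂ) (hf : ∀ j, ContDiff ℂ ω (f j))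
    (hf' : ∀ j e, HasFDerivAt (f j) (f' j e) e)
    (h : ∀ e, ∃ U : Cn p →ₗ[ℂ] Cn p, LinearMap.det U = 1 ∧
      ∀ v j, f' j e v = U (L e v) j) : IsUnimodularDerivative L := by
  refine ⟨fun e => WithLp.toLp 2 fun j => f j e, contDiff_euclidean.2 hf, fun e => ?_⟩
  obtain ⟨U, hU, hL⟩ := h e
  refine ⟨U, hU, fun v => ?_⟩
  have h1 : HasFDerivAt (fun e => WithLp.toLp 2 fun j => f j e : E → Cn p)
      ((EuclideanSpace.equiv (Fin p) ℂ).symm.toContinuousLinearMap.comp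
        (ContinuousLinearMap.pi fun j => f' j e)) e := by
    exact (EuclideanSpace.equiv (Fin p) ℂ).symm.hasFDerivAt.comp e
      (hasFDerivAt_pi.2 fun j => hf' j e)
  rw [h1.fderiv]
  ext j
  exact hL v j

/-- An elementary unimodular map, adding a multiple of one coordinate to another. -/
lemma exists_elementary {j k : Fin p} (hjk : k ≠ j) (c : ℂ) :
    ∃ U : Cn p →ₗ[ℂ] Cn p, LinearMap.det U = 1 ∧
      ∀ w i, U w i = w i + if i = j then c * w k else 0 := by
  refine ⟨LinearMap.transvection (c • (EuclideanSpace.proj k : Cn p →L[ℂ] ℂ).toLinearMap)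
    (EuclideanSpace.single j 1), ?_, fun w i => ?_⟩
  · rw [LinearMap.transvection.det]
    simp [hjk]
  · simp [LinearMap.transvection]

/-- The good products are closed: a multiple of `dx_{i₁}` or of `dx_{i₂}`, whichever is present, may
be added to the twisted form without changing the product, and makes the twisted form exact. -/
lemma TwistedCoframe.isUnimodularDerivative {s : Fin p → Option (Fin N)} (hs : T.IsGood s) :
    IsUnimodularDerivative (T.field s) := by
  classical
  by_cases hn : none ∈ range s
  swap
  · refine isUnimodularDerivative_of_components (fun j => T.form 0 (s j))
      (fun j _ => T.form 0 (s j)) (fun j => (T.form 0 (s j)).contDiff)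
      (fun j e => (T.form 0 (s j)).hasFDerivAt)
      fun e => ⟨LinearMap.id, LinearMap.det_id, fun v j => ?_⟩
    rw [LinearMap.id_apply, T.field_apply]
    rcases hj : s j with - | i
    · exact absurd ⟨j, hj⟩ hn
    · rfl
  · obtain ⟨j₀, hj₀⟩ := hn
    have hval : ∀ j, j ≠ j₀ → ∃ i, s j = some i := fun j hj => by
      rcases h : s j with - | i
      · exact absurd (hs.1 (h.trans hj₀.symm)) hj
      · exact ⟨i, rfl⟩
    have hx : ∀ i, ContDiff ℂ ω (T.x i) := fun i => (T.x i).contDiff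
    rcases hs.2 ⟨j₀, hj₀⟩ with ⟨k, hk⟩ | ⟨k, hk⟩
    · have hkj : k ≠ j₀ := by rintro rfl; rw [hj₀] at hk; cases hk
      refine isUnimodularDerivative_of_components
        (fun j e => if j = j₀ then T.y e - T.x T.i₁ e * T.x T.i₂ e else T.form 0 (s j) e)
        (fun j e => if j = j₀ then T.y - (T.x T.i₁ e • T.x T.i₂ + T.x T.i₂ e • T.x T.i₁)
          else T.form 0 (s j)) (fun j => ?_) (fun j e => ?_) fun e => ?_
      · by_cases h : j = j₀
        · simp only [if_pos h]
          exact T.y.contDiff.sub ((hx _).mul (hx _))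
        · simp only [if_neg h]
          exact (T.form 0 (s j)).contDiff
      · by_cases h : j = j₀
        · simp only [if_pos h]
          exact T.y.hasFDerivAt.sub ((T.x T.i₁).hasFDerivAt.mul (T.x T.i₂).hasFDerivAt)
        · simp only [if_neg h]
          exact (T.form 0 (s j)).hasFDerivAt
      · obtain ⟨U, hU, h⟩ := exists_elementary hkj (-T.x T.i₂ e)
        refine ⟨U, hU, fun v j => ?_⟩
        rw [h, T.field_apply, T.field_apply, hk]
        by_cases hj : j = j₀
        · subst hj
          simp [hj₀, TwistedCoframe.form]
          ring
        · obtain ⟨i, hi⟩ := hval j hj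
          simp [hj, hi, TwistedCoframe.form]
    · have hkj : k ≠ j₀ := by rintro rfl; rw [hj₀] at hk; cases hk
      refine isUnimodularDerivative_of_components
        (fun j e => if j = j₀ then T.y e else T.form 0 (s j) e)
        (fun j e => if j = j₀ then T.y else T.form 0 (s j)) (fun j => ?_) (fun j e => ?_)
        fun e => ?_
      · by_cases h : j = j₀
        · simp only [if_pos h]
          exact T.y.contDiff
        · simp only [if_neg h]
          exact (T.form 0 (s j)).contDiff
      · by_cases h : j = j₀
        · simp only [if_pos h]
          exact T.y.hasFDerivAt
        · simp only [if_neg h]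
          exact (T.form 0 (s j)).hasFDerivAt
      · obtain ⟨U, hU, h⟩ := exists_elementary hkj (T.x T.i₁ e)
        refine ⟨U, hU, fun v j => ?_⟩
        rw [h, T.field_apply, T.field_apply, hk]
        by_cases hj : j = j₀
        · subst hj
          simp [hj₀, TwistedCoframe.form]
        · obtain ⟨i, hi⟩ := hval j hj
          simp [hj, hi, TwistedCoframe.form]

/-- The coframe is invariant under `G`. -/
def TwistedCoframe.IsInvariant (G : Set (E → E)) : Prop :=
  ∀ g ∈ G, ∀ e v, (∀ i, T.x i (fderiv ℂ g e v) = T.x i v) ∧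
    T.y (fderiv ℂ g e v) = T.y v + (T.x T.i₁ (g e) - T.x T.i₁ e) * T.x T.i₂ v

lemma TwistedCoframe.isDeckInvariantField {G : Set (E → E)} (h : T.IsInvariant G)
    (s : Fin p → Option (Fin N)) : IsDeckInvariantField G (T.field s) := by
  intro g hg e v
  obtain ⟨hx, hy⟩ := h g hg e v
  ext j
  rw [T.field_apply, T.field_apply]
  rcases s j with - | i
  · simp [TwistedCoframe.form, hx, hy]
    ring
  · exact hx i

/-- The coframe spans the dual space. -/
def TwistedCoframe.IsSpanning : Prop :=
  ∀ v, (∀ i, T.x i v = 0) → T.y v = 0 → v = 0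

lemma TwistedCoframe.IsSpanning.eq_zero (h : T.IsSpanning) (e v : E)
    (hv : ∀ i, T.form e i v = 0) : v = 0 := by
  have hx : ∀ i, T.x i v = 0 := fun i => hv (some i)
  refine h v hx ?_
  have := hv none
  simpa [TwistedCoframe.form, hx] using this

end Coframe

/-! ### Changes of coordinates of quotients and products -/

section Deck

open Set Filter Topology

variable {E : Type*} [NormedAddCommGroup E] [NormedSpace ℂ E]
  {H : Type*} [TopologicalSpace H] {I : ModelWithCorners ℂ E H}
  {M : Type*} [TopologicalSpace M] [ChartedSpace H M]

/-- If the charts are local inverses of a map `π` whose fibres are the orbits of `G`, the changes of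
coordinates belong locally to `G`. -/
lemma hasDeck_of_localInverse [I.Boundaryless] {G : Set (E → E)} {π : E → M}
    (hπ : ∀ x, ∀ e ∈ (extChartAt I x).target, (extChartAt I x).symm e = π e)
    (hG : ∀ e e', π e = π e' → ∃ g ∈ G, e' = g e)
    (hc : ∀ g ∈ G, Continuous g ∧ ∀ e, π (g e) = π e) : HasDeck I M G := by
  intro x x' e he
  have h1 : π e = π (transition I x x' e) := by
    rw [← hπ x e (mem_overlap.1 he).1, ← hπ x' _ (transition_mem he), symm_transition he]
  obtain ⟨g, hg, hge⟩ := hG _ _ h1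
  refine ⟨g, hg, ?_⟩
  have h2 : ∀ᶠ u in 𝓝 e, u ∈ overlap I x x' := (isOpen_overlap x x').mem_nhds he
  have h3 : ∀ᶠ u in 𝓝 e, g u ∈ (extChartAt I x').target := by
    refine (hc g hg).1.continuousAt.eventually ((isOpen_extChartAt_target x').mem_nhds ?_)
    rw [← hge]
    exact transition_mem he
  filter_upwards [h2, h3] with u hu hu'
  have h4 : (extChartAt I x').symm (transition I x x' u) = (extChartAt I x').symm (g u) := by
    rw [symm_transition hu, hπ x u (mem_overlap.1 hu).1, hπ x' _ hu', (hc g hg).2]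
  exact (extChartAt I x').symm.injOn (by exact transition_mem hu) (by exact hu') h4

/-- The model space itself. -/
lemma hasDeck_self : HasDeck 𝓘(ℂ, E) E {id} := by
  intro x x' e _
  refine ⟨id, rfl, Eventually.of_forall fun u => ?_⟩
  simp [transition, chartAt_self_eq]

variable {E' : Type*} [NormedAddCommGroup E'] [NormedSpace ℂ E']
  {H' : Type*} [TopologicalSpace H'] {I' : ModelWithCorners ℂ E' H'}
  {M' : Type*} [TopologicalSpace M'] [ChartedSpace H' M']

lemma HasDeck.prod {G : Set (E → E)} {G' : Set (E' → E')} (h : HasDeck I M G)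
    (h' : HasDeck I' M' G') :
    HasDeck (I.prod I') (M × M') {f | ∃ g ∈ G, ∃ g' ∈ G', f = Prod.map g g'} := by
  rintro ⟨x, y⟩ ⟨x', y'⟩ ⟨e, e'⟩ he
  rw [mem_overlap, extChartAt_prod, extChartAt_prod, PartialEquiv.prod_target,
    PartialEquiv.prod_source, PartialEquiv.prod_symm, PartialEquiv.prod_coe] at he
  obtain ⟨g, hg, hgt⟩ := h x x' e (mem_overlap.2 ⟨he.1.1, he.2.1⟩)
  obtain ⟨g', hg', hgt'⟩ := h' y y' e' (mem_overlap.2 ⟨he.1.2, he.2.2⟩)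
  refine ⟨Prod.map g g', ⟨g, hg, g', hg', rfl⟩, ?_⟩
  have hgt1 : ∀ᶠ u in 𝓝 ((e, e') : E × E'), transition I x x' u.1 = g u.1 :=
    (continuous_fst.tendsto (e, e')).eventually hgt
  have hgt2 : ∀ᶠ u in 𝓝 ((e, e') : E × E'), transition I' y y' u.2 = g' u.2 :=
    (continuous_snd.tendsto (e, e')).eventually hgt'
  filter_upwards [hgt1, hgt2] with u hu hu'
  have h3 : transition (I.prod I') (x, y) (x', y') u =
      (transition I x x' u.1, transition I' y y' u.2) := by
    rw [transition, extChartAt_prod, extChartAt_prod, PartialEquiv.prod_symm]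
    rfl
  rw [h3, hu, hu']
  rfl

end Deck

/-! ### The Iwasawa manifold -/

section Iwasawa

open Set Filter Topology

/-- The derivative of a left translation of the complex Heisenberg group. -/
def heisLin (a : ℂ) : Cn 3 →L[ℂ] Cn 3 :=
  (EuclideanSpace.equiv (Fin 3) ℂ).symm.toContinuousLinearMap.comp
    (ContinuousLinearMap.pi ![EuclideanSpace.proj 0, EuclideanSpace.proj 1,
      EuclideanSpace.proj 2 + a • EuclideanSpace.proj 1])

lemma heisLin_apply (a : ℂ) (v : Cn 3) : heisLin a v = !₂[v 0, v 1, v 2 + a * v 1] := by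
  ext i
  fin_cases i <;> simp [heisLin]

/-- The product `(g, z) ↦ g z` of the complex Heisenberg group, realized on `ℂ^3`. -/
def heisMul (g z : Cn 3) : Cn 3 := heisLin (g 0) z + g

lemma heisMul_apply (g z : Cn 3) :
    heisMul g z = !₂[z 0 + g 0, z 1 + g 1, z 2 + g 0 * z 1 + g 2] := by
  rw [heisMul, heisLin_apply]
  ext i
  fin_cases i <;> simp

lemma heisMul_assoc (g h z : Cn 3) : heisMul (heisMul g h) z = heisMul g (heisMul h z) := by
  simp only [heisMul_apply]
  ext i
  fin_cases i <;> simp <;> ring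

lemma heisMul_zero (g : Cn 3) : heisMul g 0 = g := by
  simp [heisMul]

lemma zero_heisMul (g : Cn 3) : heisMul 0 g = g := by
  rw [heisMul_apply]
  ext i
  fin_cases i <;> simp

lemma heisMul_right_cancel {g h z : Cn 3} (H : heisMul g z = heisMul h z) : g = h := by
  simp only [heisMul_apply] at H
  have h0 := congrArg (fun w : Cn 3 => w 0) H
  have h1 := congrArg (fun w : Cn 3 => w 1) H
  have h2 := congrArg (fun w : Cn 3 => w 2) H
  simp at h0 h1 h2
  rw [h0] at h2
  ext i
  fin_cases i
  · exact h0
  · exact h1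
  · simpa using h2

lemma hasFDerivAt_heisMul (g z : Cn 3) : HasFDerivAt (heisMul g) (heisLin (g 0)) z :=
  (heisLin (g 0)).hasFDerivAt.add_const g

lemma contDiff_heisMul (g : Cn 3) : ContDiff ℂ ω (heisMul g) :=
  (heisLin (g 0)).contDiff.add contDiff_const

/-- The lattice of Gaussian integer points of the Heisenberg group. -/
@[ext]
structure HeisLattice where
  a : GaussianInt
  b : GaussianInt
  c : GaussianInt

namespace HeisLattice

instance : Mul HeisLattice := ⟨fun g h => ⟨h.a + g.a, h.b + g.b, h.c + g.a * h.b + g.c⟩⟩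
instance : One HeisLattice := ⟨⟨0, 0, 0⟩⟩
instance : Inv HeisLattice := ⟨fun g => ⟨-g.a, -g.b, g.a * g.b - g.c⟩⟩

lemma mul_def (g h : HeisLattice) :
    g * h = ⟨h.a + g.a, h.b + g.b, h.c + g.a * h.b + g.c⟩ := rfl
lemma one_def : (1 : HeisLattice) = ⟨0, 0, 0⟩ := rfl
lemma inv_def (g : HeisLattice) : g⁻¹ = ⟨-g.a, -g.b, g.a * g.b - g.c⟩ := rfl

instance : Group HeisLattice := Group.ofLeftAxioms
  (fun g h k => by simp only [mul_def]; ext1 <;> simp <;> ring)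
  (fun g => by simp only [mul_def, one_def]; ext1 <;> simp)
  (fun g => by simp only [mul_def, one_def, inv_def]; (ext1 <;> simp); ring)

/-- The lattice point as an element of `ℂ^3`. -/
def coe (g : HeisLattice) : Cn 3 := !₂[(g.a : ℂ), (g.b : ℂ), (g.c : ℂ)]

lemma coe_mul (g h : HeisLattice) : (g * h).coe = heisMul g.coe h.coe := by
  rw [heisMul_apply, mul_def]
  ext i
  fin_cases i <;> simp [coe]

lemma coe_one : (1 : HeisLattice).coe = 0 := by
  ext i
  fin_cases i <;> simp [coe, one_def]

lemma coe_injective : Function.Injective coe := by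
  intro g h H
  have h0 := congrArg (fun w : Cn 3 => w 0) H
  have h1 := congrArg (fun w : Cn 3 => w 1) H
  have h2 := congrArg (fun w : Cn 3 => w 2) H
  simp [coe] at h0 h1 h2
  exact HeisLattice.ext h0 h1 h2

instance : MulAction HeisLattice (Cn 3) where
  smul g z := heisMul g.coe z
  one_smul z := by
    change heisMul (1 : HeisLattice).coe z = z
    rw [coe_one, zero_heisMul]
  mul_smul g h z := by
    change heisMul (g * h).coe z = heisMul g.coe (heisMul h.coe z)
    rw [coe_mul, heisMul_assoc]

lemma smul_def (g : HeisLattice) (z : Cn 3) : g • z = heisMul g.coe z := rfl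

instance : ContinuousConstSMul HeisLattice (Cn 3) :=
  ⟨fun g => (contDiff_heisMul g.coe).continuous⟩

instance : IsCancelSMul HeisLattice (Cn 3) where
  left_cancel' g z w h := by
    have := congrArg (fun u => g⁻¹ • u) h
    simpa using this
  right_cancel' _ _ _ h := coe_injective (heisMul_right_cancel h)

lemma finite_norm_le (R : ℝ) : {a : GaussianInt | ‖(a : ℂ)‖ ≤ R}.Finite := by
  have hfin : ((Icc (-⌈R⌉) ⌈R⌉ : Set ℤ) ×ˢ (Icc (-⌈R⌉) ⌈R⌉ : Set ℤ)).Finite :=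
    (finite_Icc _ _).prod (finite_Icc _ _)
  refine Set.Finite.of_finite_image (f := fun a : GaussianInt => (a.re, a.im))
    (hfin.subset ?_) ?_
  · rintro _ ⟨a, ha, rfl⟩
    have h1 : ∀ k : ℤ, |(k : ℝ)| ≤ ‖(a : ℂ)‖ → k ∈ Icc (-⌈R⌉) ⌈R⌉ := by
      intro k hk
      have h2 : |(k : ℝ)| ≤ ⌈R⌉ := (hk.trans ha).trans (Int.le_ceil R)
      rw [abs_le] at h2
      exact ⟨by exact_mod_cast h2.1, by exact_mod_cast h2.2⟩
    refine ⟨h1 _ ?_, h1 _ ?_⟩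
    · rw [GaussianInt.intCast_re]; exact Complex.abs_re_le_norm _
    · rw [GaussianInt.intCast_im]; exact Complex.abs_im_le_norm _
  · intro a _ b _ h
    exact Zsqrtd.ext (congrArg Prod.fst h) (congrArg Prod.snd h)

instance : ProperlyDiscontinuousSMul HeisLattice (Cn 3) where
  finite_disjoint_inter_image {K L} hK hL := by
    obtain ⟨R, hR⟩ := (hK.union hL).isBounded.exists_norm_le
    have hK' : ∀ z ∈ K, ∀ i, ‖z i‖ ≤ R := fun z hz i =>
      (PiLp.norm_apply_le z i).trans (hR z (Or.inl hz))
    have hL' : ∀ z ∈ L, ∀ i, ‖z i‖ ≤ R := fun z hz i =>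
      (PiLp.norm_apply_le z i).trans (hR z (Or.inr hz))
    have hfin : ({a : GaussianInt | ‖(a : ℂ)‖ ≤ 2 * R} ×ˢ
        ({a : GaussianInt | ‖(a : ℂ)‖ ≤ 2 * R} ×ˢ
          {a : GaussianInt | ‖(a : ℂ)‖ ≤ 2 * R + 2 * R * R})).Finite :=
      (finite_norm_le _).prod ((finite_norm_le _).prod (finite_norm_le _))
    refine Set.Finite.of_finite_image (f := fun g : HeisLattice => (g.a, g.b, g.c))
      (hfin.subset ?_) ?_
    · rintro _ ⟨g, ⟨w, ⟨z, hz, rfl⟩, hw⟩, rfl⟩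
      have hw' : ∀ i, ‖(heisMul g.coe z) i‖ ≤ R := hL' _ hw
      have e0 : (g.a : ℂ) = heisMul g.coe z 0 - z 0 := by simp [heisMul_apply, coe]
      have e1 : (g.b : ℂ) = heisMul g.coe z 1 - z 1 := by simp [heisMul_apply, coe]
      have e2 : (g.c : ℂ) = heisMul g.coe z 2 - z 2 - g.a * z 1 := by
        simp [heisMul_apply, coe]
        ring
      have b0 : ‖(g.a : ℂ)‖ ≤ 2 * R := by
        rw [e0]
        linarith [norm_sub_le (heisMul g.coe z 0) (z 0), hw' 0, hK' z hz 0]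
      have b1 : ‖(g.b : ℂ)‖ ≤ 2 * R := by
        rw [e1]
        linarith [norm_sub_le (heisMul g.coe z 1) (z 1), hw' 1, hK' z hz 1]
      refine ⟨b0, b1, ?_⟩
      change ‖(g.c : ℂ)‖ ≤ _
      rw [e2]
      have b2 : ‖(g.a : ℂ) * z 1‖ ≤ 2 * R * R := by
        rw [norm_mul]
        exact mul_le_mul b0 (hK' z hz 1) (norm_nonneg _) ((norm_nonneg _).trans b0)
      linarith [norm_sub_le (heisMul g.coe z 2 - z 2) (g.a * z 1),
        norm_sub_le (heisMul g.coe z 2) (z 2), hw' 2, hK' z hz 2]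
    · intro g _ h _ H
      simp only [Prod.mk.injEq] at H
      exact HeisLattice.ext H.1 H.2.1 H.2.2

end HeisLattice

/-- The half-open unit square. -/
def unitSquare : Set ℂ := {w | (0 ≤ w.re ∧ w.re < 1) ∧ (0 ≤ w.im ∧ w.im < 1)}

lemma existsUnique_add_mem_unitSquare (w : ℂ) : ∃! a : GaussianInt, w + a ∈ unitSquare := by
  have key : ∀ a : GaussianInt, w + a ∈ unitSquare ↔ a.re = -⌊w.re⌋ ∧ a.im = -⌊w.im⌋ := by
    intro a
    have h : ∀ (t : ℝ) (k : ℤ), (0 ≤ t + k ∧ t + k < 1) ↔ k = -⌊t⌋ := by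
      intro t k
      rw [eq_neg_iff_add_eq_zero, ← eq_neg_iff_add_eq_zero, ← neg_eq_iff_eq_neg, eq_comm,
        Int.floor_eq_iff]
      push_cast
      constructor <;> rintro ⟨h1, h2⟩ <;> constructor <;> linarith
    rw [unitSquare, mem_ofPred_eq, Complex.add_re, Complex.add_im, ← GaussianInt.intCast_re,
      ← GaussianInt.intCast_im, h, h]
  refine ⟨⟨-⌊w.re⌋, -⌊w.im⌋⟩, (key _).2 ⟨rfl, rfl⟩, fun a ha => ?_⟩
  obtain ⟨h1, h2⟩ := (key a).1 ha
  exact Zsqrtd.ext h1 h2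

/-- A fundamental domain of the lattice. -/
def unitCube : Set (Cn 3) := {z | ∀ i, z i ∈ unitSquare}

lemma existsUnique_smul_mem_unitCube (z : Cn 3) : ∃! g : HeisLattice, g • z ∈ unitCube := by
  obtain ⟨a, ha, ha'⟩ := existsUnique_add_mem_unitSquare (z 0)
  obtain ⟨b, hb, hb'⟩ := existsUnique_add_mem_unitSquare (z 1)
  obtain ⟨c, hc, hc'⟩ := existsUnique_add_mem_unitSquare (z 2 + a * z 1)
  have key : ∀ g : HeisLattice, g • z ∈ unitCube ↔ z 0 + g.a ∈ unitSquare ∧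
      z 1 + g.b ∈ unitSquare ∧ z 2 + g.a * z 1 + g.c ∈ unitSquare := by
    intro g
    rw [HeisLattice.smul_def, heisMul_apply, unitCube, mem_ofPred_eq, Fin.forall_fin_succ,
      Fin.forall_fin_two]
    simp [HeisLattice.coe]
  refine ⟨⟨a, b, c⟩, (key _).2 ⟨ha, hb, hc⟩, fun g hg => ?_⟩
  obtain ⟨h0, h1, h2⟩ := (key g).1 hg
  have e0 := ha' _ h0
  have e1 := hb' _ h1
  rw [e0] at h2
  exact HeisLattice.ext e0 e1 (hc' _ h2)

/-- The Iwasawa manifold, the quotient of the complex Heisenberg group by a lattice. -/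
abbrev Iwasawa : Type := MulAction.orbitRel.Quotient HeisLattice (Cn 3)

/-- The projection onto the Iwasawa manifold. -/
def iwasawaMk (z : Cn 3) : Iwasawa := Quotient.mk _ z

lemma iwasawaMk_eq {z w : Cn 3} : iwasawaMk z = iwasawaMk w ↔ ∃ g : HeisLattice, g • w = z :=
  Quotient.eq''

lemma iwasawaMk_smul (g : HeisLattice) (z : Cn 3) : iwasawaMk (g • z) = iwasawaMk z :=
  iwasawaMk_eq.2 ⟨g, rfl⟩

lemma continuous_iwasawaMk : Continuous iwasawaMk := continuous_quotient_mk'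

lemma surjective_iwasawaMk : Function.Surjective iwasawaMk := Quotient.mk_surjective

lemma iwasawa_symm_apply (x : Iwasawa) (e : Cn 3) :
    (extChartAt 𝓘(ℂ, Cn 3) x).symm e = iwasawaMk e := by
  have h : ⇑(chartAt (Cn 3) x).symm = iwasawaMk := by
    change ⇑((IsLocalHomeomorph.localInverseAt _ _).trans (chartAt (Cn 3) _)).symm = _
    rw [OpenPartialHomeomorph.trans_symm_eq_symm_trans_symm, OpenPartialHomeomorph.coe_trans,
      IsLocalHomeomorph.localInverseAt_symm]
    rfl
  rw [extChartAt, OpenPartialHomeomorph.extend_coe_symm, h]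
  rfl

/-- The deck transformations of the Iwasawa manifold. -/
def iwasawaDeck : Set (Cn 3 → Cn 3) := range fun g : HeisLattice => heisMul g.coe

lemma hasDeck_iwasawa : HasDeck 𝓘(ℂ, Cn 3) Iwasawa iwasawaDeck := by
  refine hasDeck_of_localInverse (π := iwasawaMk) (fun x e _ => iwasawa_symm_apply x e) ?_ ?_
  · intro e e' h
    obtain ⟨g, hg⟩ := iwasawaMk_eq.1 h.symm
    exact ⟨_, ⟨g, rfl⟩, hg.symm⟩
  · rintro _ ⟨g, rfl⟩
    exact ⟨(contDiff_heisMul _).continuous, fun e => iwasawaMk_smul g e⟩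

instance : IsManifold 𝓘(ℂ, Cn 3) ω Iwasawa := by
  refine isManifold_of_contDiffOn _ _ _ ?_
  rintro _ _ ⟨q, rfl⟩ ⟨q', rfl⟩
  intro e he
  have he' : e ∈ overlap 𝓘(ℂ, Cn 3) q q' := by
    have h1 := he.1
    rw [mem_overlap, extChartAt_target, extChartAt_source]
    rw [mem_preimage, OpenPartialHomeomorph.trans_source, mem_inter_iff] at h1
    exact ⟨⟨h1.1, he.2⟩, h1.2⟩
  obtain ⟨_, ⟨g, rfl⟩, hg⟩ := hasDeck_iwasawa q q' e he'
  refine ContDiffAt.contDiffWithinAt ?_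
  exact (contDiff_heisMul g.coe).contDiffAt.congr_of_eventuallyEq hg

instance : T2Space Iwasawa :=
  t2Space_of_properlyDiscontinuousSMul_of_t2Space (Γ := HeisLattice) (T := Cn 3)

instance : SecondCountableTopology Iwasawa :=
  ContinuousConstSMul.secondCountableTopology (Γ := HeisLattice) (T := Cn 3)

instance : ConnectedSpace Iwasawa := surjective_iwasawaMk.connectedSpace continuous_iwasawaMk

lemma exists_isCompact_unitCube_subset : ∃ K : Set (Cn 3), IsCompact K ∧ unitCube ⊆ K := by
  refine ⟨(WithLp.toLp 2) '' (univ.pi fun _ => Metric.closedBall (0 : ℂ) 2),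
    (isCompact_univ_pi fun _ => isCompact_closedBall _ _).image (PiLp.continuous_toLp 2 _),
    fun z hz => ⟨z.ofLp, fun i _ => ?_, rfl⟩⟩
  obtain ⟨⟨h1, h2⟩, h3, h4⟩ := hz i
  rw [mem_closedBall_zero_iff]
  have h5 := Complex.norm_le_abs_re_add_abs_im (z i)
  rw [abs_of_nonneg h1, abs_of_nonneg h3] at h5
  exact h5.trans (by linarith)

instance : CompactSpace Iwasawa := by
  obtain ⟨K, hK, hQ⟩ := exists_isCompact_unitCube_subset
  have h : iwasawaMk '' K = univ := by
    refine eq_univ_of_forall fun y => ?_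
    obtain ⟨z, rfl⟩ := surjective_iwasawaMk y
    obtain ⟨g, hg, -⟩ := existsUnique_smul_mem_unitCube z
    exact ⟨g • z, hQ hg, iwasawaMk_smul g z⟩
  exact ⟨h ▸ hK.image continuous_iwasawaMk⟩

end Iwasawa

/-! ### Closed transverse forms on products with the Iwasawa manifold -/

section Examples

open Set Filter Topology

section Coframes

variable {E : Type*} [NormedAddCommGroup E] [NormedSpace ℂ E] [FiniteDimensional ℂ E]
  {H : Type*} [TopologicalSpace H] {I : ModelWithCorners ℂ E H} [I.Boundaryless]
  {M : Type*} [TopologicalSpace M] [ChartedSpace H M] {G : Set (E → E)}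

/-- If all products of `p` distinct members of the coframe are closed, the coframe yields a closed
transverse form. -/
lemma TwistedCoframe.exists_isKahlerForm {N p : ℕ} (T : TwistedCoframe E N) (hG : HasDeck I M G)
    (hT : T.IsInvariant G) (hs : T.IsSpanning)
    (hgood : ∀ s : Fin p → Option (Fin N), Function.Injective s → T.IsGood s) :
    ∃ Ω : Form E M (2 * p), IsKahlerForm I .kahler Ω ∧
      (p = 1 ∨ p = 2 → ∀ x, IsPositiveAt (Ω x)) := by
  classical
  have : Fintype {s : Fin p → Option (Fin N) // Function.Injective s} := Fintype.ofFinite _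
  refine ⟨descend I M (volSum fun s : {s : Fin p → Option (Fin N) // Function.Injective s} =>
    T.field s.1), ?_, fun hp x => isPositiveAt_volSum hp _⟩
  refine isKahlerForm_descend_volSum hG (fun s => T.isDeckInvariantField hT s.1)
    (fun s => T.isUnimodularDerivative (hgood s.1 s.2)) fun e v hv => ?_
  obtain ⟨s, hsi, hdet⟩ := exists_minor_ne_zero (hs.eq_zero T e) hv
  exact ⟨⟨s, hsi⟩, hdet⟩

/-- The coframe with the functional `x₀` replaced by `x₀ + x₂`, and `dy - x₂ dx₃` replaced by
`dy - (x₀ + x₂) dx₃`. -/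
def TwistedCoframe.shift (T : TwistedCoframe E 4) : TwistedCoframe E 4 where
  x := Function.update T.x 0 (T.x 0 + T.x 2)
  y := T.y
  i₁ := 0
  i₂ := 3

/-- In degree three, the products of the members of the coframe that are not closed are those of
`dx₀`, `dx₁` and the twisted form. They are replaced by the corresponding products for the shifted
coframe, which have the same restriction to the subspaces on which all the other products vanish. -/
lemma TwistedCoframe.exists_isKahlerForm_shift (T : TwistedCoframe E 4) (h1 : T.i₁ = 2)
    (h2 : T.i₂ = 3) (hG : HasDeck I M G) (hT : T.IsInvariant G) (hs : T.IsSpanning)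
    (h0 : ∀ g ∈ G, ∀ e, T.x 0 (g e) = T.x 0 e) : IsPKahler I M .kahler 3 := by
  classical
  have hT' : T.shift.IsInvariant G := by
    intro g hg e v
    obtain ⟨hx, hy⟩ := hT g hg e v
    refine ⟨fun i => ?_, ?_⟩
    · by_cases hi : i = 0
      · subst hi
        simp [TwistedCoframe.shift, hx]
      · simp [TwistedCoframe.shift, hi, hx]
    · rw [h1, h2] at hy
      simp [TwistedCoframe.shift, hy, h0 g hg e]
  set L : {s : Fin 3 → Option (Fin 4) // T.IsGood s} ⊕
      {s : Fin 3 → Option (Fin 4) // T.shift.IsGood s} → E → E →L[ℂ] Cn 3 :=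
    Sum.elim (fun s => T.field s.1) (fun s => T.shift.field s.1) with hL
  have : Fintype {s : Fin 3 → Option (Fin 4) // T.IsGood s} := Fintype.ofFinite _
  have : Fintype {s : Fin 3 → Option (Fin 4) // T.shift.IsGood s} := Fintype.ofFinite _
  refine ⟨_, isKahlerForm_descend_volSum (L := L) hG ?_ ?_ ?_⟩
  · rintro (s | s)
    · exact T.isDeckInvariantField hT s.1
    · exact T.shift.isDeckInvariantField hT' s.1
  · rintro (s | s)
    · exact T.isUnimodularDerivative s.2
    · exact T.shift.isUnimodularDerivative s.2
  intro e v hv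
  by_contra! hcon
  have hgood : ∀ s, T.IsGood s → (Matrix.of fun i k => T.form e (s k) (v i)).det = 0 :=
    fun s hs => hcon (Sum.inl ⟨s, hs⟩)
  have hgood' : ∀ s, T.shift.IsGood s →
      (Matrix.of fun i k => T.shift.form e (s k) (v i)).det = 0 :=
    fun s hs => hcon (Sum.inr ⟨s, hs⟩)
  obtain ⟨s, hsi, hdet⟩ := exists_minor_ne_zero (hs.eq_zero T e) hv
  have hbad : ¬ T.IsGood s := fun h => hdet (hgood s h)
  have hbad' : none ∈ range s ∧ some 2 ∉ range s ∧ some 3 ∉ range s := by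
    by_contra hc
    refine hbad ⟨hsi, fun hn => ?_⟩
    rw [h1, h2]
    tauto
  obtain ⟨hn, hs2, hs3⟩ := hbad'
  -- the functionals `x₂` and `x₃` vanish on all `v i`
  have hzero : ∀ l : Fin 4, l = 2 ∨ l = 3 → ∀ i, T.x l (v i) = 0 := by
    intro l hl
    have hls : some l ∉ range s := by rcases hl with rfl | rfl <;> assumption
    refine eq_zero_of_minors hdet fun j => ?_
    rw [← hgood (Function.update s j (some l)) ⟨?_, fun _ => ?_⟩]
    · congr 1
      ext i k
      rw [Matrix.of_apply, Matrix.of_apply, Function.update_apply, Function.update_apply]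
      split_ifs <;> rfl
    · intro a b hab
      rw [Function.update_apply, Function.update_apply] at hab
      split_ifs at hab with ha hb hb
      · rw [ha, hb]
      · exact absurd ⟨b, hab.symm⟩ hls
      · exact absurd ⟨a, hab⟩ hls
      · exact hsi hab
    · rw [h1, h2]
      rcases hl with rfl | rfl
      · exact Or.inl ⟨j, by simp⟩
      · exact Or.inr ⟨j, by simp⟩
  have h0s : some 0 ∈ range s := by
    by_contra h0s
    have h4 : ∀ k, s k = none ∨ s k = some 1 := by
      intro k
      rcases hk : s k with - | i
      · exact Or.inl rfl
      · right
        fin_cases i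
        · exact absurd ⟨k, hk⟩ h0s
        · rfl
        · exact absurd ⟨k, hk⟩ hs2
        · exact absurd ⟨k, hk⟩ hs3
    have h5 : (Finset.univ.image s).card ≤ ({none, some 1} : Finset (Option (Fin 4))).card := by
      refine Finset.card_le_card fun o ho => ?_
      obtain ⟨k, -, rfl⟩ := Finset.mem_image.1 ho
      simpa using h4 k
    rw [Finset.card_image_of_injective _ hsi] at h5
    simp at h5
  refine hdet ?_
  rw [← hgood' s ⟨hsi, fun _ => Or.inl h0s⟩]
  congr 1
  ext i k
  rw [Matrix.of_apply, Matrix.of_apply]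
  rcases hk : s k with - | l
  · simp [TwistedCoframe.form, TwistedCoframe.shift, h1, h2, hzero 3]
  · by_cases hl : l = 0
    · subst hl
      simp [TwistedCoframe.form, TwistedCoframe.shift, hzero 2]
    · simp [TwistedCoframe.form, TwistedCoframe.shift, hl]

end Coframes

/-- The standard form of the plane, built from its two coordinates. -/
lemma exists_isKahlerForm_plane : ∃ Ω : Form (Cn 2) (Cn 2) (2 * 1),
    IsKahlerForm 𝓘(ℂ, Cn 2) .kahler Ω ∧ ∀ x, IsPositiveAt (Ω x) := by
  set L : Fin 2 → Cn 2 → Cn 2 →L[ℂ] Cn 1 := fun j _ =>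
    (EuclideanSpace.equiv (Fin 1) ℂ).symm.toContinuousLinearMap.comp
      (ContinuousLinearMap.pi fun _ => EuclideanSpace.proj j) with hL
  refine ⟨_, isKahlerForm_descend_volSum (L := L) hasDeck_self ?_ ?_ ?_,
    fun x => isPositiveAt_volSum (Or.inl rfl) _⟩
  · rintro j _ rfl e v
    rw [fderiv_id]
    rfl
  · intro j
    exact ⟨L j 0, (L j 0).contDiff, fun e => ⟨LinearMap.id, LinearMap.det_id, fun v => by
      rw [ContinuousLinearMap.fderiv]; rfl⟩⟩
  · intro e v hv
    by_contra! h
    refine hv.ne_zero 0 ?_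
    ext j
    have := h j
    rw [Matrix.det_fin_one] at this
    exact this

/-- The coframe `dz₀, dz₁, dz₂ - z₀ dz₁` of the Iwasawa manifold. -/
def iwasawaCoframe : TwistedCoframe (Cn 3) 2 where
  x := ![EuclideanSpace.proj 0, EuclideanSpace.proj 1]
  y := EuclideanSpace.proj 2
  i₁ := 0
  i₂ := 1

/-- In degree two, all products of distinct members of the coframe of the Iwasawa manifold are
closed, although `dz₂ - z₀ dz₁` is not. -/
lemma exists_isKahlerForm_iwasawa : ∃ Ω : Form (Cn 3) Iwasawa (2 * 2),
    IsKahlerForm 𝓘(ℂ, Cn 3) .kahler Ω ∧ ∀ x, IsPositiveAt (Ω x) := by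
  suffices h : ∃ Ω : Form (Cn 3) Iwasawa (2 * 2), IsKahlerForm 𝓘(ℂ, Cn 3) .kahler Ω ∧
      ((2 : ℕ) = 1 ∨ (2 : ℕ) = 2 → ∀ x, IsPositiveAt (Ω x)) by
    obtain ⟨Ω, h1, h2⟩ := h
    exact ⟨Ω, h1, h2 (Or.inr rfl)⟩
  refine iwasawaCoframe.exists_isKahlerForm hasDeck_iwasawa ?_ ?_ ?_
  · rintro _ ⟨g, rfl⟩ e v
    rw [(hasFDerivAt_heisMul _ _).fderiv, heisLin_apply]
    refine ⟨fun i => ?_, ?_⟩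
    · fin_cases i <;> simp [iwasawaCoframe]
    · simp [iwasawaCoframe, heisMul_apply]
  · intro v hx hy
    ext i
    fin_cases i
    · exact hx 0
    · exact hx 1
    · exact hy
  · intro s hs
    refine ⟨hs, fun _ => ?_⟩
    by_contra! h
    have h4 : ∀ k, s k = none := by
      intro k
      rcases hk : s k with - | i
      · rfl
      · fin_cases i
        · exact absurd ⟨k, hk⟩ h.1
        · exact absurd ⟨k, hk⟩ h.2
    exact absurd (hs ((h4 0).trans (h4 1).symm)) (by decide)

/-- The coframe of the product of the plane and the Iwasawa manifold, for a model space `E` with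
coordinate maps `z` and `w`. -/
def productCoframe {E : Type*} [NormedAddCommGroup E] [NormedSpace ℂ E] (z : E →L[ℂ] Cn 2)
    (w : E →L[ℂ] Cn 3) : TwistedCoframe E 4 where
  x := ![(EuclideanSpace.proj 0).comp z, (EuclideanSpace.proj 1).comp z,
    (EuclideanSpace.proj 0).comp w, (EuclideanSpace.proj 1).comp w]
  y := (EuclideanSpace.proj 2).comp w
  i₁ := 2
  i₂ := 3

/-- A manifold whose changes of coordinates are trivial on the coordinates `z` of the plane and left
translations on the coordinates `w` of the Heisenberg group is `3`-Kähler. -/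
lemma isPKahler_of_productCoframe {E : Type*} [NormedAddCommGroup E] [NormedSpace ℂ E]
    [FiniteDimensional ℂ E] {H : Type*} [TopologicalSpace H] {I : ModelWithCorners ℂ E H}
    [I.Boundaryless] {M : Type*} [TopologicalSpace M] [ChartedSpace H M] {G : Set (E → E)}
    (hG : HasDeck I M G) {z : E →L[ℂ] Cn 2} {w : E →L[ℂ] Cn 3}
    (hzw : ∀ v, z v = 0 → w v = 0 → v = 0)
    (h : ∀ g ∈ G, ∃ γ : Cn 3, ∀ e v, z (g e) = z e ∧ w (g e) = heisMul γ (w e) ∧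
      z (fderiv ℂ g e v) = z v ∧ w (fderiv ℂ g e v) = heisLin (γ 0) (w v)) :
    IsPKahler I M .kahler 3 := by
  refine (productCoframe z w).exists_isKahlerForm_shift rfl rfl hG ?_ ?_ ?_
  · intro g hg e v
    obtain ⟨γ, hγ⟩ := h g hg
    obtain ⟨h1, h2, h3, h4⟩ := hγ e v
    refine ⟨fun i => ?_, ?_⟩
    · fin_cases i <;> simp [productCoframe, h3, h4, heisLin_apply]
    · simp [productCoframe, h2, h4, heisMul_apply, heisLin_apply]
  · intro v hx hy
    refine hzw v ?_ ?_
    · ext i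
      fin_cases i
      · exact hx 0
      · exact hx 1
    · ext i
      fin_cases i
      · exact hx 2
      · exact hx 3
      · exact hy
  · intro g hg e
    obtain ⟨γ, hγ⟩ := h g hg
    obtain ⟨h1, -⟩ := hγ e 0
    simp [productCoframe, h1]

lemma isPKahler_plane_iwasawa :
    IsPKahler ((𝓘(ℂ, Cn 2)).prod 𝓘(ℂ, Cn 3)) (Cn 2 × Iwasawa) .kahler 3 := by
  refine isPKahler_of_productCoframe (hasDeck_self.prod hasDeck_iwasawa)
    (z := ContinuousLinearMap.fst ℂ _ _) (w := ContinuousLinearMap.snd ℂ _ _)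
    (fun v h1 h2 => Prod.ext h1 h2) ?_
  rintro _ ⟨_, rfl, _, ⟨g, rfl⟩, rfl⟩
  refine ⟨g.coe, fun e v => ⟨rfl, rfl, ?_⟩⟩
  rw [((hasFDerivAt_id (𝕜 := ℂ) e.1).prodMap e (hasFDerivAt_heisMul g.coe e.2)).fderiv]
  exact ⟨rfl, rfl⟩

lemma isPKahler_iwasawa_plane :
    IsPKahler ((𝓘(ℂ, Cn 3)).prod 𝓘(ℂ, Cn 2)) (Iwasawa × Cn 2) .kahler 3 := by
  refine isPKahler_of_productCoframe (hasDeck_iwasawa.prod hasDeck_self)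
    (z := ContinuousLinearMap.snd ℂ _ _) (w := ContinuousLinearMap.fst ℂ _ _)
    (fun v h1 h2 => Prod.ext h2 h1) ?_
  rintro _ ⟨_, ⟨g, rfl⟩, _, rfl, rfl⟩
  refine ⟨g.coe, fun e v => ⟨rfl, rfl, ?_⟩⟩
  rw [((hasFDerivAt_heisMul g.coe e.1).prodMap e (hasFDerivAt_id (𝕜 := ℂ) e.2)).fderiv]
  exact ⟨rfl, rfl⟩

end Examples

/-! ### The flat operator `d d^c` and averages of forms -/

section Average

open Set Filter Topology MeasureTheory

variable {E : Type*} [NormedAddCommGroup E] [NormedSpace ℂ E]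

/-- The operator `d d^c` for forms on a vector space. -/
def ddcFlat {k : ℕ} (η : E → E [⋀^Fin k]→L[ℝ] ℂ) (e : E) : E [⋀^Fin (k + 1 + 1)]→L[ℝ] ℂ :=
  extDeriv (fun e => scaleL E (k + 1) (-Complex.I)
    (extDeriv (fun e => scaleL E k Complex.I (η e)) e)) e

/-- Pull-backs under affine maps commute with the exterior derivative. -/
lemma extDeriv_comp_affine {k : ℕ} {η : E → E [⋀^Fin k]→L[ℝ] ℂ} {A : E →L[ℂ] E} {b : E} {e : E}
    (hη : DifferentiableAt ℝ η (A e + b)) :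
    extDeriv (fun u => (η (A u + b)).compContinuousLinearMap (A.restrictScalars ℝ)) e =
      (extDeriv η (A e + b)).compContinuousLinearMap (A.restrictScalars ℝ) := by
  have h1 : ∀ u, fderiv ℝ (fun u => A u + b) u = A.restrictScalars ℝ := fun u =>
    ((A.restrictScalars ℝ).hasFDerivAt.add_const b).fderiv
  have h2 := extDeriv_pullback (f := fun u => A u + b) (x := e) (r := ∞) hη
    (((A.restrictScalars ℝ).contDiff.add contDiff_const).contDiffAt)
    (by rw [minSmoothness_of_isRCLikeNormedField]; exact WithTop.coe_le_coe.2 le_top)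
  simpa only [h1] using h2

lemma scaleL_comp {k : ℕ} (c : ℂ) (η : E [⋀^Fin k]→L[ℝ] ℂ) (A : E →L[ℂ] E) :
    scaleL E k c (η.compContinuousLinearMap (A.restrictScalars ℝ)) =
      (scaleL E k c η).compContinuousLinearMap (A.restrictScalars ℝ) := by
  ext v
  rw [scaleL_apply]
  change η (fun i => A (c • v i)) = scaleL E k c η (fun i => A (v i))
  rw [scaleL_apply]
  simp only [map_smul]

lemma contDiff_extDeriv {k : ℕ} {η : E → E [⋀^Fin k]→L[ℝ] ℂ} (hη : ContDiff ℝ ∞ η) :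
    ContDiff ℝ ∞ (extDeriv η) :=
  contDiffOn_univ.1 (contDiffOn_extDeriv isOpen_univ hη.contDiffOn)

lemma ddcFlat_comp_affine {k : ℕ} {η : E → E [⋀^Fin k]→L[ℝ] ℂ} (hη : ContDiff ℝ ∞ η)
    (A : E →L[ℂ] E) (b : E) (e : E) :
    ddcFlat (fun u => (η (A u + b)).compContinuousLinearMap (A.restrictScalars ℝ)) e =
      (ddcFlat η (A e + b)).compContinuousLinearMap (A.restrictScalars ℝ) := by
  have h1 : ContDiff ℝ ∞ fun e => scaleL E k Complex.I (η e) :=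
    (scaleL E k Complex.I).contDiff.comp hη
  have h2 : ContDiff ℝ ∞ fun e => scaleL E (k + 1) (-Complex.I)
      (extDeriv (fun e => scaleL E k Complex.I (η e)) e) :=
    (scaleL E (k + 1) (-Complex.I)).contDiff.comp (contDiff_extDeriv h1)
  have h3 : ∀ u, extDeriv (fun u => (scaleL E k Complex.I
      (η (A u + b))).compContinuousLinearMap (A.restrictScalars ℝ)) u =
      (extDeriv (fun e => scaleL E k Complex.I (η e)) (A u + b)).compContinuousLinearMap
        (A.restrictScalars ℝ) := fun u =>
    extDeriv_comp_affine (h1.differentiable (by simp) _)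
  simp only [ddcFlat, scaleL_comp, h3]
  exact extDeriv_comp_affine (h2.differentiable (by simp) _)

section Integral

variable {G : Type*} [NormedAddCommGroup G] [NormedSpace ℝ G] {k : ℕ}

lemma contDiff_extDeriv_param {f : E → G → E [⋀^Fin k]→L[ℝ] ℂ}
    (hf : ContDiff ℝ ∞ fun q : E × G => f q.1 q.2) :
    ContDiff ℝ ∞ fun q : E × G => extDeriv (fun p => f p q.2) q.1 := by
  have hd : ∀ q : E × G, fderiv ℝ (fun p => f p q.2) q.1 =
      (fderiv ℝ (fun q : E × G => f q.1 q.2) q).comp (ContinuousLinearMap.inl ℝ E G) := by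
    intro q
    have h1 := (hf.differentiable (by simp) q).hasFDerivAt
    have h2 := HasFDerivAt.comp (f := fun p : E => (p, q.2)) q.1 h1
      (hasFDerivAt_prodMk_left q.1 q.2)
    exact h2.fderiv
  have h3 : (fun q : E × G => extDeriv (fun p => f p q.2) q.1) = fun q =>
      ContinuousAlternatingMap.alternatizeUncurryFinCLM (n := k) ℝ E ℂ
        ((fderiv ℝ (fun q : E × G => f q.1 q.2) q).comp (ContinuousLinearMap.inl ℝ E G)) := by
    funext q
    rw [← hd]
    rfl
  rw [h3]
  have h4 : ContDiff ℝ ∞ fun q : E × G =>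
      (fderiv ℝ (fun q : E × G => f q.1 q.2) q).comp (ContinuousLinearMap.inl ℝ E G) :=
    (hf.fderiv_right (m := ∞) le_rfl).clm_comp contDiff_const
  exact (ContinuousAlternatingMap.alternatizeUncurryFinCLM (n := k) ℝ E ℂ).contDiff.comp h4

variable [MeasurableSpace G] [BorelSpace G] {ν : Measure G} [IsFiniteMeasureOnCompacts ν]
  {K : Set G}

lemma scaleL_integral {f : E → G → E [⋀^Fin k]→L[ℝ] ℂ} (hK : IsCompact K)
    (h0 : ∀ p, ∀ u, u ∉ K → f p u = 0) (hf : ContDiff ℝ ∞ fun q : E × G => f q.1 q.2) (c : ℂ)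
    (p : E) : scaleL E k c (∫ u, f p u ∂ν) = ∫ u, scaleL E k c (f p u) ∂ν :=
  ((scaleL E k c).integral_comp_comm (integrable_of_param (μ := ν) hK (fun p _ => h0 p)
    (s := univ) hf.contDiffOn (mem_univ p))).symm

variable [FiniteDimensional ℝ G]

/-- Differentiation of a form under the integral sign. -/
lemma extDeriv_integral {f : E → G → E [⋀^Fin k]→L[ℝ] ℂ} (hK : IsCompact K)
    (h0 : ∀ p, ∀ u, u ∉ K → f p u = 0) (hf : ContDiff ℝ ∞ fun q : E × G => f q.1 q.2) (p : E) :
    extDeriv (fun p => ∫ u, f p u ∂ν) p = ∫ u, extDeriv (fun p => f p u) p ∂ν := by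
  have hf' : ContDiffOn ℝ ∞ (fun q : E × G => f q.1 q.2) (univ ×ˢ univ) := hf.contDiffOn
  have h1 := hasFDerivAt_integral (μ := ν) (w := fun _ => 1) (locallyIntegrable_const 1)
    isOpen_univ hK (fun p _ => h0 p) hf' (mem_univ p)
  simp only [one_smul] at h1
  have h2 := (ContinuousAlternatingMap.alternatizeUncurryFinCLM ℝ E ℂ (n := k)).integral_comp_comm
    (integrable_fderiv_of_param (μ := ν) isOpen_univ hK (fun p _ => h0 p) hf' (mem_univ p))
  rw [extDeriv, h1.fderiv]
  exact h2.symm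

/-- The operator `d d^c` commutes with averages. -/
lemma ddcFlat_integral {f : E → G → E [⋀^Fin k]→L[ℝ] ℂ} (hK : IsCompact K)
    (h0 : ∀ p, ∀ u, u ∉ K → f p u = 0) (hf : ContDiff ℝ ∞ fun q : E × G => f q.1 q.2) (p : E) :
    ddcFlat (fun p => ∫ u, f p u ∂ν) p = ∫ u, ddcFlat (fun p => f p u) p ∂ν := by
  have h1 : ContDiff ℝ ∞ fun q : E × G => scaleL E k Complex.I (f q.1 q.2) :=
    (scaleL E k Complex.I).contDiff.comp hf
  have h10 : ∀ p, ∀ u, u ∉ K → scaleL E k Complex.I (f p u) = 0 := fun p u hu => by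
    rw [h0 p u hu, map_zero]
  have h2 := contDiff_extDeriv_param (f := fun p u => scaleL E k Complex.I (f p u)) h1
  have h20 : ∀ p, ∀ u, u ∉ K → extDeriv (fun p => scaleL E k Complex.I (f p u)) p = 0 :=
    fun p u hu => by
      have : (fun p => scaleL E k Complex.I (f p u)) = fun _ => 0 := funext fun p => h10 p u hu
      rw [this, extDeriv, fderiv_const_apply]
      exact map_zero (ContinuousAlternatingMap.alternatizeUncurryFinCLM ℝ E ℂ)
  have h3 : ContDiff ℝ ∞ fun q : E × G => scaleL E (k + 1) (-Complex.I)
      (extDeriv (fun p => scaleL E k Complex.I (f p q.2)) q.1) :=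
    (scaleL E (k + 1) (-Complex.I)).contDiff.comp h2
  have h30 : ∀ p, ∀ u, u ∉ K → scaleL E (k + 1) (-Complex.I)
      (extDeriv (fun p => scaleL E k Complex.I (f p u)) p) = 0 := fun p u hu => by
    rw [h20 p u hu, map_zero]
  rw [ddcFlat]
  simp only [scaleL_integral hK h0 hf, extDeriv_integral hK h10 h1, scaleL_integral hK h20 h2]
  exact extDeriv_integral hK h30 h3 p

end Integral

/-- Pulling back smooth forms by smooth fields of linear maps. -/
lemma contDiff_compContinuousLinearMap [FiniteDimensional ℂ E] {V : Type*} [NormedAddCommGroup V]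
    [NormedSpace ℝ V] {k : ℕ} {η : V → E [⋀^Fin k]→L[ℝ] ℂ} {A : V → E →L[ℝ] E}
    (hη : ContDiff ℝ ∞ η) (hA : ContDiff ℝ ∞ A) :
    ContDiff ℝ ∞ fun x => (η x).compContinuousLinearMap (A x) := by
  rw [← contDiffOn_univ]
  refine contDiffOn_covector fun v => contDiffOn_univ.2 ?_
  have h1 : ContDiff ℝ ∞ fun p : (Fin k → E →L[ℝ] E) ×
      (ContinuousMultilinearMap ℝ (fun _ : Fin k => E) ℂ) => p.2.compContinuousLinearMap p.1 :=
    contDiff_iff_contDiffAt.2 fun q =>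
      (ContinuousMultilinearMap.analyticAt_uncurry_compContinuousLinearMap (q := q)).contDiffAt
  have h2 := h1.comp ((contDiff_pi.2 fun _ => hA).prodMk
    ((ContinuousAlternatingMap.toContinuousMultilinearMapCLM (𝕜 := ℝ) (E := E) (F := ℂ)
      (ι := Fin k) ℝ).contDiff.comp hη))
  exact (ContinuousMultilinearMap.apply ℝ (fun _ : Fin k => E) ℂ v).contDiff.comp h2

end Average

/-! ### Forms on the Iwasawa manifold and their lifts -/

section Lift

open Set Filter Topology

variable {k : ℕ}

/-- The pull-back of a form on the Heisenberg group by a left translation. -/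
def pull (h : Cn 3) (η : Cn 3 → Cn 3 [⋀^Fin k]→L[ℝ] ℂ) (z : Cn 3) : Cn 3 [⋀^Fin k]→L[ℝ] ℂ :=
  (η (heisMul h z)).compContinuousLinearMap ((heisLin (h 0)).restrictScalars ℝ)

lemma pull_apply (h : Cn 3) (η : Cn 3 → Cn 3 [⋀^Fin k]→L[ℝ] ℂ) (z : Cn 3) (v : Fin k → Cn 3) :
    pull h η z v = η (heisMul h z) fun i => heisLin (h 0) (v i) := rfl

lemma heisLin_heisLin (a b : ℂ) (v : Cn 3) : heisLin a (heisLin b v) = heisLin (a + b) v := by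
  simp only [heisLin_apply]
  ext i
  fin_cases i <;> simp
  ring

lemma heisLin_zero (v : Cn 3) : heisLin 0 v = v := by
  rw [heisLin_apply]
  ext i
  fin_cases i <;> simp

lemma injective_heisLin (a : ℂ) : Function.Injective (heisLin a) := by
  intro v w h
  have := congrArg (heisLin (-a)) h
  rwa [heisLin_heisLin, heisLin_heisLin, neg_add_cancel, heisLin_zero, heisLin_zero] at this

lemma pull_pull (g h : Cn 3) (η : Cn 3 → Cn 3 [⋀^Fin k]→L[ℝ] ℂ) (z : Cn 3) :
    pull g (pull h η) z = pull (heisMul h g) η z := by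
  ext v
  rw [pull_apply, pull_apply, pull_apply, heisMul_assoc]
  have h0 : heisMul h g 0 = h 0 + g 0 := by simp [heisMul_apply, add_comm]
  simp only [heisLin_heisLin, h0]

lemma ddcFlat_pull {η : Cn 3 → Cn 3 [⋀^Fin k]→L[ℝ] ℂ} (hη : ContDiff ℝ ∞ η) (h : Cn 3)
    (z : Cn 3) : ddcFlat (pull h η) z = pull h (ddcFlat η) z :=
  ddcFlat_comp_affine hη (heisLin (h 0)) h z

/-- The lift of a form on the Iwasawa manifold to the Heisenberg group. -/
def lift (Ω : Form (Cn 3) Iwasawa k) (z : Cn 3) : Cn 3 [⋀^Fin k]→L[ℝ] ℂ :=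
  (Ω (iwasawaMk z)).compContinuousLinearMap
    ((fderiv ℂ (extChartAt 𝓘(ℂ, Cn 3) (iwasawaMk z) ∘ iwasawaMk) z).restrictScalars ℝ)

lemma inChart_eq_lift (Ω : Form (Cn 3) Iwasawa k) (x : Iwasawa) :
    inChart 𝓘(ℂ, Cn 3) Ω x = lift Ω := by
  funext e
  have h : ⇑(extChartAt 𝓘(ℂ, Cn 3) x).symm = iwasawaMk := funext (iwasawa_symm_apply x)
  rw [inChart_eq, transition, h]
  rfl

lemma exists_deck (z : Cn 3) : ∃ g : HeisLattice,
    heisMul g.coe z ∈ (extChartAt 𝓘(ℂ, Cn 3) (iwasawaMk z)).target ∧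
    heisMul g.coe z = extChartAt 𝓘(ℂ, Cn 3) (iwasawaMk z) (iwasawaMk z) ∧
    extChartAt 𝓘(ℂ, Cn 3) (iwasawaMk z) ∘ iwasawaMk =ᶠ[𝓝 z] heisMul g.coe := by
  set x := iwasawaMk z with hx
  have h1 : iwasawaMk (extChartAt 𝓘(ℂ, Cn 3) x x) = iwasawaMk z := by
    rw [← iwasawa_symm_apply x, extChartAt_to_inv]
  obtain ⟨g, hg⟩ := iwasawaMk_eq.1 h1
  have hg' : heisMul g.coe z = extChartAt 𝓘(ℂ, Cn 3) x x := hg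
  have ht : heisMul g.coe z ∈ (extChartAt 𝓘(ℂ, Cn 3) x).target := by
    rw [hg']; exact mem_extChartAt_target x
  refine ⟨g, ht, hg', ?_⟩
  filter_upwards [(contDiff_heisMul g.coe).continuous.continuousAt.eventually
    ((isOpen_extChartAt_target x).mem_nhds ht)] with u hu
  have h2 : iwasawaMk u = (extChartAt 𝓘(ℂ, Cn 3) x).symm (heisMul g.coe u) := by
    rw [iwasawa_symm_apply]
    exact (iwasawaMk_smul g u).symm
  rw [Function.comp_apply, h2, (extChartAt 𝓘(ℂ, Cn 3) x).right_inv hu]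

lemma lift_eq (Ω : Form (Cn 3) Iwasawa k) (z : Cn 3) : ∃ a : ℂ,
    lift Ω z = (Ω (iwasawaMk z)).compContinuousLinearMap ((heisLin a).restrictScalars ℝ) := by
  obtain ⟨g, -, -, hg⟩ := exists_deck z
  exact ⟨g.coe 0, by rw [lift, hg.fderiv_eq, (hasFDerivAt_heisMul _ _).fderiv]⟩

/-- The lift is invariant under the lattice. -/
lemma pull_lift (Ω : Form (Cn 3) Iwasawa k) (g : HeisLattice) : pull g.coe (lift Ω) = lift Ω := by
  funext z
  have hπ : iwasawaMk (heisMul g.coe z) = iwasawaMk z := iwasawaMk_smul g z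
  obtain ⟨g', -, -, hg'⟩ := exists_deck (heisMul g.coe z)
  have h1 : HasFDerivAt (extChartAt 𝓘(ℂ, Cn 3) (iwasawaMk z) ∘ iwasawaMk)
      (heisLin (g'.coe 0)) (heisMul g.coe z) := by
    rw [hπ] at hg'
    exact (hasFDerivAt_heisMul _ _).congr_of_eventuallyEq hg'
  have h2 : (extChartAt 𝓘(ℂ, Cn 3) (iwasawaMk z) ∘ iwasawaMk) =
      (extChartAt 𝓘(ℂ, Cn 3) (iwasawaMk z) ∘ iwasawaMk) ∘ heisMul g.coe := by
    funext u
    exact congrArg (extChartAt 𝓘(ℂ, Cn 3) (iwasawaMk z)) (iwasawaMk_smul g u).symm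
  have h3 : fderiv ℂ (extChartAt 𝓘(ℂ, Cn 3) (iwasawaMk z) ∘ iwasawaMk) z =
      (heisLin (g'.coe 0)).comp (heisLin (g.coe 0)) := by
    rw [h2]
    exact (h1.comp z (hasFDerivAt_heisMul g.coe z)).fderiv
  ext v
  rw [pull_apply, lift, lift, hπ, h1.fderiv, h3]
  rfl

lemma contDiff_lift {Ω : Form (Cn 3) Iwasawa k} (hΩ : IsSmooth 𝓘(ℂ, Cn 3) Ω) :
    ContDiff ℝ ∞ (lift Ω) := by
  refine contDiff_iff_contDiffAt.2 fun z => ?_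
  obtain ⟨g, hg, -, -⟩ := exists_deck z
  have h1 : ContDiffAt ℝ ∞ (lift Ω) (heisMul g.coe z) := by
    have := hΩ (iwasawaMk z)
    rw [inChart_eq_lift] at this
    exact this.contDiffAt ((isOpen_extChartAt_target _).mem_nhds hg)
  rw [← pull_lift Ω g]
  have h2 : ContDiffAt ℝ ∞ (heisMul g.coe) z :=
    (((contDiff_heisMul g.coe).restrict_scalars ℝ).of_le le_top).contDiffAt
  exact (ContinuousAlternatingMap.compContinuousLinearMapCLM
    ((heisLin (g.coe 0)).restrictScalars ℝ)).contDiff.contDiffAt.comp z (h1.comp z h2)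

lemma ddcFlat_lift {Ω : Form (Cn 3) Iwasawa k} (hΩ : IsSmooth 𝓘(ℂ, Cn 3) Ω)
    (h : extD 𝓘(ℂ, Cn 3) (extDc 𝓘(ℂ, Cn 3) Ω) = 0) (z : Cn 3) : ddcFlat (lift Ω) z = 0 := by
  obtain ⟨g, hg, -, -⟩ := exists_deck z
  have h1 := inChart_extD_extDc hΩ hg
  rw [h, inChart_eq_lift, inChart_eq_lift] at h1
  have h2 : ddcFlat (lift Ω) (heisMul g.coe z) = 0 := by
    rw [ddcFlat, ← h1]
    ext v
    rfl
  rw [← pull_lift Ω g, ddcFlat_pull (contDiff_lift hΩ), pull, h2]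
  rfl

lemma isTransverseAt_lift {p : ℕ} {Ω : Form (Cn 3) Iwasawa (2 * p)}
    (h : ∀ x, IsTransverseAt (Ω x)) (z : Cn 3) : IsTransverseAt (lift Ω z) := by
  obtain ⟨a, ha⟩ := lift_eq Ω z
  rw [ha]
  exact (h _).comp (injective_heisLin a)

end Lift

/-! ### The lattice and the Haar measure -/

section Haar

open Set Filter Topology MeasureTheory

instance : Countable HeisLattice := by
  have h1 : Function.Injective fun a : GaussianInt => (a.re, a.im) := fun a b h =>
    Zsqrtd.ext (congrArg Prod.fst h) (congrArg Prod.snd h)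
  have : Countable GaussianInt := h1.countable
  have h2 : Function.Injective fun g : HeisLattice => (g.a, g.b, g.c) := fun a b h => by
    simp only [Prod.mk.injEq] at h
    exact HeisLattice.ext h.1 h.2.1 h.2.2
  exact h2.countable

/-- The Haar measure of `ℂ^3`. -/
def haar : Measure (Cn 3) := Measure.addHaar

instance : haar.IsAddHaarMeasure := inferInstanceAs (Measure.addHaar (G := Cn 3)).IsAddHaarMeasure

/-- Affine maps whose linear part is a transvection preserve the measure. -/
lemma measurePreserving_transvection (f : Module.Dual ℂ (Cn 3)) (v b : Cn 3) (hf : f v = 0) :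
    MeasurePreserving (fun z => LinearMap.transvection f v z + b) haar haar := by
  set A : Cn 3 →ₗ[ℝ] Cn 3 := (LinearMap.transvection f v).restrictScalars ℝ with hA
  have hdet : LinearMap.det A = 1 := by
    have h1 : LinearMap.det A = _ := LinearMap.det_restrictScalars (f := LinearMap.transvection f v)
    rw [h1, LinearMap.transvection.det, hf, add_zero, map_one]
  have h2 : MeasurePreserving A haar haar := by
    refine ⟨(LinearMap.continuous_of_finiteDimensional A).measurable, ?_⟩
    rw [Measure.map_linearMap_addHaar_eq_smul_addHaar haar (by rw [hdet]; exact one_ne_zero), hdet]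
    simp
  exact (measurePreserving_add_right haar b).comp h2

lemma measurePreserving_heisMul_left (g : Cn 3) : MeasurePreserving (heisMul g) haar haar := by
  have h := measurePreserving_transvection
    (g 0 • (EuclideanSpace.proj 1 : Cn 3 →L[ℂ] ℂ).toLinearMap) (EuclideanSpace.single 2 1) g
    (by simp)
  convert h using 1
  funext z
  rw [heisMul_apply]
  ext i
  fin_cases i <;> simp [LinearMap.transvection]

lemma measurePreserving_heisMul_right (g : Cn 3) :
    MeasurePreserving (fun z => heisMul z g) haar haar := by
  have h := measurePreserving_transvection
    (g 1 • (EuclideanSpace.proj 0 : Cn 3 →L[ℂ] ℂ).toLinearMap) (EuclideanSpace.single 2 1) g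
    (by simp)
  convert h using 1
  funext z
  rw [heisMul_apply]
  ext i
  fin_cases i <;> simp [LinearMap.transvection]
  · ring
  · ring
  · ring

instance : SMulInvariantMeasure HeisLattice (Cn 3) haar where
  measure_preimage_smul g _ hs :=
    (measurePreserving_heisMul_left g.coe).measure_preimage hs.nullMeasurableSet

lemma measurableSet_unitCube : MeasurableSet unitCube := by
  have h : MeasurableSet unitSquare := by
    have h1 : unitSquare = Complex.re ⁻¹' Ico 0 1 ∩ Complex.im ⁻¹' Ico 0 1 := rfl
    rw [h1]
    exact (Complex.measurable_re measurableSet_Ico).inter (Complex.measurable_im measurableSet_Ico)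
  have h2 : unitCube = ⋂ i : Fin 3, (fun z : Cn 3 => z i) ⁻¹' unitSquare := by
    ext z
    simp [unitCube]
  rw [h2]
  exact MeasurableSet.iInter fun i =>
    (EuclideanSpace.proj i : Cn 3 →L[ℂ] ℂ).continuous.measurable h

/-- Functions invariant under the lattice have the same integrals over the unit cube and over its
right translates. -/
lemma setIntegral_heisMul_right {V : Type*} [NormedAddCommGroup V] [NormedSpace ℝ V]
    {F : Cn 3 → V} (hF : ∀ (γ : HeisLattice) z, F (γ • z) = F z) (g : Cn 3) :
    ∫ h in unitCube, F (heisMul h g) ∂haar = ∫ h in unitCube, F h ∂haar := by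
  set g' : Cn 3 := !₂[-g 0, -g 1, g 0 * g 1 - g 2] with hg'
  have h1 : ∀ z, heisMul (heisMul z g) g' = z := by
    intro z
    rw [heisMul_assoc]
    have : heisMul g g' = 0 := by
      rw [heisMul_apply]
      ext i
      fin_cases i <;> simp [hg']
      ring
    rw [this, heisMul_zero]
  have h2 : ∀ z, heisMul (heisMul z g') g = z := by
    intro z
    rw [heisMul_assoc]
    have : heisMul g' g = 0 := by
      rw [heisMul_apply]
      ext i
      fin_cases i <;> simp [hg']
      ring
    rw [this, heisMul_zero]
  have hcont : ∀ u : Cn 3, Continuous fun z => heisMul z u := by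
    intro u
    refine (PiLp.continuous_toLp 2 _).comp (continuous_pi fun i => ?_) |>.congr
      fun z => (heisMul_apply z u).symm
    fin_cases i <;> simp <;> fun_prop
  set Φ : Cn 3 ≃ₜ Cn 3 :=
    { toFun := fun z => heisMul z g
      invFun := fun z => heisMul z g'
      left_inv := h1
      right_inv := h2
      continuous_toFun := hcont g
      continuous_invFun := hcont g' }
  have hd1 : IsFundamentalDomain HeisLattice unitCube haar :=
    IsFundamentalDomain.mk' measurableSet_unitCube.nullMeasurableSet existsUnique_smul_mem_unitCube
  have hd2 : IsFundamentalDomain HeisLattice ((fun z => heisMul z g') ⁻¹' unitCube) haar := by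
    refine IsFundamentalDomain.mk'
      ((hcont g').measurable measurableSet_unitCube).nullMeasurableSet fun z => ?_
    have h3 : ∀ γ : HeisLattice, γ • z ∈ (fun z => heisMul z g') ⁻¹' unitCube ↔
        γ • heisMul z g' ∈ unitCube := fun γ => by
      rw [mem_preimage, HeisLattice.smul_def, HeisLattice.smul_def, heisMul_assoc]
    simp only [h3]
    exact existsUnique_smul_mem_unitCube _
  rw [hd1.setIntegral_eq hd2 hF]
  have h4 := (measurePreserving_heisMul_right g).setIntegral_preimage_emb
    Φ.measurableEmbedding F ((fun z => heisMul z g') ⁻¹' unitCube)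
  rw [← h4]
  congr 2
  ext z
  rw [mem_preimage, mem_preimage, h1]

end Haar

/-! ### Left-invariant two-forms on the Heisenberg group -/

section Invariant

open Set Filter Topology

/-- The central vector of the Heisenberg algebra. -/
def center : Cn 3 := EuclideanSpace.single 2 1

/-- The bilinear map with `heisLin (-z₀) v = v - shear z v`. -/
def shear : Cn 3 →ₗ[ℝ] Cn 3 →ₗ[ℝ] Cn 3 :=
  LinearMap.mk₂ ℝ (fun u v => (u 0 * v 1) • center)
    (fun u u' v => by simp [add_mul, add_smul]) (fun c u v => by
      simp [mul_assoc, mul_smul (c : ℂ)])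
    (fun u v v' => by simp [mul_add, add_smul]) (fun c u v => by
      simp [mul_left_comm, mul_smul (c : ℂ)])

lemma shear_apply (u v : Cn 3) : shear u v = (u 0 * v 1) • center := rfl

lemma heisLin_neg (z v : Cn 3) : heisLin (-z 0) v = v - shear z v := by
  rw [heisLin_apply, shear_apply]
  ext i
  fin_cases i <;> simp [center]
  ring

/-- A covector of degree two as a bilinear map. -/
def pairing (B : Cn 3 [⋀^Fin 2]→L[ℝ] ℂ) : Cn 3 →ₗ[ℝ] Cn 3 →ₗ[ℝ] ℂ :=
  have hu : ∀ x y z : Cn 3, Function.update ![x, z] 1 y = ![x, y] := fun x y z => by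
    ext i : 1
    fin_cases i <;> rfl
  LinearMap.mk₂ ℝ (fun x y => B ![x, y])
    (fun x x' y => B.toAlternatingMap.map_vecCons_add ![y] x x')
    (fun c x y => B.toAlternatingMap.map_vecCons_smul ![y] c x)
    (fun x y y' => by simpa only [hu] using B.map_update_add ![x, 0] 1 y y')
    (fun c x y => by simpa only [hu] using B.map_update_smul ![x, 0] 1 c y)

lemma pairing_apply (B : Cn 3 [⋀^Fin 2]→L[ℝ] ℂ) (x y : Cn 3) : pairing B x y = B ![x, y] := rfl

lemma apply_eq_pairing (B : Cn 3 [⋀^Fin 2]→L[ℝ] ℂ) (s : Fin 2 → Cn 3) :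
    B s = pairing B (s 0) (s 1) := by
  rw [pairing_apply]
  congr 1
  ext i : 1
  fin_cases i <;> rfl

lemma pairing_self (B : Cn 3 [⋀^Fin 2]→L[ℝ] ℂ) (x : Cn 3) : pairing B x x = 0 :=
  B.map_eq_zero_of_eq ![x, x] (i := 0) (j := 1) rfl (by decide)

lemma pairing_swap (B : Cn 3 [⋀^Fin 2]→L[ℝ] ℂ) (x y : Cn 3) : pairing B y x = -pairing B x y := by
  have h := pairing_self B (x + y)
  simp only [map_add, LinearMap.add_apply, pairing_self, zero_add, add_zero] at h
  exact eq_neg_of_add_eq_zero_left (by rw [← h])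

/-- The value of a covector of degree two on multiples of the central vector. -/
lemma pairing_center (B : Cn 3 [⋀^Fin 2]→L[ℝ] ℂ) (a c : ℂ) :
    pairing B (a • center) (c • center) =
      ((a.re * c.im - a.im * c.re : ℝ) : ℂ) * pairing B center (Complex.I • center) := by
  have h : ∀ a : ℂ, a • center = (a.re : ℝ) • center + (a.im : ℝ) • (Complex.I • center) := by
    intro a
    conv_lhs => rw [← Complex.re_add_im a, add_smul, mul_smul]
    rw [Complex.coe_smul, Complex.coe_smul]
  rw [h a, h c]
  simp only [map_add, LinearMap.add_apply, map_smul, LinearMap.smul_apply, pairing_self,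
    pairing_swap B center (Complex.I • center), smul_zero, zero_add, add_zero, Complex.real_smul]
  push_cast
  ring

/-- The form whose value at `z` is the left translate of `B`. -/
def invForm (B : Cn 3 [⋀^Fin 2]→L[ℝ] ℂ) (z : Cn 3) : Cn 3 [⋀^Fin 2]→L[ℝ] ℂ :=
  B.compContinuousLinearMap ((heisLin (-z 0)).restrictScalars ℝ)

lemma invForm_apply (B : Cn 3 [⋀^Fin 2]→L[ℝ] ℂ) (z : Cn 3) (s : Fin 2 → Cn 3) :
    invForm B z s = pairing B (s 0 - shear z (s 0)) (s 1 - shear z (s 1)) := by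
  rw [← heisLin_neg, ← heisLin_neg]
  exact apply_eq_pairing B fun i => heisLin (-z 0) (s i)

lemma contDiff_heisLin {V : Type*} [NormedAddCommGroup V] [NormedSpace ℝ V] {a : V → ℂ}
    (ha : ContDiff ℝ ∞ a) : ContDiff ℝ ∞ fun x => (heisLin (a x)).restrictScalars ℝ := by
  refine contDiff_clm_apply_iff.2 fun y => ?_
  have h : (fun x => (heisLin (a x)).restrictScalars ℝ y) =
      fun x => !₂[y 0, y 1, y 2 + a x * y 1] := funext fun x => heisLin_apply _ _
  rw [h, contDiff_piLp]
  intro i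
  fin_cases i <;> simp <;> fun_prop

lemma contDiff_coord (i : Fin 3) : ContDiff ℝ ∞ fun z : Cn 3 => z i :=
  ((EuclideanSpace.proj i : Cn 3 →L[ℂ] ℂ).restrictScalars ℝ).contDiff

lemma contDiff_invForm (B : Cn 3 [⋀^Fin 2]→L[ℝ] ℂ) : ContDiff ℝ ∞ (invForm B) :=
  contDiff_compContinuousLinearMap contDiff_const (contDiff_heisLin (contDiff_coord 0).neg)

/-- The derivative of a covector-valued map from its values on a line. -/
lemma fderiv_apply_eq {E : Type*} [NormedAddCommGroup E] [NormedSpace ℂ E] {k : ℕ}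
    {f : E → E [⋀^Fin k]→L[ℝ] ℂ} {z u : E} (hf : DifferentiableAt ℝ f z) {s : Fin k → E}
    {c₀ c₁ c₂ : ℂ} (h : ∀ r : ℝ, f (z + r • u) s = c₀ + r * c₁ + r ^ 2 * c₂) :
    fderiv ℝ f z u s = c₁ := by
  have h1 : HasFDerivAt (fun z => f z s)
      ((ContinuousAlternatingMap.apply ℝ E ℂ s).comp (fderiv ℝ f z)) z :=
    HasFDerivAt.comp (g := ContinuousAlternatingMap.apply ℝ E ℂ s) (f := f) z
      (ContinuousAlternatingMap.apply ℝ E ℂ s).hasFDerivAt hf.hasFDerivAt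
  have h2 : HasDerivAt (fun r : ℝ => f (z + r • u) s) (fderiv ℝ f z u s) 0 := by
    have h3 : HasDerivAt (fun r : ℝ => z + r • u) u 0 := by
      simpa using ((hasDerivAt_id (0 : ℝ)).smul_const u).const_add z
    exact HasFDerivAt.comp_hasDerivAt (f := fun r : ℝ => z + r • u) (0 : ℝ)
      (by simpa using h1) h3
  have h4 : HasDerivAt (fun r : ℝ => c₀ + (r : ℂ) * c₁ + (r : ℂ) ^ 2 * c₂) c₁ 0 := by
    have h5 : HasDerivAt (fun r : ℝ => (r : ℂ)) 1 0 := (hasDerivAt_id (0 : ℝ)).ofReal_comp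
    exact (((h5.mul_const c₁).const_add c₀).add ((h5.pow 2).mul_const c₂)).congr_deriv (by simp)
  simp only [h] at h2
  exact h2.unique h4

lemma fderiv_invForm (B : Cn 3 [⋀^Fin 2]→L[ℝ] ℂ) (z u : Cn 3) (s : Fin 2 → Cn 3) :
    fderiv ℝ (invForm B) z u s =
      -(pairing B (shear u (s 0)) (s 1 - shear z (s 1)) +
        pairing B (s 0 - shear z (s 0)) (shear u (s 1))) := by
  refine fderiv_apply_eq ((contDiff_invForm B).differentiable (by simp) z)
    (c₀ := invForm B z s) (c₂ := pairing B (shear u (s 0)) (shear u (s 1))) fun r => ?_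
  rw [invForm_apply, invForm_apply]
  simp only [map_add, map_sub, map_smul, LinearMap.add_apply, LinearMap.sub_apply,
    LinearMap.smul_apply, Complex.real_smul]
  ring

/-- The second derivative of `invForm B` in the directions `t`, `u`, at the arguments `v`, `w`. -/
def hess (B : Cn 3 [⋀^Fin 2]→L[ℝ] ℂ) (t u v w : Cn 3) : ℂ :=
  pairing B (shear u v) (shear t w) + pairing B (shear t v) (shear u w)

/-- As `invForm B` is a polynomial of degree two, `d d^c` at the origin is an alternating sum of its
constant second derivatives. -/
lemma ddcFlat_invForm (B : Cn 3 [⋀^Fin 2]→L[ℝ] ℂ) (y : Fin 4 → Cn 3) :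
    ddcFlat (invForm B) 0 y = ∑ j : Fin 4, (-1) ^ (j : ℕ) * ∑ i : Fin 3, (-1) ^ (i : ℕ) *
      hess B (y j) (-Complex.I • j.removeNth y i) (i.removeNth (j.removeNth y) 0)
        (i.removeNth (j.removeNth y) 1) := by
  have hs := contDiff_invForm B
  have h1 : (fun e => scaleL (Cn 3) (2 + 1) (-Complex.I)
      (extDeriv (fun e => scaleL (Cn 3) 2 Complex.I (invForm B e)) e)) = fun e =>
      ContinuousAlternatingMap.alternatizeUncurryFin ((fderiv ℝ (invForm B) e).comp
        (((-Complex.I) • ContinuousLinearMap.id ℂ (Cn 3)).restrictScalars ℝ)) := by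
    funext e
    exact scaleL_extDeriv_scaleL (hs.differentiable (by simp) e)
  have h2 : ContDiff ℝ ∞ fun e => scaleL (Cn 3) (2 + 1) (-Complex.I)
      (extDeriv (fun e => scaleL (Cn 3) 2 Complex.I (invForm B e)) e) :=
    (scaleL (Cn 3) (2 + 1) (-Complex.I)).contDiff.comp
      (contDiff_extDeriv ((scaleL (Cn 3) 2 Complex.I).contDiff.comp hs))
  rw [ddcFlat, extDeriv, ContinuousAlternatingMap.alternatizeUncurryFin_apply]
  refine Finset.sum_congr rfl fun j _ => ?_
  rw [← Int.cast_smul_eq_zsmul ℂ, smul_eq_mul]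
  push_cast
  congr 1
  refine fderiv_apply_eq (h2.differentiable (by simp) 0)
    (c₀ := ContinuousAlternatingMap.alternatizeUncurryFin ((fderiv ℝ (invForm B) 0).comp
        (((-Complex.I) • ContinuousLinearMap.id ℂ (Cn 3)).restrictScalars ℝ)) (j.removeNth y))
    (c₂ := 0) fun r => ?_
  rw [congrFun h1, ContinuousAlternatingMap.alternatizeUncurryFin_apply,
    ContinuousAlternatingMap.alternatizeUncurryFin_apply, mul_zero, add_zero, Finset.mul_sum,
    ← Finset.sum_add_distrib]
  refine Finset.sum_congr rfl fun i _ => ?_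
  have h3 : ∀ z v, (fderiv ℝ (invForm B) z).comp
      (((-Complex.I) • ContinuousLinearMap.id ℂ (Cn 3)).restrictScalars ℝ) v =
      fderiv ℝ (invForm B) z (-Complex.I • v) := fun _ _ => rfl
  rw [h3, h3, fderiv_invForm, fderiv_invForm, ← Int.cast_smul_eq_zsmul ℂ,
    ← Int.cast_smul_eq_zsmul ℂ, smul_eq_mul, smul_eq_mul, hess]
  simp only [map_sub, map_smul, LinearMap.sub_apply,
    LinearMap.smul_apply, Complex.real_smul, zero_add, map_zero, LinearMap.zero_apply, sub_zero]
  push_cast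
  ring

/-- The form `d d^c` of a left-invariant form detects its value on the centre. -/
lemma ddcFlat_invForm_frame (B : Cn 3 [⋀^Fin 2]→L[ℝ] ℂ) :
    ddcFlat (invForm B) 0 ![EuclideanSpace.single 0 1, EuclideanSpace.single 0 Complex.I,
      EuclideanSpace.single 1 1, EuclideanSpace.single 1 Complex.I] =
      4 * pairing B center (Complex.I • center) := by
  rw [ddcFlat_invForm]
  simp only [hess, shear_apply, pairing_center]
  simp [Fin.sum_univ_succ, Fin.removeNth, Fin.succAbove]
  ring

end Invariant

/-! ### The Iwasawa manifold is not pluriclosed -/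

section NotPluriclosed

open Set Filter Topology MeasureTheory

lemma exists_cutoff : ∃ (χ : Cn 3 → ℝ) (K : Set (Cn 3)), IsCompact K ∧ ContDiff ℝ ∞ χ ∧
    (∀ z ∉ K, χ z = 0) ∧ ∀ z ∈ unitCube, χ z = 1 := by
  obtain ⟨K, hK, hQ⟩ := exists_isCompact_unitCube_subset
  obtain ⟨R, hR⟩ := hK.isBounded.subset_closedBall 0
  set χ : ContDiffBump (0 : Cn 3) := ⟨max R 1, max R 1 + 1, by positivity, by linarith⟩
  refine ⟨χ, Metric.closedBall 0 (max R 1 + 1), isCompact_closedBall _ _, χ.contDiff,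
    fun z hz => ?_, fun z hz => ?_⟩
  · have h : z ∉ tsupport χ := by rw [χ.tsupport_eq]; exact hz
    exact image_eq_zero_of_notMem_tsupport h
  · exact χ.one_of_mem_closedBall
      (Metric.closedBall_subset_closedBall (le_max_left _ _) (hR (hQ hz)))

lemma ddcFlat_smul {E : Type*} [NormedAddCommGroup E] [NormedSpace ℂ E] {k : ℕ} (c : ℝ)
    (η : E → E [⋀^Fin k]→L[ℝ] ℂ) (e : E) :
    ddcFlat (fun e => c • η e) e = c • ddcFlat η e := by
  have h : ∀ {l : ℕ} (θ : E → E [⋀^Fin l]→L[ℝ] ℂ) (e : E),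
      extDeriv (fun e => c • θ e) e = c • extDeriv θ e := fun θ e => extDeriv_smul c θ
  simp only [ddcFlat, map_smul, h]

/-- A transverse form of bidegree `(1, 1)` on the Heisenberg group which is invariant under the
lattice is not annihilated by `d d^c`. -/
lemma exists_ddcFlat_ne_zero {η : Cn 3 → Cn 3 [⋀^Fin 2]→L[ℝ] ℂ} (hη : ContDiff ℝ ∞ η)
    (hinv : ∀ γ : HeisLattice, pull γ.coe η = η)
    (hpos : ∀ z, 0 < (η z ![center, Complex.I • center]).re) : ∃ z, ddcFlat η z ≠ 0 := by
  by_contra! hdd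
  obtain ⟨χ, K, hK, hχ, hχK, hχQ⟩ := exists_cutoff
  set ν : Measure (Cn 3) := haar.restrict unitCube with hν
  set f : Cn 3 → Cn 3 → Cn 3 [⋀^Fin 2]→L[ℝ] ℂ := fun z h => χ h • pull h η z with hf
  have h0 : ∀ p, ∀ u, u ∉ K → f p u = 0 := fun p u hu => by
    ext v
    simp [hf, hχK u hu]
  have hmul : ContDiff ℝ ∞ fun q : Cn 3 × Cn 3 => heisMul q.2 q.1 := by
    have h1 : (fun q : Cn 3 × Cn 3 => heisMul q.2 q.1) = fun q =>
        (heisLin (q.2 0)).restrictScalars ℝ q.1 + q.2 := rfl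
    rw [h1]
    exact ((contDiff_heisLin ((contDiff_coord 0).comp contDiff_snd)).clm_apply contDiff_fst).add
      contDiff_snd
  have hfs : ContDiff ℝ ∞ fun q : Cn 3 × Cn 3 => f q.1 q.2 :=
    (hχ.comp contDiff_snd).smul (contDiff_compContinuousLinearMap (hη.comp hmul)
      (contDiff_heisLin ((contDiff_coord 0).comp contDiff_snd)))
  have hint : ∀ p, Integrable (f p) ν := fun p =>
    integrable_of_param hK (fun p _ => h0 p) (s := univ) hfs.contDiffOn (mem_univ p)
  have hone : ∀ p, ∫ h, f p h ∂ν = ∫ h in unitCube, pull h η p ∂haar := fun p =>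
    setIntegral_congr_fun measurableSet_unitCube fun h hh => by
      change χ h • pull h η p = pull h η p
      rw [hχQ h hh, one_smul]
  set B : Cn 3 [⋀^Fin 2]→L[ℝ] ℂ := ∫ h, f 0 h ∂ν with hB
  -- the average is left-invariant, since its integrand is a function on the right quotient
  have havg : (fun p => ∫ h, f p h ∂ν) = invForm B := by
    funext g
    have h1 : ∀ (γ : HeisLattice) z, pull (γ • z) η 0 = pull z η 0 := fun γ z => by
      rw [HeisLattice.smul_def, ← pull_pull, hinv]
    have h2 := setIntegral_heisMul_right (F := fun z => pull z η 0) h1 g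
    have h3 : ∀ h, pull (heisMul h g) η 0 =
        (ContinuousAlternatingMap.compContinuousLinearMapCLM
          ((heisLin (g 0)).restrictScalars ℝ)) (pull h η g) := fun h => by
      rw [← pull_pull, pull, heisMul_zero]
      rfl
    have h4 : (ContinuousAlternatingMap.compContinuousLinearMapCLM
        ((heisLin (g 0)).restrictScalars ℝ)) (∫ h, f g h ∂ν) = B := by
      rw [hB, hone, hone, ← h2]
      simp only [h3]
      rw [ContinuousLinearMap.integral_comp_comm]
      have := hint g
      exact this.congr (ae_restrict_of_forall_mem measurableSet_unitCube fun h hh => by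
        change χ h • pull h η g = pull h η g
        rw [hχQ h hh, one_smul])
    rw [← h4]
    ext v
    change _ = (∫ h, f g h ∂ν) fun i => heisLin (g 0) (heisLin (-g 0) (v i))
    simp only [heisLin_heisLin, add_neg_cancel, heisLin_zero]
  have hzero : ddcFlat (invForm B) 0 = 0 := by
    rw [← havg, ddcFlat_integral hK h0 hfs]
    have h1 : ∀ h, ddcFlat (fun p => f p h) 0 = 0 := fun h => by
      have h2 : ddcFlat (fun p => pull h η p) 0 = 0 := by
        refine (ddcFlat_pull hη h 0).trans ?_
        rw [pull, hdd]
        rfl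
      rw [hf, ddcFlat_smul, h2]
      ext v
      simp
    simp only [h1, integral_zero]
  have hβ : pairing B center (Complex.I • center) = 0 := by
    have h1 := ddcFlat_invForm_frame B
    rw [hzero] at h1
    have h2 : (4 : ℂ) * pairing B center (Complex.I • center) = 0 := h1.symm
    simpa using h2
  -- the real part of this value is the integral of a positive function
  set Λ : Cn 3 [⋀^Fin 2]→L[ℝ] ℂ →L[ℝ] ℝ :=
    Complex.reCLM.comp (ContinuousAlternatingMap.apply ℝ (Cn 3) ℂ ![center, Complex.I • center])
    with hΛ
  have hval : ∀ h ∈ unitCube, 0 < Λ (f 0 h) := by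
    intro h hh
    have h1 : ∀ a c : ℂ, heisLin a (c • center) = c • center := by
      intro a c
      rw [heisLin_apply]
      ext i
      fin_cases i <;> simp [center]
    have h2 : (fun i => heisLin (h 0) (![center, Complex.I • center] i)) =
        ![center, Complex.I • center] := by
      funext i
      fin_cases i
      · simpa using h1 (h 0) 1
      · exact h1 (h 0) Complex.I
    have h3 : Λ (f 0 h) = χ h • (η (heisMul h 0) fun i =>
        heisLin (h 0) (![center, Complex.I • center] i)).re := by
      change ((χ h • pull h η 0) ![center, Complex.I • center]).re = _
      rw [ContinuousAlternatingMap.smul_apply, Complex.smul_re]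
      rfl
    rw [h3, hχQ h hh, h2, one_smul]
    exact hpos _
  have hposint : 0 < ∫ h, Λ (f 0 h) ∂ν := by
    have hi : IntegrableOn (fun h => Λ (f 0 h)) unitCube haar := Λ.integrable_comp (hint 0)
    refine (setIntegral_pos_iff_support_of_nonneg_ae
      (ae_restrict_of_forall_mem measurableSet_unitCube fun h hh => (hval h hh).le) hi).2 ?_
    have h1 : unitCube ⊆ Function.support (fun h => Λ (f 0 h)) ∩ unitCube := fun h hh =>
      ⟨(hval h hh).ne', hh⟩
    refine lt_of_lt_of_le (pos_iff_ne_zero.2 ?_) (measure_mono h1)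
    have hd : IsFundamentalDomain HeisLattice unitCube haar :=
      IsFundamentalDomain.mk' measurableSet_unitCube.nullMeasurableSet
        existsUnique_smul_mem_unitCube
    exact hd.measure_ne_zero (NeZero.ne haar)
  rw [Λ.integral_comp_comm (hint 0)] at hposint
  have hre : Λ B = (pairing B center (Complex.I • center)).re := rfl
  rw [← hB, hre, hβ, Complex.zero_re] at hposint
  exact lt_irrefl _ hposint

/-- The Iwasawa manifold is not `1`-Kähler of any type: all four types have `d d^c Ω = 0` in degree
one. -/
theorem not_isPKahler_iwasawa (τ : KahlerType) : ¬ IsPKahler 𝓘(ℂ, Cn 3) Iwasawa τ 1 := by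
  rintro ⟨Ω, hΩ⟩
  have hframe : ∀ z, 0 < (lift Ω z ![center, Complex.I • center]).re := by
    intro z
    have hc : center ≠ 0 := by simp [center]
    have h1 := isTransverseAt_lift hΩ.transverse z (fun _ => center)
      (LinearIndependent.of_subsingleton 0 hc)
    have h2 : complexFrame (fun _ : Fin 1 => center) = ![center, Complex.I • center] := by
      funext i
      fin_cases i
      · exact (congrArg (· • center) (if_pos rfl)).trans (one_smul ℂ center)
      · exact congrArg (· • center) (if_neg (by decide))
    rw [h2] at h1
    exact h1
  obtain ⟨z, hz⟩ := exists_ddcFlat_ne_zero (contDiff_lift hΩ.smooth) (pull_lift Ω) hframe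
  exact hz (ddcFlat_lift hΩ.smooth hΩ.extD_extDc_eq_zero z)

end NotPluriclosed

/-! ### Failure of sharpness for the plane and the Iwasawa manifold -/

section Failure

/-- In codimension one there is a single form on each factor, and the conditions on `∂Ω_{p+a}` and
`∂Φ_{q+a}` are void. -/
lemma hasPositiveForms_of_codim_one {τ : KahlerType} {p q : ℕ}
    {X : Type*} [TopologicalSpace X] [ChartedSpace (Cn (p + 1)) X]
    {Y : Type*} [TopologicalSpace Y] [ChartedSpace (Cn (q + 1)) Y]
    (hX : ∃ Ω : Form (Cn (p + 1)) X (2 * p), IsKahlerForm 𝓘(ℂ, Cn (p + 1)) τ Ω ∧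
      ∀ x, IsPositiveAt (Ω x))
    (hY : ∃ Φ : Form (Cn (q + 1)) Y (2 * q), IsKahlerForm 𝓘(ℂ, Cn (q + 1)) τ Φ ∧
      ∀ y, IsPositiveAt (Φ y)) : HasPositiveForms τ (p + 1) (q + 1) p q X Y := by
  obtain ⟨Ω, hΩ⟩ := hX
  obtain ⟨Φ, hΦ⟩ := hY
  refine ⟨Function.update (fun _ => 0) p Ω, Function.update (fun _ => 0) q Φ, ?_, ?_, ?_, ?_⟩
  · intro s h1 h2
    obtain rfl : s = p := by omega
    rwa [Function.update_self]
  · intro s h1 h2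
    obtain rfl : s = q := by omega
    rwa [Function.update_self]
  · intro _ a h1 h2
    omega
  · intro _ a h1 h2
    omega

variable (τ : KahlerType)

lemma exists_positive_plane : ∃ Ω : Form (Cn 2) (Cn 2) (2 * 1),
    IsKahlerForm 𝓘(ℂ, Cn 2) τ Ω ∧ ∀ x, IsPositiveAt (Ω x) := by
  obtain ⟨Ω, h1, h2⟩ := exists_isKahlerForm_plane
  exact ⟨Ω, h1.of_kahler le_rfl τ, h2⟩

lemma exists_positive_iwasawa : ∃ Ω : Form (Cn 3) Iwasawa (2 * 2),
    IsKahlerForm 𝓘(ℂ, Cn 3) τ Ω ∧ ∀ x, IsPositiveAt (Ω x) := by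
  obtain ⟨Ω, h1, h2⟩ := exists_isKahlerForm_iwasawa
  exact ⟨Ω, h1.of_kahler one_le_two τ, h2⟩

lemma generalSetting_plane_iwasawa : GeneralSetting τ 2 3 1 2 (Cn 2) Iwasawa where
  one_le_p := le_rfl
  p_le_m := by norm_num
  one_le_q := by norm_num
  q_le_n := by norm_num
  ne_one_one := by simp
  left_index h := by omega
  right_index h := by omega
  forms := hasPositiveForms_of_codim_one (exists_positive_plane τ) (exists_positive_iwasawa τ)
  minimal_left h := by omega
  minimal_right _ := not_isPKahler_iwasawa τ

lemma generalSetting_iwasawa_plane : GeneralSetting τ 3 2 2 1 Iwasawa (Cn 2) where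
  one_le_p := by norm_num
  p_le_m := by norm_num
  one_le_q := le_rfl
  q_le_n := by norm_num
  ne_one_one := by simp
  left_index h := by omega
  right_index h := by omega
  forms := hasPositiveForms_of_codim_one (exists_positive_iwasawa τ) (exists_positive_plane τ)
  minimal_left _ := not_isPKahler_iwasawa τ
  minimal_right h := by omega

lemma kahlerSetting_plane_iwasawa : KahlerSetting τ 2 3 2 (Cn 2) Iwasawa where
  one_le_m := by norm_num
  one_le_q := by norm_num
  q_le_n := by norm_num
  ne_one_one := by simp
  kahler_left := by
    obtain ⟨Ω, h, -⟩ := exists_isKahlerForm_plane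
    exact ⟨Ω, h⟩
  kahler_right s h1 h2 := by
    obtain rfl : s = 2 := by omega
    obtain ⟨Ω, h, -⟩ := exists_positive_iwasawa τ
    exact ⟨Ω, h⟩
  minimal_right := not_isPKahler_iwasawa τ

lemma productIsPKahler_plane_iwasawa : ProductIsPKahler τ 2 3 (Cn 2) Iwasawa 3 := by
  obtain ⟨Ω, h⟩ := isPKahler_plane_iwasawa
  exact ⟨Ω, h.of_kahler (by norm_num) τ⟩

lemma productIsPKahler_iwasawa_plane : ProductIsPKahler τ 3 2 Iwasawa (Cn 2) 3 := by
  obtain ⟨Ω, h⟩ := isPKahler_iwasawa_plane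
  exact ⟨Ω, h.of_kahler (by norm_num) τ⟩

end Failure

end GenKahler

end

theorem proposition5p6 :
    -- both bounds are sharp if both manifolds are compact
    (∀ (τ : GenKahler.KahlerType) (m n p q : ℕ)
      (X : Type*) [TopologicalSpace X] [ChartedSpace (GenKahler.Cn m) X]
      [IsManifold 𝓘(ℂ, GenKahler.Cn m) ω X] [T2Space X] [Nonempty X] [CompactSpace X]
      (Y : Type*) [TopologicalSpace Y] [ChartedSpace (GenKahler.Cn n) Y]
      [IsManifold 𝓘(ℂ, GenKahler.Cn n) ω Y] [T2Space Y] [Nonempty Y] [CompactSpace Y],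
      (GenKahler.GeneralSetting τ m n p q X Y →
        ¬ GenKahler.ProductIsPKahler τ m n X Y (GenKahler.generalBound m n p q - 1)) ∧
      (GenKahler.KahlerSetting τ m n q X Y →
        ¬ GenKahler.ProductIsPKahler τ m n X Y (m + q - 1))) ∧
    -- neither bound is sharp in general if one of the manifolds is not compact
    (∃ (m n p q : ℕ)
      (X : Type) (_ : TopologicalSpace X) (_ : ChartedSpace (GenKahler.Cn m) X)
      (Y : Type) (_ : TopologicalSpace Y) (_ : ChartedSpace (GenKahler.Cn n) Y),
      IsManifold 𝓘(ℂ, GenKahler.Cn m) ω X ∧ T2Space X ∧ SecondCountableTopology X ∧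
      ConnectedSpace X ∧ ¬ CompactSpace X ∧
      IsManifold 𝓘(ℂ, GenKahler.Cn n) ω Y ∧ T2Space Y ∧ SecondCountableTopology Y ∧
      ConnectedSpace Y ∧ CompactSpace Y ∧
      ∀ τ : GenKahler.KahlerType,
        (GenKahler.GeneralSetting τ m n p q X Y ∧
          GenKahler.ProductIsPKahler τ m n X Y (GenKahler.generalBound m n p q - 1)) ∧
        (GenKahler.GeneralSetting τ n m q p Y X ∧
          GenKahler.ProductIsPKahler τ n m Y X (GenKahler.generalBound n m q p - 1)) ∧
        (GenKahler.KahlerSetting τ m n q X Y ∧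
          GenKahler.ProductIsPKahler τ m n X Y (m + q - 1))) := by
  refine ⟨?_, ?_⟩
  · intro τ m n p q X _ _ _ _ _ _ Y _ _ _ _ _ _
    exact ⟨fun h => h.not_productIsPKahler, fun h => h.not_productIsPKahler⟩
  · refine ⟨2, 3, 1, 2, GenKahler.Cn 2, inferInstance, inferInstance, GenKahler.Iwasawa,
      inferInstance, inferInstance, inferInstance, inferInstance, inferInstance, inferInstance,
      not_compactSpace_iff.2 (NormedSpace.noncompactSpace ℂ _), inferInstance, inferInstance,
      inferInstance, inferInstance, inferInstance, fun τ => ⟨?_, ?_, ?_⟩⟩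
    · exact ⟨GenKahler.generalSetting_plane_iwasawa τ, GenKahler.productIsPKahler_plane_iwasawa τ⟩
    · exact ⟨GenKahler.generalSetting_iwasawa_plane τ, GenKahler.productIsPKahler_iwasawa_plane τ⟩
    · exact ⟨GenKahler.kahlerSetting_plane_iwasawa τ, GenKahler.productIsPKahler_plane_iwasawa τ⟩
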